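/- Let $M$ be a complete smooth Riemannian manifold (finite-dimensional, without boundary, not necessarily compact or connected; complete means complete as a metric space for the Riemannian distance $d$, with $d=\infty$ between different components). Let $f:M\to M$ be a $C^1$-diffeomorphism whose derivative is uniformly bounded: there is $C$ with $\|Tf\,v\|\le C\|v\|$ for all $v\in TM$. A foliation means a continuous foliation with $C^1$ leaves; it is tangent to a subbundle $E\subset TM$ if the tangent space of the leaf through each point $x$ is $E_x$. For a foliation $W$, $W(x)$ is the leaf through $x$ and $d_W$ is the distance measured along leaves (the infimum of lengths of $C^1$ curves contained in the leaf). $W$ is quasi-isometric if there is $Q>1$ such that $d_W(x,y)\le Q\,d(x,y)$ for all $x,y$ lying on the same leaf of $W$. Suppose $E\subset TM$ is a continuous $Tf$-invariant subbundle which is uniquely integrable with tangent foliation $W$, that is, $W$ is tangent to $E$ and every $C^1$ curve $\gamma:[0,1]\to M$ tangent to $E$ lies in a single leaf of $W$. Suppose that $E=E^c\oplus E^u$ with $E^c,E^u$ continuous $Tf$-invariant subbundles such that $E^u$ absolutely dominates $E^c$: there is an integer $n>0$ such that $$\|Tf^n u\|<\tfrac12\|Tf^n v\|$$ for all $x,y\in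 M$ and all unit vectors $u\in E^c_x$, $v\in E^u_y$. Suppose finally that $W^c$ and $W^u$ are quasi-isometric foliations tangent to $E^c$ and $E^u$ respectively. Then for any two points $x,y$ on the same leaf of $W$, the intersection $W^c(x)\cap W^u(y)$ consists of exactly one point. -/

import Mathlib

open Set Bundle Manifold
open scoped ContDiff ENNReal Topology

/-- A foliated chart on a manifold `M` (modelled on `I`) with `C¹` plaques: a homeomorphism `φ` from
an open subset of `M` onto `ℝᵏ × ℝˡ` such that each plaque `φ⁻¹(ℝᵏ × {c})` is `C¹`-immersed in `M`
by the parametrization `a ↦ φ⁻¹(a, c)`. The chart is only required to be continuous in the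
transverse direction. -/
structure FoliatedChart {V : Type*} [NormedAddCommGroup V] [NormedSpace ℝ V]
    {H : Type*} [TopologicalSpace H] (I : ModelWithCorners ℝ V H)
    (M : Type*) [TopologicalSpace M] [ChartedSpace H M] where
  /-- dimension of the leaves -/
  k : ℕ
  /-- codimension of the leaves -/
  l : ℕ
  /-- the chart -/
  chart : OpenPartialHomeomorph M (EuclideanSpace ℝ (Fin k) × EuclideanSpace ℝ (Fin l))
  target_eq : chart.target = univ
  contMDiff_plaque : ∀ c, ContMDiff (𝓡 k) I 1 (fun a => chart.symm (a, c))
  injective_plaque : ∀ c a,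
    Function.Injective (mfderiv (𝓡 k) I (fun a => chart.symm (a, c)) a)

/-- A (continuous) foliation of `M` with `C¹` leaves, given by a foliated atlas: foliated charts
cover `M`, and the transition maps locally send plaques to plaques. -/
structure Foliation {V : Type*} [NormedAddCommGroup V] [NormedSpace ℝ V]
    {H : Type*} [TopologicalSpace H] (I : ModelWithCorners ℝ V H)
    (M : Type*) [TopologicalSpace M] [ChartedSpace H M] where
  /-- the foliated atlas -/
  atlas : Set (FoliatedChart I M)
  cover : ∀ p : M, ∃ φ ∈ atlas, p ∈ φ.chart.source
  compatible : ∀ φ ∈ atlas, ∀ ψ ∈ atlas, ∀ p ∈ φ.chart.source ∩ ψ.chart.source,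
    ∃ U ∈ 𝓝 p, U ⊆ φ.chart.source ∩ ψ.chart.source ∧ ∀ x ∈ U, ∀ y ∈ U,
      ((φ.chart x).2 = (φ.chart y).2 ↔ (ψ.chart x).2 = (ψ.chart y).2)

section Defs

variable {V : Type*} [NormedAddCommGroup V] [NormedSpace ℝ V]
  {H : Type*} [TopologicalSpace H] {I : ModelWithCorners ℝ V H}

section Foliation

variable {M : Type*} [TopologicalSpace M] [ChartedSpace H M]

/-- `x` and `y` lie on a common plaque of the foliation. -/
def Foliation.SamePlaque (W : Foliation I M) (x y : M) : Prop :=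
  ∃ φ ∈ W.atlas, x ∈ φ.chart.source ∧ y ∈ φ.chart.source ∧ (φ.chart x).2 = (φ.chart y).2

/-- The leaf through `x`: all points that can be joined to `x` by a finite chain of plaques. -/
def Foliation.leaf (W : Foliation I M) (x : M) : Set M :=
  {y | Relation.EqvGen W.SamePlaque x y}

/-- The foliation `W` is tangent to the family of tangent subspaces `E`, that is, `T W = E`. -/
def Foliation.IsTangentTo (W : Foliation I M) (E : ∀ x : M, Submodule ℝ (TangentSpace I x)) :
    Prop :=
  ∀ φ ∈ W.atlas, ∀ a c,
    (mfderiv (𝓡 φ.k) I (fun a => φ.chart.symm (a, c)) a).range = E (φ.chart.symm (a, c))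

/-- `E` is a continuous subbundle of the tangent bundle: near each point it has a continuous frame.
(The rank is locally constant.) -/
def IsContinuousSubbundle [IsManifold I 1 M]
    (E : ∀ x : M, Submodule ℝ (TangentSpace I x)) : Prop :=
  ∀ p : M, ∃ (k : ℕ) (U : Set M) (X : Fin k → ∀ x : M, TangentSpace I x), U ∈ 𝓝 p ∧
    (∀ i, ContinuousOn (fun x => (⟨x, X i x⟩ : TangentBundle I M)) U) ∧
    ∀ x ∈ U, LinearIndependent ℝ (fun i => X i x) ∧
      Submodule.span ℝ (range fun i => X i x) = E x

/-- `E` is invariant under the derivative of `f`: `Tf (E x) = E (f x)`. -/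
def IsTangentInvariant (f : M → M) (E : ∀ x : M, Submodule ℝ (TangentSpace I x)) : Prop :=
  ∀ x : M, (E x).map (mfderiv I I f x).toLinearMap = E (f x)

/-- `E = E₁ ⊕ E₂` is a splitting of `E` into continuous `Tf`-invariant subbundles. -/
def IsSplitting [IsManifold I 1 M]
    (f : M → M) (E E₁ E₂ : ∀ x : M, Submodule ℝ (TangentSpace I x)) : Prop :=
  IsContinuousSubbundle E₁ ∧ IsTangentInvariant f E₁ ∧
  IsContinuousSubbundle E₂ ∧ IsTangentInvariant f E₂ ∧
  ∀ x : M, E₁ x ⊔ E₂ x = E x ∧ Disjoint (E₁ x) (E₂ x)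

/-- `E` is uniquely integrable with tangent foliation `W`: `T W = E` and every `C¹` curve
`γ : [0,1] → M` tangent to `E` lies in a single leaf of `W`. -/
def IsUniquelyIntegrableBy (E : ∀ x : M, Submodule ℝ (TangentSpace I x)) (W : Foliation I M) :
    Prop :=
  W.IsTangentTo E ∧
  ∀ γ : ℝ → M, ContMDiffOn 𝓘(ℝ, ℝ) I 1 γ (Icc 0 1) →
    (∀ t ∈ Icc (0 : ℝ) 1, mfderivWithin 𝓘(ℝ, ℝ) I γ (Icc 0 1) t (1 : ℝ) ∈ E (γ t)) →
    ∀ t ∈ Icc (0 : ℝ) 1, γ t ∈ W.leaf (γ 0)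

end Foliation

section Riemannian

variable {M : Type*} [EMetricSpace M] [ChartedSpace H M]
  [RiemannianBundle (fun x : M => TangentSpace I x)]

/-- `E₂` absolutely dominates `E₁` under `f`. -/
def AbsolutelyDominates (f : M → M) (E₂ E₁ : ∀ x : M, Submodule ℝ (TangentSpace I x)) : Prop :=
  ∃ n : ℕ, 0 < n ∧ ∀ (x y : M) (u : TangentSpace I x) (v : TangentSpace I y),
    u ∈ E₁ x → v ∈ E₂ y → ‖u‖ = 1 → ‖v‖ = 1 →
      ‖mfderiv I I f^[n] x u‖ < 1 / 2 * ‖mfderiv I I f^[n] y v‖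

variable (I) in
/-- The derivative of `f` is uniformly bounded. -/
def HasBoundedDerivative (f : M → M) : Prop :=
  ∃ C : ℝ, ∀ (x : M) (v : TangentSpace I x), ‖mfderiv I I f x v‖ ≤ C * ‖v‖

/-- The distance `d_W` measured along the leaves of `W`: the infimum of the lengths of the
`C¹` curves in the leaf that join the two points (`∞` if there are none). -/
noncomputable def Foliation.leafEDist (W : Foliation I M) (x y : M) : ℝ≥0∞ :=
  ⨅ (γ : ℝ → M) (_ : ContMDiffOn 𝓘(ℝ, ℝ) I 1 γ (Icc 0 1)) (_ : γ 0 = x) (_ : γ 1 = y)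
    (_ : ∀ t ∈ Icc (0 : ℝ) 1, γ t ∈ W.leaf x), pathELength I γ 0 1

/-- `W` is quasi-isometric: `d_W(x, y) ≤ Q d(x, y)` for all `x`, `y` on a common leaf. -/
def Foliation.IsQuasiIsometric (W : Foliation I M) : Prop :=
  ∃ Q : ℝ, 1 < Q ∧ ∀ x y : M, y ∈ W.leaf x → W.leafEDist x y ≤ ENNReal.ofReal Q * edist x y

end Riemannian

end Defs

/-! Absolute domination provides, for every `ε > 0`, an iterate `h` of `f` that stretches `Ec` at
most by `a` and whose inverse stretches `Eu` at most by `b`, with `a * b ≤ ε`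
(`AbsolutelyDominates.exists_separatesBundles`). The rates are uniform over `M`, so quasi-isometry
turns them into inequalities between ambient distances of points on a common leaf, with constants
`Qc`, `Qu` that do not depend on `ε`.

Uniqueness: if `z`, `z'` share a `Wc`-leaf and a `Wu`-leaf, going forward by `h` along `Wc` and back
along `Wu` gives `d(z,z') ≤ ε Qc Qu d(z,z')`, hence `z = z'` (`eq_of_mem_leaf`). The way back needs
`Wu` to be invariant, which follows from unique integrability of `Eu`
(`isUniquelyIntegrableBy_right`): for a curve tangent to `Eu`, the leaf of `h(Wc)` through a point
of the curve meets the expected plaque of `Wu` at a point `q`; seen through `h⁻¹` the two points are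
`O(b)` apart, so they are `O(ab)` apart, and `ε → 0` puts the curve in the plaque. Invariance of
`Wc` is never needed, because the local intersection theorem `exists_mem_leaf_inter_plaque` is
uniform over all foliations tangent to `Ec`.

Existence: the set of `y` such that `Wu(y)` meets `Wc(x)` contains `x` and is saturated by `Wu`.
Along paths in `Wc`-leaves it is open, by sliding and the local product structure, and closed,
because the sides of a rectangle of `Wc`- and `Wu`-leaves are bounded by two of them
(`exists_rectangle_bound`). Chains of `Wc`- and `Wu`-leaves fill the leaf of `W`.

A leaf is a mere subset of `M` here, so its topology is handled through `1`-Lipschitz paths that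
locally stay in plaques. Such paths are closed under ultrafilter limits, which supplies all the
compactness. -/

set_option linter.unusedSectionVars false

/-! ### Lipschitz paths in leaves and their compactness. -/

section LeafPaths

open Filter

variable {V : Type*} [NormedAddCommGroup V] [NormedSpace ℝ V]
  {H : Type*} [TopologicalSpace H] {I : ModelWithCorners ℝ V H}

section Topological

variable {M : Type*} [TopologicalSpace M] [ChartedSpace H M]

/-- Along the filter `l`, the points `g j` lie in the plaque of `p` in every foliated chart
around `p`. -/
def Foliation.StaysInPlaque (W : Foliation I M) {ι : Type*} (g : ι → M) (l : Filter ι) (p : M) :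
    Prop :=
  ∀ φ ∈ W.atlas, p ∈ φ.chart.source → ∀ᶠ j in l, (φ.chart (g j)).2 = (φ.chart p).2

theorem FoliatedChart.source_mem_nhds (φ : FoliatedChart I M) {p : M} (hp : p ∈ φ.chart.source) :
    φ.chart.source ∈ 𝓝 p :=
  φ.chart.open_source.mem_nhds hp

/-- Lying eventually in a common plaque does not depend on the foliated chart. -/
theorem Foliation.eventually_eq_snd_of_chart (W : Foliation I M) {ι : Type*} {g h : ι → M}
    {l : Filter ι} {p : M} (hg : Tendsto g l (𝓝 p)) (hh : Tendsto h l (𝓝 p))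
    {φ : FoliatedChart I M} (hφ : φ ∈ W.atlas)
    (hp : p ∈ φ.chart.source) (h1 : ∀ᶠ j in l, (φ.chart (g j)).2 = (φ.chart (h j)).2)
    {ψ : FoliatedChart I M} (hψ : ψ ∈ W.atlas) (hpψ : p ∈ ψ.chart.source) :
    ∀ᶠ j in l, (ψ.chart (g j)).2 = (ψ.chart (h j)).2 := by
  obtain ⟨U, hU, -, hUe⟩ := W.compatible φ hφ ψ hψ p ⟨hp, hpψ⟩
  filter_upwards [h1, hg hU, hh hU] with j hj hgj hhj
  exact (hUe _ hgj _ hhj).1 hj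

theorem Foliation.staysInPlaque_of_chart (W : Foliation I M) {ι : Type*} {g : ι → M}
    {l : Filter ι} {p : M} (hg : Tendsto g l (𝓝 p)) {φ : FoliatedChart I M} (hφ : φ ∈ W.atlas)
    (hp : p ∈ φ.chart.source) (h : ∀ᶠ j in l, (φ.chart (g j)).2 = (φ.chart p).2) :
    W.StaysInPlaque g l p :=
  fun _ hψ hpψ => W.eventually_eq_snd_of_chart hg tendsto_const_nhds hφ hp h hψ hpψ

theorem Foliation.StaysInPlaque.eqOn_snd {W : Foliation I M} {γ : ℝ → M} {s : Set ℝ}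
    (hs : IsPreconnected s) {φ : FoliatedChart I M} (hφ : φ ∈ W.atlas)
    (hγ : ∀ t ∈ s, γ t ∈ φ.chart.source) (h : ∀ t ∈ s, W.StaysInPlaque γ (𝓝[s] t) (γ t))
    {t t' : ℝ} (ht : t ∈ s) (ht' : t' ∈ s) : (φ.chart (γ t)).2 = (φ.chart (γ t')).2 := by
  refine hs.induction₂' (fun t t' => (φ.chart (γ t)).2 = (φ.chart (γ t')).2) (fun x hx => ?_)
    (fun x y z _ _ _ h1 h2 => h1.trans h2) ht ht'
  filter_upwards [h x hx φ hφ (hγ x hx)] with y hy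
  exact ⟨hy.symm, hy⟩

theorem Foliation.mem_leaf_self (W : Foliation I M) (x : M) : x ∈ W.leaf x :=
  Relation.EqvGen.refl x

theorem Foliation.mem_leaf_symm {W : Foliation I M} {x y : M} (h : y ∈ W.leaf x) :
    x ∈ W.leaf y :=
  Relation.EqvGen.symm _ _ h

theorem Foliation.mem_leaf_trans {W : Foliation I M} {x y z : M} (h : y ∈ W.leaf x)
    (h' : z ∈ W.leaf y) : z ∈ W.leaf x :=
  Relation.EqvGen.trans _ _ _ h h'

theorem Foliation.mem_leaf_of_snd_eq {W : Foliation I M} {x y : M} {φ : FoliatedChart I M}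
    (hφ : φ ∈ W.atlas) (hx : x ∈ φ.chart.source) (hy : y ∈ φ.chart.source)
    (h : (φ.chart x).2 = (φ.chart y).2) : y ∈ W.leaf x :=
  Relation.EqvGen.rel _ _ ⟨φ, hφ, hx, hy, h⟩

theorem Foliation.StaysInPlaque.eventually_mem_leaf {W : Foliation I M} {ι : Type*} {g : ι → M}
    {l : Filter ι} {p : M} (h : W.StaysInPlaque g l p) (hg : Tendsto g l (𝓝 p)) :
    ∀ᶠ j in l, g j ∈ W.leaf p := by
  obtain ⟨φ, hφ, hp⟩ := W.cover p
  filter_upwards [h φ hφ hp, hg (φ.source_mem_nhds hp)] with j hj hj'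
  exact W.mem_leaf_of_snd_eq hφ hp hj' hj.symm

/-- A continuous path that locally stays in plaques stays in a leaf. -/
theorem Foliation.StaysInPlaque.mem_leaf {W : Foliation I M} {γ : ℝ → M} {s : Set ℝ}
    (hs : IsPreconnected s) (hγ : ContinuousOn γ s)
    (h : ∀ t ∈ s, W.StaysInPlaque γ (𝓝[s] t) (γ t))
    {t t' : ℝ} (ht : t ∈ s) (ht' : t' ∈ s) : γ t' ∈ W.leaf (γ t) := by
  refine hs.induction₂' (fun t t' => γ t' ∈ W.leaf (γ t)) (fun x hx => ?_)
    (fun x y z _ _ _ h1 h2 => Foliation.mem_leaf_trans h1 h2) ht ht'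
  filter_upwards [(h x hx).eventually_mem_leaf (hγ x hx)] with y hy
  exact ⟨hy, Foliation.mem_leaf_symm hy⟩

/-- The plaque of `φ` at height `c`, as a parametrized map. -/
def FoliatedChart.plaque (φ : FoliatedChart I M) (c : EuclideanSpace ℝ (Fin φ.l))
    (a : EuclideanSpace ℝ (Fin φ.k)) : M :=
  φ.chart.symm (a, c)

theorem FoliatedChart.plaque_mem_source (φ : FoliatedChart I M) (c a) :
    φ.plaque c a ∈ φ.chart.source :=
  φ.chart.map_target (by simp [φ.target_eq])

theorem FoliatedChart.chart_plaque (φ : FoliatedChart I M) (c a) :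
    φ.chart (φ.plaque c a) = (a, c) :=
  φ.chart.right_inv (by simp [φ.target_eq])

theorem FoliatedChart.plaque_chart (φ : FoliatedChart I M) {p : M} (hp : p ∈ φ.chart.source) :
    φ.plaque (φ.chart p).2 (φ.chart p).1 = p :=
  φ.chart.left_inv hp

theorem FoliatedChart.contMDiff_plaque' (φ : FoliatedChart I M) (c) :
    ContMDiff (𝓡 φ.k) I 1 (φ.plaque c) :=
  φ.contMDiff_plaque c

theorem FoliatedChart.continuous_plaque (φ : FoliatedChart I M) (c) :
    Continuous (φ.plaque c) :=
  (φ.contMDiff_plaque c).continuous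

section Segment

/-- The straight path in a plaque starting at `a` with velocity `w`. -/
def FoliatedChart.segment (φ : FoliatedChart I M) (c : EuclideanSpace ℝ (Fin φ.l))
    (a w : EuclideanSpace ℝ (Fin φ.k)) (t : ℝ) : M :=
  φ.plaque c (a + t • w)

variable (φ : FoliatedChart I M) (c : EuclideanSpace ℝ (Fin φ.l))
  (a w : EuclideanSpace ℝ (Fin φ.k))

/-- The derivative of the parametrization of a plaque. -/
noncomputable def FoliatedChart.dplaque (φ : FoliatedChart I M) (c : EuclideanSpace ℝ (Fin φ.l))
    (a : EuclideanSpace ℝ (Fin φ.k)) :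
    EuclideanSpace ℝ (Fin φ.k) →L[ℝ] TangentSpace I (φ.plaque c a) :=
  mfderiv (𝓡 φ.k) I (φ.plaque c) a

theorem FoliatedChart.hasMFDerivAt_plaque (φ : FoliatedChart I M)
    (c : EuclideanSpace ℝ (Fin φ.l)) (a : EuclideanSpace ℝ (Fin φ.k)) :
    HasMFDerivAt (𝓡 φ.k) I (φ.plaque c) a (φ.dplaque c a) :=
  ((φ.contMDiff_plaque' c).mdifferentiable one_ne_zero a).hasMFDerivAt

theorem FoliatedChart.dplaque_injective (φ : FoliatedChart I M)
    (c : EuclideanSpace ℝ (Fin φ.l)) (a : EuclideanSpace ℝ (Fin φ.k)) :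
    Function.Injective (φ.dplaque c a) :=
  φ.injective_plaque c a

theorem Foliation.IsTangentTo.range_dplaque {W : Foliation I M}
    {E : ∀ x : M, Submodule ℝ (TangentSpace I x)} (hE : W.IsTangentTo E) {φ : FoliatedChart I M}
    (hφ : φ ∈ W.atlas) (c a) : (φ.dplaque c a).range = E (φ.plaque c a) :=
  hE φ hφ a c

theorem FoliatedChart.contMDiff_segment : ContMDiff 𝓘(ℝ, ℝ) I 1 (φ.segment c a w) := by
  refine (φ.contMDiff_plaque' c).comp ?_
  rw [contMDiff_iff_contDiff]
  fun_prop

theorem FoliatedChart.hasMFDerivAt_segment (t : ℝ) :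
    HasMFDerivAt 𝓘(ℝ, ℝ) I (φ.segment c a w) t
      ((φ.dplaque c (a + t • w)).comp (ContinuousLinearMap.toSpanSingleton ℝ w)) := by
  have h1 : HasFDerivAt (fun t : ℝ => a + t • w) (ContinuousLinearMap.toSpanSingleton ℝ w) t := by
    have := ((hasDerivAt_id t).smul_const w).const_add a
    simpa using this.hasFDerivAt
  exact (φ.hasMFDerivAt_plaque c _).comp t h1.hasMFDerivAt

theorem FoliatedChart.mfderiv_segment (t : ℝ) :
    mfderiv 𝓘(ℝ, ℝ) I (φ.segment c a w) t (1 : ℝ) =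
      φ.dplaque c (a + t • w) w := by
  rw [(φ.hasMFDerivAt_segment c a w t).mfderiv]
  exact congrArg (φ.dplaque c (a + t • w)) (one_smul ℝ w)

theorem FoliatedChart.segment_mem_source (t : ℝ) : φ.segment c a w t ∈ φ.chart.source :=
  φ.plaque_mem_source _ _

variable {φ}

theorem Foliation.segment_staysInPlaque {W : Foliation I M} (hφ : φ ∈ W.atlas) (t : ℝ) :
    W.StaysInPlaque (φ.segment c a w) (𝓝 t) (φ.segment c a w t) :=
  W.staysInPlaque_of_chart (φ.contMDiff_segment c a w).continuous.continuousAt hφ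
    (φ.segment_mem_source c a w t)
    (Eventually.of_forall fun s => by simp [FoliatedChart.segment, φ.chart_plaque])

theorem Foliation.IsTangentTo.segment_mem {W : Foliation I M}
    {E : ∀ x : M, Submodule ℝ (TangentSpace I x)} (hE : W.IsTangentTo E) (hφ : φ ∈ W.atlas)
    (t : ℝ) : mfderiv 𝓘(ℝ, ℝ) I (φ.segment c a w) t (1 : ℝ) ∈ E (φ.segment c a w t) := by
  rw [φ.mfderiv_segment]
  have h := hE.range_dplaque hφ c (a + t • w)
  have h1 : φ.dplaque c (a + t • w) w ∈ E (φ.plaque c (a + t • w)) :=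
    h.le (LinearMap.mem_range_self _ w)
  exact h1

theorem Foliation.IsTangentTo.segment_mfderivWithin_mem {W : Foliation I M}
    {E : ∀ x : M, Submodule ℝ (TangentSpace I x)} (hE : W.IsTangentTo E) {φ : FoliatedChart I M}
    (hφ : φ ∈ W.atlas) (c a w) {t : ℝ} (ht : t ∈ Icc (0 : ℝ) 1) :
    mfderivWithin 𝓘(ℝ, ℝ) I (φ.segment c a w) (Icc 0 1) t (1 : ℝ) ∈ E (φ.segment c a w t) := by
  rw [mfderivWithin_eq_mfderiv
    (uniqueMDiffWithinAt_iff_uniqueDiffWithinAt.2 (uniqueDiffOn_Icc zero_lt_one t ht))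
    ((φ.contMDiff_segment c a w).mdifferentiable one_ne_zero t)]
  exact hE.segment_mem c a w hφ t

end Segment

end Topological

section Metric

variable {M : Type*} [EMetricSpace M] [ChartedSpace H M]

/-- A `1`-Lipschitz path that locally stays in plaques of the foliation. -/
structure Foliation.IsLeafPath (W : Foliation I M) (σ : ℝ → M) : Prop where
  lipschitz : LipschitzWith 1 σ
  staysInPlaque : ∀ t, W.StaysInPlaque σ (𝓝 t) (σ t)

theorem Foliation.IsLeafPath.edist_le {W : Foliation I M} {σ : ℝ → M} (h : W.IsLeafPath σ)
    (s t : ℝ) : edist (σ s) (σ t) ≤ edist s t := by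
  simpa using h.lipschitz s t

theorem Foliation.IsLeafPath.continuous {W : Foliation I M} {σ : ℝ → M} (h : W.IsLeafPath σ) :
    Continuous σ := h.lipschitz.continuous

theorem Foliation.IsLeafPath.mem_leaf {W : Foliation I M} {σ : ℝ → M} (h : W.IsLeafPath σ)
    (s t : ℝ) : σ t ∈ W.leaf (σ s) :=
  Foliation.StaysInPlaque.mem_leaf isPreconnected_univ h.continuous.continuousOn
    (fun t _ => by simpa using h.staysInPlaque t) (mem_univ s) (mem_univ t)

theorem Foliation.IsLeafPath.eqOn_snd {W : Foliation I M} {σ : ℝ → M} (h : W.IsLeafPath σ)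
    {s : Set ℝ} (hs : IsPreconnected s) {φ : FoliatedChart I M} (hφ : φ ∈ W.atlas)
    (hσ : ∀ t ∈ s, σ t ∈ φ.chart.source) {t t' : ℝ} (ht : t ∈ s) (ht' : t' ∈ s) :
    (φ.chart (σ t)).2 = (φ.chart (σ t')).2 :=
  Foliation.StaysInPlaque.eqOn_snd hs hφ hσ
    (fun t _ ψ hψ hp => (h.staysInPlaque t ψ hψ hp).filter_mono nhdsWithin_le_nhds) ht ht'

section Limits

variable {ι : Type*} (𝒰 : Ultrafilter ι) {σ : ι → ℝ → M}

/-- The set of times at which the limit exists is open by local compactness and closed by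
completeness, hence all of `ℝ`. This plays the role of the compactness of closed balls in the
Hopf–Rinow theorem. -/
theorem LipschitzWith.exists_ultrafilter_limit [CompleteSpace M] [LocallyCompactSpace M]
    (hσ : ∀ᶠ j in (𝒰 : Filter ι), LipschitzWith 1 (σ j)) {x : M} {t₀ : ℝ}
    (hx : Tendsto (fun j => σ j t₀) 𝒰 (𝓝 x)) (t : ℝ) :
    ∃ y, Tendsto (fun j => σ j t) 𝒰 (𝓝 y) := by
  set A : Set ℝ := {t | ∃ y, Tendsto (fun j => σ j t) 𝒰 (𝓝 y)} with hA
  have hopen : IsOpen A := by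
    rw [EMetric.isOpen_iff]
    rintro t ⟨y, hy⟩
    obtain ⟨K, hK, hyK⟩ := exists_compact_mem_nhds y
    obtain ⟨ε, hε, hεK⟩ := EMetric.mem_nhds_iff.1 hyK
    have hε2 : 0 < ε / 2 := ENNReal.half_pos hε.ne'
    refine ⟨ε / 2, hε2, fun s hs => ?_⟩
    have hev : ∀ᶠ j in (𝒰 : Filter ι), σ j s ∈ K := by
      filter_upwards [hσ, hy (Metric.eball_mem_nhds y hε2)] with j hj hj'
      apply hεK
      have h1 : edist (σ j s) (σ j t) ≤ edist s t := by simpa using hj s t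
      calc edist (σ j s) y ≤ edist (σ j s) (σ j t) + edist (σ j t) y := edist_triangle _ _ _
        _ < ε / 2 + ε / 2 := ENNReal.add_lt_add (h1.trans_lt hs) hj'
        _ = ε := ENNReal.add_halves ε
    obtain ⟨z, -, hz⟩ := hK.ultrafilter_le_nhds (𝒰.map fun j => σ j s)
      (le_principal_iff.2 hev)
    exact ⟨z, hz⟩
  have hclosed : IsClosed A := by
    rw [← closure_subset_iff_isClosed]
    intro t ht
    have hc : Cauchy (map (fun j => σ j t) (𝒰 : Filter ι)) := by
      refine EMetric.cauchy_iff.2 ⟨(inferInstance : NeBot (map _ (𝒰 : Filter ι))).ne, fun ε hε => ?_⟩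
      have hε4 : 0 < ε / 2 / 2 := ENNReal.half_pos (ENNReal.half_pos hε.ne').ne'
      obtain ⟨s, ⟨y, hy⟩, hst⟩ := EMetric.mem_closure_iff.1 ht _ hε4
      refine ⟨Metric.eball y (ε / 2), ?_, fun u hu v hv => ?_⟩
      · show ∀ᶠ j in (𝒰 : Filter ι), σ j t ∈ Metric.eball y (ε / 2)
        filter_upwards [hσ, hy (Metric.eball_mem_nhds y hε4)] with j hj hj'
        have h1 : edist (σ j t) (σ j s) ≤ edist t s := by simpa using hj t s
        calc edist (σ j t) y ≤ edist (σ j t) (σ j s) + edist (σ j s) y := edist_triangle _ _ _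
          _ < ε / 2 / 2 + ε / 2 / 2 := ENNReal.add_lt_add (h1.trans_lt hst) hj'
          _ = ε / 2 := ENNReal.add_halves _
      · calc edist u v ≤ edist u y + edist v y := edist_triangle_right _ _ _
          _ < ε / 2 + ε / 2 := ENNReal.add_lt_add hu hv
          _ = ε := ENNReal.add_halves ε
    obtain ⟨y, hy⟩ := CompleteSpace.complete hc
    exact ⟨y, hy⟩
  have : A = univ := IsClopen.eq_univ ⟨hclosed, hopen⟩ ⟨t₀, x, hx⟩
  have h : t ∈ A := this ▸ mem_univ t
  exact h

/-- Near a limit point, `1`-Lipschitz paths stay in the source of a foliated chart. -/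
theorem FoliatedChart.exists_ball_mem_source (φ : FoliatedChart I M)
    (hσ : ∀ᶠ j in (𝒰 : Filter ι), LipschitzWith 1 (σ j)) {y : M} {t : ℝ}
    (hy : Tendsto (fun j => σ j t) 𝒰 (𝓝 y)) (hφ : y ∈ φ.chart.source) :
    ∃ r > 0, ∀ᶠ j in (𝒰 : Filter ι), ∀ s ∈ Metric.ball t r, σ j s ∈ φ.chart.source := by
  obtain ⟨ε, hε, hεK⟩ := EMetric.mem_nhds_iff.1 (φ.source_mem_nhds hφ)
  have hε2 : 0 < ε / 2 := ENNReal.half_pos hε.ne'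
  obtain ⟨r, hr, hr'⟩ := Metric.mem_nhds_iff.1 (Metric.eball_mem_nhds t hε2)
  refine ⟨r, hr, ?_⟩
  filter_upwards [hσ, hy (Metric.eball_mem_nhds y hε2)] with j hj hj' s hs
  apply hεK
  have h1 : edist (σ j s) (σ j t) ≤ edist s t := by simpa using hj s t
  calc edist (σ j s) y ≤ edist (σ j s) (σ j t) + edist (σ j t) y := edist_triangle _ _ _
    _ < ε / 2 + ε / 2 := ENNReal.add_lt_add (h1.trans_lt (hr' hs)) hj'
    _ = ε := ENNReal.add_halves ε

/-- Pointwise limits of leaf paths along an ultrafilter are leaf paths. -/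
theorem Foliation.IsLeafPath.exists_ultrafilter_limit [CompleteSpace M] [LocallyCompactSpace M]
    {W : Foliation I M} (hσ : ∀ᶠ j in (𝒰 : Filter ι), W.IsLeafPath (σ j)) {x : M} {t₀ : ℝ}
    (hx : Tendsto (fun j => σ j t₀) 𝒰 (𝓝 x)) :
    ∃ τ : ℝ → M, W.IsLeafPath τ ∧ ∀ t, Tendsto (fun j => σ j t) 𝒰 (𝓝 (τ t)) := by
  have hL : ∀ᶠ j in (𝒰 : Filter ι), LipschitzWith 1 (σ j) := hσ.mono fun j hj => hj.lipschitz
  choose τ hτ using LipschitzWith.exists_ultrafilter_limit 𝒰 hL hx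
  have hτL : LipschitzWith 1 τ := fun s t =>
    le_of_tendsto ((hτ s).edist (hτ t)) (hL.mono fun j hj => hj s t)
  refine ⟨τ, ⟨hτL, fun t => ?_⟩, hτ⟩
  obtain ⟨φ, hφ, ht⟩ := W.cover (τ t)
  refine W.staysInPlaque_of_chart hτL.continuous.continuousAt hφ ht ?_
  -- One radius works for almost all `j`, by the common Lipschitz constant. Each `σ j` has constant
  -- height on that interval, and the equality of heights passes to the limit.
  obtain ⟨r, hr, hev⟩ := φ.exists_ball_mem_source 𝒰 hL (hτ t) ht
  filter_upwards [Metric.ball_mem_nhds t hr,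
    hτL.continuous.continuousAt (φ.source_mem_nhds ht)] with s hs hsφ
  have hsφ : τ s ∈ φ.chart.source := hsφ
  have h1 := ((continuous_snd.continuousAt.comp (φ.chart.continuousAt hsφ)).tendsto).comp (hτ s)
  have h2 := ((continuous_snd.continuousAt.comp (φ.chart.continuousAt ht)).tendsto).comp (hτ t)
  refine tendsto_nhds_unique_of_eventuallyEq h1 h2 ?_
  filter_upwards [hσ, hev] with j hj hj'
  exact hj.eqOn_snd (convex_ball t r).isPreconnected hφ hj' hs (Metric.mem_ball_self hr)

/-- If leaf paths converge and their initial points lie in the limiting plaque, then so do all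
their points. -/
theorem Foliation.IsLeafPath.staysInPlaque_ultrafilter
    {W : Foliation I M} (hσ : ∀ᶠ j in (𝒰 : Filter ι), W.IsLeafPath (σ j)) {τ : ℝ → M}
    (hτ : W.IsLeafPath τ) (hlim : ∀ t, Tendsto (fun j => σ j t) 𝒰 (𝓝 (τ t))) {t₀ : ℝ}
    (h₀ : W.StaysInPlaque (fun j => σ j t₀) 𝒰 (τ t₀)) (t : ℝ) :
    W.StaysInPlaque (fun j => σ j t) 𝒰 (τ t) := by
  have hL : ∀ᶠ j in (𝒰 : Filter ι), LipschitzWith 1 (σ j) := hσ.mono fun j hj => hj.lipschitz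
  -- The truth value of the claim is locally constant in time, so it is the same at `t₀` and at `t`.
  refine (isPreconnected_univ (α := ℝ)).induction₂ (fun t t' =>
    W.StaysInPlaque (fun j => σ j t) 𝒰 (τ t) ↔ W.StaysInPlaque (fun j => σ j t') 𝒰 (τ t'))
    (fun t _ => ?_) (fun _ _ _ _ _ _ h1 h2 => h1.trans h2) (fun _ _ _ _ h => h.symm)
    (mem_univ t₀) (mem_univ t) |>.1 h₀
  obtain ⟨φ, hφ, ht⟩ := W.cover (τ t)
  obtain ⟨r, hr, hev⟩ := φ.exists_ball_mem_source 𝒰 hL (hlim t) ht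
  rw [nhdsWithin_univ]
  filter_upwards [Metric.ball_mem_nhds t hr, hτ.staysInPlaque t φ hφ ht,
    hτ.continuous.continuousAt (φ.source_mem_nhds ht)] with s hs hs2 hsφ
  have hsφ : τ s ∈ φ.chart.source := hsφ
  have key : ∀ᶠ j in (𝒰 : Filter ι), (φ.chart (σ j s)).2 = (φ.chart (σ j t)).2 := by
    filter_upwards [hσ, hev] with j hj hj'
    exact hj.eqOn_snd (convex_ball t r).isPreconnected hφ hj' hs (Metric.mem_ball_self hr)
  constructor
  · intro h
    refine W.staysInPlaque_of_chart (hlim s) hφ hsφ ?_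
    filter_upwards [key, h φ hφ ht] with j hj hj'
    rw [hj, hj', hs2]
  · intro h
    refine W.staysInPlaque_of_chart (hlim t) hφ ht ?_
    filter_upwards [key, h φ hφ hsφ] with j hj hj'
    rw [← hj, hj', hs2]

end Limits

/-- `y` is reached from `x` by a `1`-Lipschitz path in a leaf, in time `T`. -/
def Foliation.Reach (W : Foliation I M) (x y : M) (T : ℝ) : Prop :=
  ∃ σ : ℝ → M, W.IsLeafPath σ ∧ σ 0 = x ∧ σ T = y

theorem Foliation.Reach.mem_leaf {W : Foliation I M} {x y : M} {T : ℝ} (h : W.Reach x y T) :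
    y ∈ W.leaf x := by
  obtain ⟨σ, hσ, rfl, rfl⟩ := h
  exact hσ.mem_leaf 0 T

theorem Foliation.Reach.edist_le {W : Foliation I M} {x y : M} {T : ℝ} (h : W.Reach x y T)
    (hT : 0 ≤ T) : edist x y ≤ ENNReal.ofReal T := by
  obtain ⟨σ, hσ, rfl, rfl⟩ := h
  refine (hσ.edist_le 0 T).trans_eq ?_
  rw [edist_dist, Real.dist_eq, zero_sub, abs_neg, abs_of_nonneg hT]

/-- Leaf paths may stand still; concatenation with a constant path lets any travel time be enlarged.
-/
theorem Foliation.Reach.refl (W : Foliation I M) (x : M) (T : ℝ) : W.Reach x x T :=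
  ⟨fun _ => x, ⟨LipschitzWith.const x |>.weaken zero_le_one, fun _ _ _ _ => by simp⟩, rfl, rfl⟩

theorem Foliation.Reach.symm {W : Foliation I M} {x y : M} {T : ℝ} (h : W.Reach x y T) :
    W.Reach y x T := by
  obtain ⟨σ, hσ, rfl, rfl⟩ := h
  refine ⟨fun t => σ (T - t), ⟨?_, fun t φ hφ hp => ?_⟩, by simp, by simp⟩
  · refine LipschitzWith.of_edist_le fun s t => (hσ.edist_le _ _).trans_eq ?_
    rw [edist_dist, edist_dist, dist_sub_left]
  · have : Tendsto (fun s : ℝ => T - s) (𝓝 t) (𝓝 (T - t)) :=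
      (continuous_const.sub continuous_id).tendsto t
    exact this.eventually (hσ.staysInPlaque (T - t) φ hφ hp)

theorem Foliation.Reach.trans {W : Foliation I M} {x y z : M} {S T : ℝ} (hS : 0 ≤ S)
    (h : W.Reach x y S) (hT : 0 ≤ T) (h' : W.Reach y z T) : W.Reach x z (S + T) := by
  obtain ⟨σ, hσ, rfl, rfl⟩ := h
  obtain ⟨τ, hτ, hτ0, rfl⟩ := h'
  set ρ : ℝ → M := fun t => if t ≤ S then σ t else τ (t - S) with hρ
  have hle : ∀ {t}, t ≤ S → ρ t = σ t := fun h => if_pos h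
  have hge : ∀ {t}, S ≤ t → ρ t = τ (t - S) := fun {t} h => by
    rcases h.eq_or_lt with rfl | h
    · simp [hρ, hτ0]
    · exact if_neg h.not_ge
  have h1 : ∀ s t, s ≤ t → edist (ρ s) (ρ t) ≤ edist s t := by
    intro s t hst
    rcases le_total t S with h | h
    · rw [hle h, hle (hst.trans h)]; exact hσ.edist_le _ _
    rcases le_total S s with h' | h'
    · rw [hge h, hge h']
      refine (hτ.edist_le _ _).trans_eq ?_
      rw [edist_dist, edist_dist, dist_sub_right]
    · calc edist (ρ s) (ρ t) ≤ edist (ρ s) (ρ S) + edist (ρ S) (ρ t) := edist_triangle _ _ _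
        _ ≤ edist s S + edist S t := by
          gcongr
          · rw [hle h', hle le_rfl]; exact hσ.edist_le _ _
          · rw [hge h, hge le_rfl]
            refine (hτ.edist_le _ _).trans_eq ?_
            rw [edist_dist, edist_dist, dist_sub_right]
        _ = edist s t := by
          rw [edist_dist, edist_dist, edist_dist, ← ENNReal.ofReal_add dist_nonneg dist_nonneg]
          congr 1
          rw [Real.dist_eq, Real.dist_eq, Real.dist_eq, abs_of_nonpos (by linarith),
            abs_of_nonpos (by linarith), abs_of_nonpos (by linarith)]
          ring
  have hL : LipschitzWith 1 ρ := LipschitzWith.of_edist_le fun s t => by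
    rcases le_total s t with h | h
    · exact h1 s t h
    · rw [edist_comm, edist_comm s]; exact h1 t s h
  refine ⟨ρ, ⟨hL, fun t φ hφ hp => ?_⟩, hle hS, ?_⟩
  · have htend : Tendsto (fun s : ℝ => s - S) (𝓝 t) (𝓝 (t - S)) :=
      (continuous_id.sub continuous_const).tendsto t
    rcases lt_trichotomy t S with h | rfl | h
    · rw [hle h.le] at hp ⊢
      filter_upwards [hσ.staysInPlaque t φ hφ hp, Iio_mem_nhds h] with s hs hs'
      rw [hle (le_of_lt hs'), hs]
    · have e0 := hge (le_refl t)
      rw [hle le_rfl] at hp ⊢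
      rw [hle le_rfl] at e0
      have hp' : τ (t - t) ∈ φ.chart.source := e0 ▸ hp
      filter_upwards [hσ.staysInPlaque t φ hφ hp,
        htend.eventually (hτ.staysInPlaque (t - t) φ hφ hp')] with s hs hs'
      rcases le_total s t with h | h
      · rw [hle h, hs]
      · rw [hge h, hs', e0]
    · rw [hge h.le] at hp ⊢
      filter_upwards [htend.eventually (hτ.staysInPlaque (t - S) φ hφ hp), Ioi_mem_nhds h]
        with s hs hs'
      rw [hge (le_of_lt hs'), hs]
  · rw [hge (by linarith)]; congr 1; ring

/-- The set of points reached in bounded time from a given point is compact. -/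
theorem Foliation.isCompact_reach [CompleteSpace M] [LocallyCompactSpace M] (W : Foliation I M)
    (x : M) (R : ℝ) : IsCompact {p : M × ℝ | p.2 ∈ Icc 0 R ∧ W.Reach x p.1 p.2} := by
  rw [isCompact_iff_ultrafilter_le_nhds]
  intro 𝒰 h𝒰
  have hS : ∀ᶠ p in (𝒰 : Filter (M × ℝ)), p.2 ∈ Icc 0 R ∧ W.Reach x p.1 p.2 :=
    le_principal_iff.1 h𝒰
  obtain ⟨T, hT, hTlim⟩ := (isCompact_Icc (a := (0 : ℝ)) (b := R)).ultrafilter_le_nhds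
    (𝒰.map Prod.snd) (le_principal_iff.2 (hS.mono fun p hp => hp.1))
  have hTlim : Tendsto Prod.snd (𝒰 : Filter (M × ℝ)) (𝓝 T) := hTlim
  have : Nonempty M := ⟨x⟩
  choose! σ hσ hσ0 hσT using fun (p : M × ℝ) (hp : p.2 ∈ Icc 0 R ∧ W.Reach x p.1 p.2) => hp.2
  have hx0 : Tendsto (fun p => σ p 0) 𝒰 (𝓝 x) :=
    Tendsto.congr' (f₁ := fun _ => x) (hS.mono fun p hp => (hσ0 p hp).symm) tendsto_const_nhds
  obtain ⟨τ, hτ, hlim⟩ := Foliation.IsLeafPath.exists_ultrafilter_limit 𝒰 (W := W) (σ := σ)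
    (hS.mono fun p hp => hσ p hp) hx0
  have h0 : τ 0 = x := tendsto_nhds_unique (hlim 0) hx0
  refine ⟨(τ T, T), ⟨hT, τ, hτ, h0, rfl⟩, ?_⟩
  -- The endpoint of the path `σ p` is taken at the varying time `p.2`; the Lipschitz bound compares
  -- it with the point at the fixed time `T`.
  have h1 : Tendsto Prod.fst (𝒰 : Filter (M × ℝ)) (𝓝 (τ T)) := by
    rw [EMetric.tendsto_nhds]
    intro ε hε
    have hε2 : 0 < ε / 2 := ENNReal.half_pos hε.ne'
    filter_upwards [hS, hTlim (Metric.eball_mem_nhds T hε2),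
      hlim T (Metric.eball_mem_nhds _ hε2)] with p hp h1 h2
    calc edist p.1 (τ T) ≤ edist (σ p p.2) (σ p T) + edist (σ p T) (τ T) := by
          rw [hσT p hp]; exact edist_triangle _ _ _
      _ < ε / 2 + ε / 2 := ENNReal.add_lt_add (((hσ p hp).edist_le _ _).trans_lt h1) h2
      _ = ε := ENNReal.add_halves ε
  have := h1.prodMk_nhds hTlim
  exact tendsto_id'.1 this

/-- In bounded time only finitely many plaques in a compact part of a foliated chart are
reached. -/
theorem Foliation.finite_plaques_reach [CompleteSpace M] [LocallyCompactSpace M]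
    (W : Foliation I M) {φ : FoliatedChart I M} (hφ : φ ∈ W.atlas) {K : Set M} (hK : IsCompact K)
    (hKφ : K ⊆ φ.chart.source) (x : M) (T : ℝ) :
    ((fun y => (φ.chart y).2) '' {y | y ∈ K ∧ W.Reach x y T}).Finite := by
  by_contra hinf
  have hinf : Set.Infinite _ := hinf
  obtain ⟨u, hu, huinj⟩ : ∃ u : ℕ → M, (∀ n, u n ∈ K ∧ W.Reach x (u n) T) ∧
      Function.Injective fun n => (φ.chart (u n)).2 := by
    choose u hu hu' using fun n => (hinf.natEmbedding _ n).2
    refine ⟨u, hu, fun m n hmn => ?_⟩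
    have := (hu' m).symm.trans (hmn.trans (hu' n))
    exact (hinf.natEmbedding _).injective (Subtype.ext this)
  choose σ hσ hσ0 hσT using fun n => (hu n).2
  let 𝒰 : Ultrafilter ℕ := hyperfilter ℕ
  obtain ⟨τ, hτ, hlim⟩ := Foliation.IsLeafPath.exists_ultrafilter_limit 𝒰 (W := W) (σ := σ)
    (Eventually.of_forall hσ) (x := x) (t₀ := 0) (by simp [hσ0])
  have h0 : τ 0 = x := tendsto_nhds_unique (hlim 0) (by simp [hσ0])
  -- All paths start at `x`, so the plaque condition is trivial at time `0`. At time `T` it puts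
  -- hyperfilter-many endpoints in one plaque, whereas their plaques are pairwise distinct.
  have hs := Foliation.IsLeafPath.staysInPlaque_ultrafilter 𝒰 (Eventually.of_forall hσ) hτ hlim
    (t₀ := 0) (fun ψ _ _ => by simp [hσ0, h0]) T
  have hTK : τ T ∈ K := hK.isClosed.mem_of_tendsto (hlim T)
    (Eventually.of_forall fun n => (hσT n).symm ▸ (hu n).1)
  have hev := hs φ hφ (hKφ hTK)
  have hsub : {n | (φ.chart (σ n T)).2 = (φ.chart (τ T)).2}.Subsingleton := by
    intro m hm n hn
    apply huinj
    simp only [mem_ofPred_eq, hσT] at hm hn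
    exact hm.trans hn.symm
  exact (notMem_hyperfilter_of_finite hsub.finite) hev

/-- A path which is contained, as a set, in a set of points reachable from a given one, locally
stays in plaques. -/
theorem Foliation.staysInPlaque_of_reach [CompleteSpace M] [LocallyCompactSpace M]
    (W : Foliation I M) {γ : ℝ → M} {t : ℝ} {s : Set ℝ} (hs : s.OrdConnected) (ht : t ∈ s)
    (hγ : ∀ᶠ r in 𝓝[s] t, ContinuousWithinAt γ s r) (x : M)
    (hx : ∀ᶠ r in 𝓝[s] t, ∃ n : ℕ, W.Reach x (γ r) n) :
    W.StaysInPlaque γ (𝓝[s] t) (γ t) := by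
  intro φ hφ hp
  obtain ⟨K, hK, hKφ, hKc⟩ := local_compact_nhds (φ.source_mem_nhds hp)
  have hct : ContinuousWithinAt γ s t := hγ.self_of_nhdsWithin ht
  have hev := (hγ.and hx).and (hct hK)
  obtain ⟨U, hU, hUs⟩ := mem_nhdsWithin_iff_exists_mem_nhds_inter.1 hev
  obtain ⟨r, hr, hrU⟩ := Metric.mem_nhds_iff.1 hU
  have hB : ∀ u ∈ Metric.ball t r ∩ s, (ContinuousWithinAt γ s u ∧ ∃ n : ℕ, W.Reach x (γ u) n)
      ∧ γ u ∈ K := fun u hu => hUs ⟨hrU hu.1, hu.2⟩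
  have hpre : IsPreconnected (Metric.ball t r ∩ s) :=
    ((convex_ball t r).ordConnected.inter hs).isPreconnected
  -- Finitely many heights for each time bound `n` make countably many in all, and a countable
  -- connected set of heights is a single point.
  have hcount : ((fun y => (φ.chart y).2) ∘ γ '' (Metric.ball t r ∩ s)).Countable := by
    refine (countable_iUnion fun n : ℕ =>
      (W.finite_plaques_reach hφ hKc hKφ x n).countable).mono ?_
    rintro _ ⟨u, hu, rfl⟩
    obtain ⟨⟨-, n, hn⟩, hK'⟩ := hB u hu
    exact mem_iUnion.2 ⟨n, γ u, ⟨hK', hn⟩, rfl⟩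
  have hcont : ContinuousOn ((fun y => (φ.chart y).2) ∘ γ) (Metric.ball t r ∩ s) := by
    intro u hu
    obtain ⟨⟨hc, -⟩, hK'⟩ := hB u hu
    have h1 : ContinuousAt (fun y => (φ.chart y).2) (γ u) :=
      (φ.chart.continuousAt (hKφ hK')).snd
    exact (h1.comp_continuousWithinAt hc).mono inter_subset_right
  have hsub := hcount.isTotallyDisconnected _ Subset.rfl (hpre.image _ hcont)
  filter_upwards [inter_mem_nhdsWithin s (Metric.ball_mem_nhds t hr)] with u hu
  exact hsub ⟨u, ⟨hu.2, hu.1⟩, rfl⟩ ⟨t, ⟨Metric.mem_ball_self hr, ht⟩, rfl⟩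

end Metric

end LeafPaths

/-! ### From lengths of curves to Lipschitz leaf paths. -/

section LeafLength

open Filter MeasureTheory

variable {V : Type*} [NormedAddCommGroup V] [NormedSpace ℝ V]
  {H : Type*} [TopologicalSpace H] {I : ModelWithCorners ℝ V H}
  {M : Type*} [EMetricSpace M] [ChartedSpace H M]

variable [RiemannianBundle (fun x : M => TangentSpace I x)]

theorem FoliatedChart.norm_mfderiv_segment (φ : FoliatedChart I M)
    (c : EuclideanSpace ℝ (Fin φ.l)) (a w : EuclideanSpace ℝ (Fin φ.k)) (t : ℝ) :
    ‖mfderiv 𝓘(ℝ, ℝ) I (φ.segment c a w) t (1 : ℝ)‖ = ‖φ.dplaque c (a + t • w) w‖ :=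
  congrArg (fun v : TangentSpace I (φ.segment c a w t) => ‖v‖) (φ.mfderiv_segment c a w t)

section

variable [IsManifold I 1 M] [IsContinuousRiemannianBundle V (fun x : M => TangentSpace I x)]

theorem ContMDiffOn.continuousOn_norm_mfderivWithin {γ : ℝ → M} {a b : ℝ} (hab : a < b)
    (hγ : ContMDiffOn 𝓘(ℝ, ℝ) I 1 γ (Icc a b)) :
    ContinuousOn (fun t => ‖mfderivWithin 𝓘(ℝ, ℝ) I γ (Icc a b) t (1 : ℝ)‖) (Icc a b) := by
  have h1 := hγ.continuousOn_tangentMapWithin le_rfl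
    (uniqueMDiffOn_iff_uniqueDiffOn.2 (uniqueDiffOn_Icc hab))
  have h2 : Continuous fun t : ℝ => (⟨t, (1 : ℝ)⟩ : TangentBundle 𝓘(ℝ, ℝ) ℝ) := by
    have := (tangentBundleModelSpaceHomeomorph (𝓘(ℝ, ℝ))).symm.continuous.comp
      (continuous_id.prodMk (continuous_const (y := (1 : ℝ))))
    exact this
  have h3 := h1.comp h2.continuousOn (s := Icc a b) (fun t ht => ht)
  have h4 := ContinuousOn.inner_bundle h3 h3
  simp_rw [norm_eq_sqrt_real_inner]
  exact Real.continuous_sqrt.comp_continuousOn h4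

theorem ContMDiff.continuous_norm_mfderiv {γ : ℝ → M} (hγ : ContMDiff 𝓘(ℝ, ℝ) I 1 γ) :
    Continuous (fun t => ‖mfderiv 𝓘(ℝ, ℝ) I γ t (1 : ℝ)‖) := by
  have h1 := hγ.continuous_tangentMap le_rfl
  have h2 : Continuous fun t : ℝ => (⟨t, (1 : ℝ)⟩ : TangentBundle 𝓘(ℝ, ℝ) ℝ) := by
    have := (tangentBundleModelSpaceHomeomorph (𝓘(ℝ, ℝ))).symm.continuous.comp
      (continuous_id.prodMk (continuous_const (y := (1 : ℝ))))
    exact this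
  have h3 := h1.comp h2
  have h4 := Continuous.inner_bundle h3 h3
  simp_rw [norm_eq_sqrt_real_inner]
  exact Real.continuous_sqrt.comp h4

end

theorem pathELength_le_of_norm_le {γ : ℝ → M} {a b s t C : ℝ} (hst : s ≤ t)
    (hs : a ≤ s) (ht : t ≤ b)
    (hC : ∀ r ∈ Icc a b, ‖mfderivWithin 𝓘(ℝ, ℝ) I γ (Icc a b) r (1 : ℝ)‖ ≤ C) :
    pathELength I γ s t ≤ ENNReal.ofReal (C * (t - s)) := by
  rw [pathELength_eq_lintegral_mfderiv_Ioo]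
  have hC0 : 0 ≤ C := (norm_nonneg _).trans (hC s ⟨hs, hst.trans ht⟩)
  calc ∫⁻ r in Ioo s t, ‖mfderiv 𝓘(ℝ, ℝ) I γ r (1 : ℝ)‖ₑ
      ≤ ∫⁻ _ in Ioo s t, ENNReal.ofReal C := by
        refine setLIntegral_mono' measurableSet_Ioo fun r hr => ?_
        have hr' : Icc a b ∈ 𝓝 r := Icc_mem_nhds (hs.trans_lt hr.1) (hr.2.trans_le ht)
        rw [← mfderivWithin_of_mem_nhds hr', ← ofReal_norm]
        exact ENNReal.ofReal_le_ofReal (hC r (mem_of_mem_nhds hr'))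
    _ = ENNReal.ofReal (C * (t - s)) := by
        simp [ENNReal.ofReal_mul hC0]

theorem edist_le_pathELength [IsRiemannianManifold I M] {γ : ℝ → M} {a b s t : ℝ} (hst : s ≤ t)
    (hs : a ≤ s) (ht : t ≤ b) (hγ : ContMDiffOn 𝓘(ℝ, ℝ) I 1 γ (Icc a b)) :
    edist (γ s) (γ t) ≤ pathELength I γ s t := by
  rw [IsRiemannianManifold.out (I := I) (γ s) (γ t)]
  exact riemannianEDist_le_pathELength (hγ.mono (Icc_subset_Icc hs ht)) rfl rfl hst

/-- A `C¹` curve in a plaque-preserving position can be reparametrized by arclength (up to a small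
error), which yields a leaf path. -/
theorem Foliation.reach_of_pathELength_lt [IsManifold I 1 M]
    [IsContinuousRiemannianBundle V (fun x : M => TangentSpace I x)] [IsRiemannianManifold I M]
    {W : Foliation I M} {γ : ℝ → M} (hγ : ContMDiffOn 𝓘(ℝ, ℝ) I 1 γ (Icc 0 1))
    (hW : ∀ t ∈ Icc (0 : ℝ) 1, W.StaysInPlaque γ (𝓝[Icc 0 1] t) (γ t)) {K : ℝ}
    (hK : pathELength I γ 0 1 < ENNReal.ofReal K) : W.Reach (γ 0) (γ 1) K := by
  obtain ⟨C, hC⟩ := isCompact_Icc.exists_bound_of_continuousOn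
    (hγ.continuousOn_norm_mfderivWithin zero_lt_one)
  simp only [norm_norm] at hC
  have hfin : ∀ t, pathELength I γ 0 t ≠ ⊤ ∨ t ∉ Icc (0 : ℝ) 1 := fun t => by
    by_cases ht : t ∈ Icc (0 : ℝ) 1
    · left
      exact ((pathELength_le_of_norm_le ht.1 le_rfl ht.2 hC).trans_lt ENNReal.ofReal_lt_top).ne
    · exact Or.inr ht
  -- Clamping time to `[0, 1]` extends the curve and its length function to all of `ℝ`.
  set p : ℝ → ℝ := fun t => max 0 (min 1 t) with hp
  have hpI : ∀ t, p t ∈ Icc (0 : ℝ) 1 := fun t =>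
    ⟨le_max_left _ _, max_le zero_le_one (min_le_left _ _)⟩
  have hpc : Continuous p := by fun_prop
  have hpm : Monotone p := fun s t h => max_le_max le_rfl (min_le_min le_rfl h)
  have hp0 : p 0 = 0 := by simp [hp]
  have hp1 : ∀ t, 1 ≤ t → p t = 1 := fun t h => by simp [hp, h]
  set L : ℝ → ℝ := fun t => (pathELength I γ 0 (p t)).toReal with hL
  have hadd : ∀ s t, s ≤ t → pathELength I γ (p s) (p t) = ENNReal.ofReal (L t - L s) := by
    intro s t hst
    have h1 := (hfin (p s)).resolve_right (not_not.2 (hpI s))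
    have h2 := (hfin (p t)).resolve_right (not_not.2 (hpI t))
    have h3 := pathELength_add (I := I) (γ := γ) (hpI s).1 (hpm hst)
    rw [ENNReal.ofReal_sub _ ENNReal.toReal_nonneg, ENNReal.ofReal_toReal h1,
      ENNReal.ofReal_toReal h2, ← h3, ENNReal.add_sub_cancel_left h1]
  have hLm : Monotone L := fun s t hst =>
    ENNReal.toReal_mono ((hfin (p t)).resolve_right (not_not.2 (hpI t)))
      (pathELength_mono le_rfl (hpm hst))
  have hC0 : 0 ≤ C := (norm_nonneg _).trans (hC 0 ⟨le_rfl, zero_le_one⟩)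
  have hLip : ∀ s t, s ≤ t → L t - L s ≤ C * (p t - p s) := by
    intro s t hst
    have := pathELength_le_of_norm_le (hpm hst) (hpI s).1 (hpI t).2 hC
    rw [hadd s t hst] at this
    exact (ENNReal.ofReal_le_ofReal_iff (mul_nonneg hC0 (sub_nonneg.2 (hpm hst)))).1 this
  have hLc : Continuous L := by
    have h1 : ∀ s t, |L s - L t| ≤ C * |p s - p t| := by
      intro s t
      rcases le_total s t with h | h
      · rw [abs_sub_comm, abs_of_nonneg (sub_nonneg.2 (hLm h)), abs_sub_comm,
          abs_of_nonneg (sub_nonneg.2 (hpm h))]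
        exact hLip s t h
      · rw [abs_of_nonneg (sub_nonneg.2 (hLm h)), abs_of_nonneg (sub_nonneg.2 (hpm h))]
        exact hLip t s h
    rw [continuous_iff_continuousAt]
    intro t
    rw [ContinuousAt, tendsto_iff_dist_tendsto_zero]
    refine squeeze_zero (fun _ => dist_nonneg) (fun s => h1 s t) ?_
    have : Continuous fun s => C * |p s - p t| := by fun_prop
    simpa using this.tendsto t
  have hL0 : L 0 = 0 := by simp [hL, hp0]
  have hL1 : L 1 < K := by
    have h2 := (hfin 1).resolve_right (by simp)
    have : ENNReal.ofReal (L 1) < ENNReal.ofReal K := by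
      simpa only [hL, hp1 1 le_rfl, ENNReal.ofReal_toReal h2] using hK
    exact (ENNReal.ofReal_lt_ofReal_iff_of_nonneg ENNReal.toReal_nonneg).1 this
  -- The slack `ε` makes `θ t = L t + ε t` strictly increasing even where the curve stands still,
  -- with `θ 0 = 0` and `θ 1 = K`. Reparametrized by the inverse of `θ`, the curve is `1`-Lipschitz
  -- and takes time exactly `K`.
  set ε : ℝ := K - L 1 with hε
  have hεpos : 0 < ε := sub_pos.2 hL1
  have hLbd : ∀ t, L t ∈ Icc 0 K := fun t => by
    refine ⟨ENNReal.toReal_nonneg, le_trans ?_ hL1.le⟩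
    rw [hL]
    simp only [hp1 1 le_rfl]
    exact ENNReal.toReal_mono ((hfin 1).resolve_right (by simp))
      (pathELength_mono le_rfl (hpI t).2)
  set θ : ℝ → ℝ := fun t => L t + ε * t with hθ
  have hθm : StrictMono θ := hLm.add_strictMono fun s t h => by
    simpa using mul_lt_mul_of_pos_left h hεpos
  have hθc : Continuous θ := by fun_prop
  have hθs : Function.Surjective θ := by
    refine hθc.surjective ?_ ?_
    · refine tendsto_atTop_add_left_of_le' _ 0 (Eventually.of_forall fun t => (hLbd t).1) ?_
      exact tendsto_id.const_mul_atTop hεpos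
    · refine tendsto_atBot_add_left_of_ge' _ K (Eventually.of_forall fun t => (hLbd t).2) ?_
      exact tendsto_id.const_mul_atBot hεpos
  let e : ℝ ≃o ℝ := hθm.orderIsoOfSurjective θ hθs
  have he : ∀ t, e t = θ t := fun t => rfl
  have hγ1 : ∀ s t, s ≤ t → edist (γ (p s)) (γ (p t)) ≤ edist (θ s) (θ t) := by
    intro s t hst
    refine (edist_le_pathELength (hpm hst) (hpI s).1 (hpI t).2 hγ).trans ?_
    rw [hadd s t hst, edist_comm, edist_dist, Real.dist_eq,
      abs_of_nonneg (sub_nonneg.2 (hθm.monotone hst))]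
    apply ENNReal.ofReal_le_ofReal
    have : ε * s ≤ ε * t := mul_le_mul_of_nonneg_left hst hεpos.le
    simp only [hθ]; linarith
  refine ⟨fun u => γ (p (e.symm u)), ⟨LipschitzWith.of_edist_le fun u v => ?_, fun u φ hφ hu => ?_⟩,
    ?_, ?_⟩
  · have hu : θ (e.symm u) = u := e.apply_symm_apply u
    have hv : θ (e.symm v) = v := e.apply_symm_apply v
    rcases le_total u v with h | h
    · have := hγ1 _ _ (e.symm.monotone h)
      rwa [hu, hv] at this
    · have := hγ1 _ _ (e.symm.monotone h)
      rwa [hu, hv, edist_comm, edist_comm v] at this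
  · have htend : Tendsto (fun v => p (e.symm v)) (𝓝 u) (𝓝[Icc 0 1] (p (e.symm u))) :=
      tendsto_nhdsWithin_iff.2 ⟨(hpc.comp e.symm.continuous).tendsto u,
        Eventually.of_forall fun v => hpI _⟩
    exact htend.eventually (hW _ (hpI _) φ hφ hu)
  · have : e.symm 0 = 0 := by
      rw [OrderIso.symm_apply_eq, he]; simp [hθ, hL0]
    simp [this, hp0]
  · have : e.symm K = 1 := by
      rw [OrderIso.symm_apply_eq, he]; simp [hθ, hε]
    simp [this, hp1 1 le_rfl]

section Leaf

variable [IsManifold I 1 M] [IsContinuousRiemannianBundle V (fun x : M => TangentSpace I x)]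
  [IsRiemannianManifold I M]

/-- Short segments in plaques are traversed by leaf paths at almost their initial speed. -/
theorem Foliation.reach_segment {W : Foliation I M} {φ : FoliatedChart I M} (hφ : φ ∈ W.atlas)
    (c : EuclideanSpace ℝ (Fin φ.l)) (a w : EuclideanSpace ℝ (Fin φ.k)) {Λ : ℝ}
    (hΛ : ‖φ.dplaque c a w‖ < Λ) :
    ∃ s₀ > 0, ∀ s ∈ Icc 0 s₀, W.Reach (φ.plaque c a) (φ.segment c a w s) (Λ * s) := by
  obtain ⟨Λ', hΛ', hΛΛ'⟩ := exists_between hΛ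
  have hcont := (φ.contMDiff_segment c a w).continuous_norm_mfderiv
  have h0 : ‖mfderiv 𝓘(ℝ, ℝ) I (φ.segment c a w) 0 (1 : ℝ)‖ < Λ' := by
    have e : a + (0 : ℝ) • w = a := by simp
    rwa [φ.norm_mfderiv_segment, e]
  obtain ⟨s₀, hs₀, hball⟩ := Metric.nhds_basis_closedBall.mem_iff.1
    (hcont.continuousAt.eventually (gt_mem_nhds h0))
  refine ⟨s₀, hs₀, fun s hs => ?_⟩
  -- The segment up to time `s` is rewritten as a unit-time segment with velocity `s • w`, whose
  -- length is at most `Λ' * s`.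
  have e0 : φ.segment c a (s • w) 0 = φ.plaque c a := by simp [FoliatedChart.segment]
  have e1 : φ.segment c a (s • w) 1 = φ.segment c a w s := by simp [FoliatedChart.segment]
  rcases hs.1.eq_or_lt with rfl | hspos
  · have : φ.segment c a w 0 = φ.plaque c a := by simp [FoliatedChart.segment]
    rw [this]; exact Foliation.Reach.refl W _ _
  rw [← e0, ← e1]
  refine Foliation.reach_of_pathELength_lt (φ.contMDiff_segment c a _).contMDiffOn
    (fun t _ ψ hψ hp => (Foliation.segment_staysInPlaque c a _ hφ t ψ hψ hp).filter_mono
      nhdsWithin_le_nhds) ?_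
  have hb := pathELength_le_of_norm_le (I := I) (γ := φ.segment c a (s • w)) (a := 0) (b := 1)
    (s := 0) (t := 1) (C := Λ' * s) zero_le_one le_rfl le_rfl (fun r hr => ?_)
  · refine hb.trans_lt ((ENNReal.ofReal_lt_ofReal_iff ?_).2 ?_)
    · exact mul_pos ((norm_nonneg _).trans_lt hΛ) hspos
    · simpa using mul_lt_mul_of_pos_right hΛΛ' hspos
  · rw [mfderivWithin_eq_mfderiv
      (uniqueMDiffWithinAt_iff_uniqueDiffWithinAt.2 (uniqueDiffOn_Icc zero_lt_one r hr))
      (((φ.contMDiff_segment c a _).mdifferentiable one_ne_zero) r), φ.norm_mfderiv_segment]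
    have h2 : r * s ∈ Metric.closedBall (0 : ℝ) s₀ := by
      rw [Metric.mem_closedBall, dist_zero_right, Real.norm_eq_abs,
        abs_of_nonneg (mul_nonneg hr.1 hspos.le)]
      calc r * s ≤ 1 * s := mul_le_mul_of_nonneg_right hr.2 hspos.le
        _ ≤ s₀ := by simpa using hs.2
    have h3 := hball h2
    have h3 : ‖mfderiv 𝓘(ℝ, ℝ) I (φ.segment c a w) (r * s) (1 : ℝ)‖ < Λ' := h3
    rw [φ.norm_mfderiv_segment] at h3
    rw [smul_smul]
    rw [map_smul, norm_smul, Real.norm_eq_abs, abs_of_pos hspos, mul_comm]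
    gcongr

theorem Foliation.exists_reach_segment {W : Foliation I M} {φ : FoliatedChart I M}
    (hφ : φ ∈ W.atlas) (c : EuclideanSpace ℝ (Fin φ.l)) (a w : EuclideanSpace ℝ (Fin φ.k)) :
    ∃ T : ℝ, 0 ≤ T ∧ W.Reach (φ.segment c a w 0) (φ.segment c a w 1) T := by
  have hγ := (φ.contMDiff_segment c a w).contMDiffOn (s := Icc 0 1)
  obtain ⟨C, hC⟩ := isCompact_Icc.exists_bound_of_continuousOn
    (hγ.continuousOn_norm_mfderivWithin zero_lt_one)
  simp only [norm_norm] at hC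
  have hC0 : 0 ≤ C := (norm_nonneg _).trans (hC 0 ⟨le_rfl, zero_le_one⟩)
  refine ⟨C + 1, by positivity, Foliation.reach_of_pathELength_lt hγ
    (fun t _ ψ hψ hp => (Foliation.segment_staysInPlaque c a _ hφ t ψ hψ hp).filter_mono
      nhdsWithin_le_nhds) ?_⟩
  refine (pathELength_le_of_norm_le zero_le_one le_rfl le_rfl hC).trans_lt
    ((ENNReal.ofReal_lt_ofReal_iff (by positivity)).2 ?_)
  linarith

theorem Foliation.exists_reach_of_mem_leaf {W : Foliation I M} {x y : M} (h : y ∈ W.leaf x) :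
    ∃ T : ℝ, 0 ≤ T ∧ W.Reach x y T := by
  have h' : Relation.EqvGen W.SamePlaque x y := h
  clear h
  induction h' with
  | rel x y h =>
    obtain ⟨φ, hφ, hx, hy, hxy⟩ := h
    obtain ⟨T, hT, h⟩ := Foliation.exists_reach_segment hφ (φ.chart x).2 (φ.chart x).1
      ((φ.chart y).1 - (φ.chart x).1)
    refine ⟨T, hT, ?_⟩
    simp only [FoliatedChart.segment, zero_smul, add_zero, one_smul, add_sub_cancel] at h
    rwa [φ.plaque_chart hx, hxy, φ.plaque_chart hy] at h
  | refl x => exact ⟨0, le_rfl, Foliation.Reach.refl W x 0⟩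
  | symm x y _ ih =>
    obtain ⟨T, hT, h⟩ := ih
    exact ⟨T, hT, h.symm⟩
  | trans x y z _ _ ih ih' =>
    obtain ⟨T, hT, h⟩ := ih
    obtain ⟨T', hT', h'⟩ := ih'
    exact ⟨T + T', add_nonneg hT hT', h.trans hT hT' h'⟩

theorem Foliation.edist_lt_top_of_mem_leaf {W : Foliation I M} {x y : M} (h : y ∈ W.leaf x) :
    edist x y < ⊤ := by
  obtain ⟨T, hT, h⟩ := Foliation.exists_reach_of_mem_leaf h
  exact (h.edist_le hT).trans_lt ENNReal.ofReal_lt_top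

/-- A path which is contained, as a set, in a leaf, locally stays in plaques. -/
theorem Foliation.staysInPlaque_of_mem_leaf [CompleteSpace M] [LocallyCompactSpace M]
    (W : Foliation I M) {γ : ℝ → M} {t : ℝ} {s : Set ℝ} (hs : s.OrdConnected) (ht : t ∈ s)
    (hγ : ∀ᶠ r in 𝓝[s] t, ContinuousWithinAt γ s r) (x : M)
    (hx : ∀ᶠ r in 𝓝[s] t, γ r ∈ W.leaf x) :
    W.StaysInPlaque γ (𝓝[s] t) (γ t) := by
  refine W.staysInPlaque_of_reach hs ht hγ x (hx.mono fun r hr => ?_)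
  obtain ⟨T, hT, h⟩ := Foliation.exists_reach_of_mem_leaf hr
  obtain ⟨n, hn⟩ := exists_nat_ge T
  refine ⟨n, ?_⟩
  have := h.trans hT (sub_nonneg.2 hn) (Foliation.Reach.refl W _ _)
  rwa [add_sub_cancel] at this

end Leaf

end LeafLength

/-! ### Tangency of curves in leaves, and plaques of subfoliations of `W`. -/

section Tangent

open Filter MeasureTheory

/-- A curve in the image of an immersion has its velocity in the range of the derivative of the
immersion. -/
theorem HasStrictFDerivAt.mem_range_of_hasDerivWithinAt {X Y : Type*} [NormedAddCommGroup X]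
    [NormedSpace ℝ X] [FiniteDimensional ℝ X] [NormedAddCommGroup Y] [NormedSpace ℝ Y]
    [FiniteDimensional ℝ Y]
    {p : X → Y} {A : X →L[ℝ] Y} {γ : ℝ → Y} {a : ℝ → X} {s : Set ℝ} {t : ℝ} {v : Y}
    (hp : HasStrictFDerivAt p A (a t)) (hA : Function.Injective A)
    (hγ : HasDerivWithinAt γ v s t) (ha : ContinuousWithinAt a s t) (hts : t ∈ s)
    (hs : UniqueDiffWithinAt ℝ s t) (h : ∀ᶠ r in 𝓝[s] t, γ r = p (a r)) :
    v ∈ A.range := by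
  have : CompleteSpace X := FiniteDimensional.complete ℝ X
  -- The lift `a` is only known to be continuous. Composing `p` with a left inverse of `A` gives a
  -- locally invertible map, which expresses `a` through `γ` and so makes `a` differentiable; the
  -- chain rule then gives `v = A (B v)`.
  obtain ⟨B₀, hB₀⟩ := A.toLinearMap.exists_leftInverse_of_injective (LinearMap.ker_eq_bot.2 hA)
  set B : Y →L[ℝ] X := LinearMap.toContinuousLinearMap B₀
  have hBA : B.comp A = (ContinuousLinearEquiv.refl ℝ X : X →L[ℝ] X) := by
    ext x
    exact congrArg (fun f : X →ₗ[ℝ] X => f x) hB₀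
  have hBp : HasStrictFDerivAt (fun x => B (p x)) (ContinuousLinearEquiv.refl ℝ X : X →L[ℝ] X)
      (a t) := hBA ▸ B.hasStrictFDerivAt.comp (a t) hp
  have hinv := hBp.eventually_left_inverse
  set g := hBp.localInverse _ _ _ with hg
  have hga : ∀ᶠ r in 𝓝[s] t, a r = g (B (γ r)) := by
    filter_upwards [ha.eventually hinv, h] with r hr hr'
    rw [hr', hr]
  have hBγ : HasDerivWithinAt (fun r => B (γ r)) (B v) s t :=
    B.hasFDerivAt.comp_hasDerivWithinAt t hγ
  have hγt : γ t = p (a t) := h.self_of_nhdsWithin hts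
  have hgd : HasFDerivAt g ((ContinuousLinearEquiv.refl ℝ X).symm : X →L[ℝ] X) (B (γ t)) := by
    rw [hγt]; exact hBp.to_localInverse.hasFDerivAt
  have had : HasDerivWithinAt a (B v) s t := by
    have h1 := hgd.comp_hasDerivWithinAt t hBγ
    exact h1.congr_of_eventuallyEq hga (hga.self_of_nhdsWithin hts)
  have hpa : HasDerivWithinAt γ (A (B v)) s t :=
    (hp.hasFDerivAt.comp_hasDerivWithinAt t had).congr_of_eventuallyEq h hγt
  have := hs.eq_deriv _ hγ hpa
  rw [this]
  exact LinearMap.mem_range_self _ _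

variable {V : Type*} [NormedAddCommGroup V] [NormedSpace ℝ V]
  {H : Type*} [TopologicalSpace H] {I : ModelWithCorners ℝ V H}

section Topological

variable {M : Type*} [TopologicalSpace M] [ChartedSpace H M] [IsManifold I 1 M]

theorem hasStrictFDerivAt_extChartAt_comp {X : Type*} [NormedAddCommGroup X] [NormedSpace ℝ X]
    {p : X → M} {a : X} (hp : ContMDiffAt 𝓘(ℝ, X) I 1 p a) {z : M}
    (hz : p a ∈ (chartAt H z).source) {A : X →L[ℝ] TangentSpace I (p a)}
    (hA : HasMFDerivAt 𝓘(ℝ, X) I p a A) :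
    HasStrictFDerivAt (fun x => extChartAt I z (p x))
      ((mfderiv I 𝓘(ℝ, V) (extChartAt I z) (p a)).comp A : X →L[ℝ] V) a := by
  have h1 : ContMDiffAt 𝓘(ℝ, X) 𝓘(ℝ, V) 1 (fun x => extChartAt I z (p x)) a :=
    (contMDiffAt_extChartAt' hz).comp a hp
  have h2 := (h1.contDiffAt).hasStrictFDerivAt one_ne_zero
  have h3 := ((mdifferentiableAt_extChartAt hz).hasMFDerivAt.comp a hA).hasFDerivAt
  have h4 := h2.hasFDerivAt.unique h3
  rw [h4] at h2
  exact h2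

theorem FoliatedChart.hasStrictFDerivAt_plaque (φ : FoliatedChart I M)
    (c : EuclideanSpace ℝ (Fin φ.l)) (a : EuclideanSpace ℝ (Fin φ.k)) {z : M}
    (hz : φ.plaque c a ∈ (chartAt H z).source) :
    HasStrictFDerivAt (fun x => extChartAt I z (φ.plaque c x))
      ((mfderiv I 𝓘(ℝ, V) (extChartAt I z) (φ.plaque c a)).comp (mfderiv (𝓡 φ.k) I (φ.plaque c) a)
        : EuclideanSpace ℝ (Fin φ.k) →L[ℝ] V) a :=
  hasStrictFDerivAt_extChartAt_comp (φ.contMDiff_plaque' c a) hz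
    ((φ.contMDiff_plaque' c).mdifferentiable one_ne_zero a).hasMFDerivAt

/-- A differentiable path that locally stays in plaques is tangent to the foliation. -/
theorem Foliation.IsTangentTo.mfderivWithin_mem [FiniteDimensional ℝ V] {W : Foliation I M}
    {E : ∀ x : M, Submodule ℝ (TangentSpace I x)} (hE : W.IsTangentTo E) {γ : ℝ → M} {s : Set ℝ}
    {t : ℝ} (hγ : MDifferentiableWithinAt 𝓘(ℝ, ℝ) I γ s t) (hts : t ∈ s)
    (hs : UniqueDiffWithinAt ℝ s t) (hW : W.StaysInPlaque γ (𝓝[s] t) (γ t)) :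
    mfderivWithin 𝓘(ℝ, ℝ) I γ s t (1 : ℝ) ∈ E (γ t) := by
  obtain ⟨φ, hφ, hp⟩ := W.cover (γ t)
  set c := (φ.chart (γ t)).2 with hc
  set a : ℝ → EuclideanSpace ℝ (Fin φ.k) := fun r => (φ.chart (γ r)).1 with ha
  have hpl : φ.plaque c (a t) = γ t := φ.plaque_chart hp
  have hch : φ.plaque c (a t) ∈ (chartAt H (γ t)).source := hpl ▸ mem_chart_source H (γ t)
  have h1 := φ.hasStrictFDerivAt_plaque c (a t) hch
  -- In the chart centred at `γ t` the derivative of the chart at the centre is the identity, so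
  -- tangent vectors can be compared in the model space `V`.
  have hid : mfderiv I 𝓘(ℝ, V) (extChartAt I (γ t)) (γ t) = ContinuousLinearMap.id ℝ _ :=
    mfderiv_extChartAt_self
  have hA : (((mfderiv I 𝓘(ℝ, V) (extChartAt I (γ t)) (φ.plaque c (a t))).comp
      (mfderiv (𝓡 φ.k) I (φ.plaque c) (a t)) : EuclideanSpace ℝ (Fin φ.k) →L[ℝ] V)) =
      (φ.dplaque c (a t) : EuclideanSpace ℝ (Fin φ.k) →L[ℝ] V) := by
    rw [hpl, hid]; rfl
  rw [hA] at h1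
  let L : ℝ →L[ℝ] V := mfderivWithin 𝓘(ℝ, ℝ) I γ s t
  have h2 : HasFDerivWithinAt (fun r => extChartAt I (γ t) (γ r)) L s t := by
    have h3 := (mdifferentiableAt_extChartAt (I := I)
      (mem_chart_source H (γ t))).hasMFDerivAt.comp_hasMFDerivWithinAt t hγ.hasMFDerivWithinAt
    rw [hid] at h3
    exact h3.hasFDerivWithinAt
  have h4 : ContinuousWithinAt a s t :=
    (continuous_fst.continuousAt.comp (φ.chart.continuousAt hp)).comp_continuousWithinAt
      hγ.continuousWithinAt
  have h5 : ∀ᶠ r in 𝓝[s] t, extChartAt I (γ t) (γ r) =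
      extChartAt I (γ t) (φ.plaque c (a r)) := by
    filter_upwards [hW φ hφ hp, hγ.continuousWithinAt (φ.source_mem_nhds hp)] with r hr hr'
    rw [hc, ← hr, ha, φ.plaque_chart hr']
  have h6 := h1.mem_range_of_hasDerivWithinAt (φ.dplaque_injective c (a t)) h2.hasDerivWithinAt h4 hts hs h5
  have h7 := hE.range_dplaque hφ c (a t)
  have h8 : L 1 ∈
      (E (φ.plaque c (a t)) : Submodule ℝ V) := h7.le h6
  have h9 : ∀ p : M, p = γ t → ∀ v : V, v ∈ (E p : Submodule ℝ V) →
      v ∈ (E (γ t) : Submodule ℝ V) := fun p hp v hv => hp ▸ hv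
  exact h9 _ hpl _ h8

end Topological

section Riemannian

variable {M : Type*} [EMetricSpace M] [ChartedSpace H M]
  [RiemannianBundle (fun x : M => TangentSpace I x)]

/-- A map stretches a curve at most by the factor by which its derivative stretches the
velocities. -/
theorem pathELength_comp_le {h : M → M} (hh : ContMDiff I I 1 h) {γ : ℝ → M}
    (hγ : ContMDiffOn 𝓘(ℝ, ℝ) I 1 γ (Icc 0 1)) {k : ℝ}
    (hk : ∀ t ∈ Icc (0 : ℝ) 1, ‖mfderiv I I h (γ t) (mfderivWithin 𝓘(ℝ, ℝ) I γ (Icc 0 1) t (1 : ℝ))‖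
      ≤ k * ‖mfderivWithin 𝓘(ℝ, ℝ) I γ (Icc 0 1) t (1 : ℝ)‖) (hk0 : 0 ≤ k) :
    pathELength I (h ∘ γ) 0 1 ≤ ENNReal.ofReal k * pathELength I γ 0 1 := by
  rw [pathELength_eq_lintegral_mfderivWithin_Icc, pathELength_eq_lintegral_mfderivWithin_Icc,
    ← lintegral_const_mul' _ _ ENNReal.ofReal_ne_top]
  refine setLIntegral_mono' measurableSet_Icc fun t ht => ?_
  have hu : UniqueMDiffWithinAt 𝓘(ℝ, ℝ) (Icc (0 : ℝ) 1) t :=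
    uniqueMDiffWithinAt_iff_uniqueDiffWithinAt.2 (uniqueDiffOn_Icc zero_lt_one t ht)
  have h1 := mfderiv_comp_mfderivWithin t ((hh.mdifferentiable one_ne_zero) (γ t))
    ((hγ.mdifferentiableOn one_ne_zero) t ht) hu
  have h2 : mfderivWithin 𝓘(ℝ, ℝ) I (h ∘ γ) (Icc 0 1) t (1 : ℝ) =
      mfderiv I I h (γ t) (mfderivWithin 𝓘(ℝ, ℝ) I γ (Icc 0 1) t (1 : ℝ)) := by rw [h1]; rfl
  have h3 := hk t ht
  have h4 : ‖mfderivWithin 𝓘(ℝ, ℝ) I (h ∘ γ) (Icc 0 1) t (1 : ℝ)‖ =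
      ‖mfderiv I I h (γ t) (mfderivWithin 𝓘(ℝ, ℝ) I γ (Icc 0 1) t (1 : ℝ))‖ :=
    congrArg (fun v : TangentSpace I (h (γ t)) => ‖v‖) h2
  rw [← ofReal_norm, ← ofReal_norm, ← ENNReal.ofReal_mul hk0]
  exact ENNReal.ofReal_le_ofReal (h4.le.trans h3)

theorem edist_comp_le_pathELength [IsRiemannianManifold I M] {h : M → M} (hh : ContMDiff I I 1 h)
    {γ : ℝ → M} (hγ : ContMDiffOn 𝓘(ℝ, ℝ) I 1 γ (Icc 0 1)) {k : ℝ}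
    (hk : ∀ t ∈ Icc (0 : ℝ) 1, ‖mfderiv I I h (γ t) (mfderivWithin 𝓘(ℝ, ℝ) I γ (Icc 0 1) t (1 : ℝ))‖
      ≤ k * ‖mfderivWithin 𝓘(ℝ, ℝ) I γ (Icc 0 1) t (1 : ℝ)‖) (hk0 : 0 ≤ k) :
    edist (h (γ 0)) (h (γ 1)) ≤ ENNReal.ofReal k * pathELength I γ 0 1 :=
  (edist_le_pathELength zero_le_one le_rfl le_rfl (hh.comp_contMDiffOn hγ)).trans
    (pathELength_comp_le hh hγ hk hk0)

variable [IsManifold I 1 M] [IsContinuousRiemannianBundle V (fun x : M => TangentSpace I x)]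
  [IsRiemannianManifold I M] [CompleteSpace M] [LocallyCompactSpace M]

theorem Foliation.staysInPlaque_of_mapsTo_leaf (W : Foliation I M) {γ : ℝ → M} {x : M}
    (hγ : ContinuousOn γ (Icc 0 1)) (hx : ∀ t ∈ Icc (0 : ℝ) 1, γ t ∈ W.leaf x) {t : ℝ}
    (ht : t ∈ Icc (0 : ℝ) 1) : W.StaysInPlaque γ (𝓝[Icc 0 1] t) (γ t) :=
  W.staysInPlaque_of_mem_leaf ordConnected_Icc ht
    (by filter_upwards [self_mem_nhdsWithin] with r hr using hγ r hr) x
    (by filter_upwards [self_mem_nhdsWithin] with r hr using hx r hr)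

/-- `C¹` curves in leaves are tangent to the foliation. -/
theorem Foliation.IsTangentTo.mfderivWithin_mem_of_leaf [FiniteDimensional ℝ V]
    {W : Foliation I M} {E : ∀ x : M, Submodule ℝ (TangentSpace I x)} (hE : W.IsTangentTo E)
    {γ : ℝ → M} {x : M} (hγ : ContMDiffOn 𝓘(ℝ, ℝ) I 1 γ (Icc 0 1))
    (hx : ∀ t ∈ Icc (0 : ℝ) 1, γ t ∈ W.leaf x) {t : ℝ} (ht : t ∈ Icc (0 : ℝ) 1) :
    mfderivWithin 𝓘(ℝ, ℝ) I γ (Icc 0 1) t (1 : ℝ) ∈ E (γ t) :=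
  hE.mfderivWithin_mem (hγ.mdifferentiableOn one_ne_zero t ht) ht
    (uniqueDiffOn_Icc zero_lt_one t ht)
    (W.staysInPlaque_of_mapsTo_leaf hγ.continuousOn hx ht)

/-- A map whose derivative stretches the tangent bundle of a foliation by at most `k` stretches
leaf distances at most by `k`. -/
theorem Foliation.IsTangentTo.edist_le_leafEDist [FiniteDimensional ℝ V]
    {W : Foliation I M} {E : ∀ x : M, Submodule ℝ (TangentSpace I x)} (hE : W.IsTangentTo E)
    {h : M → M} (hh : ContMDiff I I 1 h) {k : ℝ} (hk0 : 0 < k)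
    (hk : ∀ (x : M) (u : TangentSpace I x), u ∈ E x → ‖mfderiv I I h x u‖ ≤ k * ‖u‖) (x y : M) :
    edist (h x) (h y) ≤ ENNReal.ofReal k * W.leafEDist x y := by
  have hk1 : ENNReal.ofReal k ≠ 0 := by simpa using hk0
  rw [mul_comm, ← ENNReal.div_le_iff_le_mul (Or.inl hk1) (Or.inl ENNReal.ofReal_ne_top), Foliation.leafEDist]
  simp only [le_iInf_iff]
  rintro γ hγ rfl rfl hx
  rw [ENNReal.div_le_iff_le_mul (Or.inl hk1) (Or.inl ENNReal.ofReal_ne_top), mul_comm]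
  exact edist_comp_le_pathELength hh hγ
    (fun t ht => hk _ _ (hE.mfderivWithin_mem_of_leaf hγ hx ht)) hk0.le

/-- The bridge from leaf distances to leaf paths, to which the limit theorems apply. A competitor in
the infimum lies in the leaf only as a set, hence the appeal to the countability argument for
plaques. -/
theorem Foliation.reach_of_leafEDist_lt {W : Foliation I M} {x y : M} {K : ℝ}
    (h : W.leafEDist x y < ENNReal.ofReal K) : W.Reach x y K := by
  simp only [Foliation.leafEDist, iInf_lt_iff] at h
  obtain ⟨γ, hγ, rfl, rfl, hx, h⟩ := h
  exact Foliation.reach_of_pathELength_lt hγ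
    (fun t ht => W.staysInPlaque_of_mapsTo_leaf hγ.continuousOn hx ht) h

/-- If `E` is uniquely integrable, curves tangent to `E` locally stay in plaques. -/
theorem IsUniquelyIntegrableBy.staysInPlaque {W : Foliation I M}
    {E : ∀ x : M, Submodule ℝ (TangentSpace I x)} (hW : IsUniquelyIntegrableBy E W) {γ : ℝ → M}
    (hγ : ContMDiffOn 𝓘(ℝ, ℝ) I 1 γ (Icc 0 1))
    (hE : ∀ t ∈ Icc (0 : ℝ) 1, mfderivWithin 𝓘(ℝ, ℝ) I γ (Icc 0 1) t (1 : ℝ) ∈ E (γ t)) {t : ℝ}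
    (ht : t ∈ Icc (0 : ℝ) 1) : W.StaysInPlaque γ (𝓝[Icc 0 1] t) (γ t) :=
  W.staysInPlaque_of_mapsTo_leaf hγ.continuousOn (hW.2 γ hγ hE) ht

/-- If the foliation `F` is tangent to a subbundle of the uniquely integrable bundle `E = T W`, then
the plaques of `F` are locally contained in plaques of `W`. -/
theorem IsUniquelyIntegrableBy.eventually_plaque_subset {W F : Foliation I M}
    {E E₁ : ∀ x : M, Submodule ℝ (TangentSpace I x)} (hW : IsUniquelyIntegrableBy E W)
    (hF : F.IsTangentTo E₁) (hE : ∀ x, E₁ x ≤ E x) {φ ψ : FoliatedChart I M} (hφ : φ ∈ F.atlas)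
    (hψ : ψ ∈ W.atlas) {x : M} (hxφ : x ∈ φ.chart.source) (hxψ : x ∈ ψ.chart.source) :
    ∀ᶠ y in 𝓝 x, (φ.chart y).2 = (φ.chart x).2 → (ψ.chart y).2 = (ψ.chart x).2 := by
  set c := (φ.chart x).2 with hc
  set a := (φ.chart x).1 with ha
  have hpl : φ.plaque c a = x := φ.plaque_chart hxφ
  have h1 : ∀ᶠ b in 𝓝 a, φ.plaque c b ∈ ψ.chart.source :=
    (φ.continuous_plaque c).continuousAt.eventually (hpl.symm ▸ ψ.source_mem_nhds hxψ)
  obtain ⟨r, hr, hball⟩ := Metric.mem_nhds_iff.1 h1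
  have h2 : ∀ᶠ y in 𝓝 x, (φ.chart y).1 ∈ Metric.ball a r :=
    (continuous_fst.continuousAt.comp (φ.chart.continuousAt hxφ)).eventually
      (Metric.ball_mem_nhds a hr)
  filter_upwards [h2, φ.source_mem_nhds hxφ] with y hy hyφ hyc
  -- The straight segment from `x` to `y` in the plaque of `F` is tangent to `E` and remains in the
  -- source of `ψ`, so unique integrability keeps its `W`-height constant.
  set w := (φ.chart y).1 - a with hw
  have e0 : φ.segment c a w 0 = x := by simp [FoliatedChart.segment, hpl]
  have e1 : φ.segment c a w 1 = y := by
    simp only [FoliatedChart.segment, one_smul, hw, add_sub_cancel]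
    rw [← hyc, φ.plaque_chart hyφ]
  have hst : ∀ t ∈ Icc (0 : ℝ) 1, φ.segment c a w t ∈ ψ.chart.source := fun t ht => by
    apply hball
    have : a + t • w ∈ segment ℝ a (φ.chart y).1 := by
      rw [segment_eq_image']; exact ⟨t, ht, rfl⟩
    exact (convex_ball a r).segment_subset (Metric.mem_ball_self hr) hy this
  have h3 := Foliation.StaysInPlaque.eqOn_snd isPreconnected_Icc hψ hst
    (fun t ht => hW.staysInPlaque (φ.contMDiff_segment c a w).contMDiffOn
      (fun t ht => hE _ (hF.segment_mfderivWithin_mem hφ c a w ht)) ht)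
    (right_mem_Icc.2 zero_le_one) (left_mem_Icc.2 zero_le_one)
  rwa [e0, e1] at h3

/-- Leaf paths of a foliation tangent to a subbundle of a uniquely integrable bundle `E = T W` are
leaf paths of `W`. -/
theorem IsUniquelyIntegrableBy.isLeafPath {W F : Foliation I M}
    {E E₁ : ∀ x : M, Submodule ℝ (TangentSpace I x)} (hW : IsUniquelyIntegrableBy E W)
    (hF : F.IsTangentTo E₁) (hE : ∀ x, E₁ x ≤ E x) {σ : ℝ → M} (hσ : F.IsLeafPath σ) :
    W.IsLeafPath σ := by
  refine ⟨hσ.lipschitz, fun t ψ hψ ht => ?_⟩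
  obtain ⟨φ, hφ, ht'⟩ := F.cover (σ t)
  filter_upwards [hσ.staysInPlaque t φ hφ ht', hσ.continuous.continuousAt.eventually
    (hW.eventually_plaque_subset hF hE hφ hψ ht' ht)] with s hs hs'
  exact hs' hs

end Riemannian

end Tangent

/-! ### First-order estimates for the local intersection problem. -/

section LocalIntersection

open Filter

theorem HasStrictFDerivAt.exists_nhds_injOn {X Y : Type*} [NormedAddCommGroup X]
    [NormedSpace ℝ X] [FiniteDimensional ℝ X] [NormedAddCommGroup Y] [NormedSpace ℝ Y]
    [FiniteDimensional ℝ Y] {p : X → Y} {A : X →L[ℝ] Y} {a : X}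
    (hp : HasStrictFDerivAt p A a) (hA : Function.Injective A) : ∃ N ∈ 𝓝 a, InjOn p N := by
  have : CompleteSpace X := FiniteDimensional.complete ℝ X
  obtain ⟨B₀, hB₀⟩ := A.toLinearMap.exists_leftInverse_of_injective (LinearMap.ker_eq_bot.2 hA)
  set B : Y →L[ℝ] X := LinearMap.toContinuousLinearMap B₀
  have hBA : B.comp A = (ContinuousLinearEquiv.refl ℝ X : X →L[ℝ] X) := by
    ext x
    exact congrArg (fun f : X →ₗ[ℝ] X => f x) hB₀
  have hBp : HasStrictFDerivAt (fun x => B (p x)) (ContinuousLinearEquiv.refl ℝ X : X →L[ℝ] X)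
      a := hBA ▸ B.hasStrictFDerivAt.comp a hp
  refine ⟨_, hBp.eventually_left_inverse, fun x hx y hy hxy => ?_⟩
  have hx : hBp.localInverse _ _ _ (B (p x)) = x := hx
  have hy : hBp.localInverse _ _ _ (B (p y)) = y := hy
  rw [← hx, ← hy, hxy]

/-- A differentiable curve whose velocity roughly points to the origin approaches the origin. -/
theorem HasDerivAt.eventually_norm_le {Y : Type*} [NormedAddCommGroup Y] [NormedSpace ℝ Y]
    {h : ℝ → Y} {h' : Y} (hh : HasDerivAt h h' 0) (h0 : h 0 ≠ 0) (hd : ‖h' + h 0‖ ≤ ‖h 0‖ / 2) :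
    ∀ᶠ s in 𝓝[>] (0 : ℝ), ‖h s‖ ≤ ‖h 0‖ - 3 / 8 * s * ‖h 0‖ := by
  have hpos : 0 < ‖h 0‖ := norm_pos_iff.2 h0
  -- An error of `1/8` leaves a rate of decrease `1 - 1/2 - 1/8 = 3/8`.
  have h1 := (hasDerivAt_iff_isLittleO_nhds_zero.1 hh).def (c := ‖h 0‖ / 8) (by positivity)
  filter_upwards [nhdsWithin_le_nhds h1, Ioo_mem_nhdsGT (zero_lt_one' ℝ)] with s hs hs1
  have hs : ‖h (0 + s) - h 0 - s • h'‖ ≤ ‖h 0‖ / 8 * ‖s‖ := hs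
  rw [zero_add, Real.norm_eq_abs, abs_of_pos hs1.1] at hs
  have e : h s = (1 - s) • h 0 + s • (h' + h 0) + (h s - h 0 - s • h') := by
    rw [sub_smul, smul_add, one_smul]; abel
  calc ‖h s‖ = ‖(1 - s) • h 0 + s • (h' + h 0) + (h s - h 0 - s • h')‖ := by rw [← e]
    _ ≤ ‖(1 - s) • h 0‖ + ‖s • (h' + h 0)‖ + ‖h s - h 0 - s • h'‖ := norm_add₃_le
    _ ≤ (1 - s) * ‖h 0‖ + s * (‖h 0‖ / 2) + ‖h 0‖ / 8 * s := by
        rw [norm_smul, norm_smul, Real.norm_eq_abs, Real.norm_eq_abs, abs_of_pos hs1.1,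
          abs_of_nonneg (by linarith [hs1.2])]
        have := mul_le_mul_of_nonneg_left hd hs1.1.le
        linarith
    _ = ‖h 0‖ - 3 / 8 * s * ‖h 0‖ := by ring

variable {V : Type*} [NormedAddCommGroup V] [NormedSpace ℝ V]
  {H : Type*} [TopologicalSpace H] {I : ModelWithCorners ℝ V H}

section Topological

variable {M : Type*} [TopologicalSpace M] [ChartedSpace H M] [IsManifold I 1 M]

/-- A continuous vector field is continuous in a chart. -/
theorem continuousAt_mfderiv_extChartAt {X : ∀ x : M, TangentSpace I x} {z : M}
    (hX : ContinuousAt (fun x => (⟨x, X x⟩ : TangentBundle I M)) z) :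
    ContinuousAt (fun x => (mfderiv I 𝓘(ℝ, V) (extChartAt I z) x (X x) : V)) z := by
  have hmem : (⟨z, X z⟩ : TangentBundle I M) ∈ (trivializationAt V (TangentSpace I) z).source := by
    rw [Trivialization.mem_source]; exact mem_baseSet_trivializationAt V (TangentSpace I) z
  have h0 : ContinuousAt (fun x => trivializationAt V (TangentSpace I) z ⟨x, X x⟩) z :=
    ContinuousAt.comp (f := fun x => (⟨x, X x⟩ : TangentBundle I M)) (x := z)
      ((trivializationAt V (TangentSpace I) z).continuousAt hmem) hX
  have h1 : ContinuousAt (fun x => (trivializationAt V (TangentSpace I) z ⟨x, X x⟩).2) z := h0.snd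
  refine h1.congr ?_
  filter_upwards [(chartAt H z).open_source.mem_nhds (mem_chart_source H z)] with x hx
  have h2 := TangentBundle.continuousLinearMapAt_trivializationAt (I := I) hx
  have h3 : x ∈ (trivializationAt V (TangentSpace I) z).baseSet := hx
  have h4 := congrArg (fun L : TangentSpace I x →L[ℝ] V => L (X x)) h2
  refine Eq.trans ?_ h4
  exact ((trivializationAt V (TangentSpace I) z).continuousLinearMapAt_apply_of_mem ℝ h3 _).symm

/-- Near a point, the plaque of a foliation through it projects injectively to any linear
coordinates on the tangent space of the leaf. -/
theorem Foliation.IsTangentTo.exists_nhds_injective [FiniteDimensional ℝ V] {Y : Type*}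
    [NormedAddCommGroup Y] [NormedSpace ℝ Y] [FiniteDimensional ℝ Y]
    {W : Foliation I M} {E : ∀ x : M, Submodule ℝ (TangentSpace I x)} (hW : W.IsTangentTo E)
    {ψ : FoliatedChart I M} (hψ : ψ ∈ W.atlas) {z : M} (hz : z ∈ ψ.chart.source) (P : V →L[ℝ] Y)
    (hP : ∀ v : V, v ∈ (E z : Submodule ℝ V) → P v = 0 → v = 0) :
    ∃ N ∈ 𝓝 z, ∀ x ∈ N, ∀ y ∈ N, (ψ.chart x).2 = (ψ.chart z).2 → (ψ.chart y).2 = (ψ.chart z).2 →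
      P (extChartAt I z x) = P (extChartAt I z y) → x = y := by
  set c := (ψ.chart z).2 with hc
  set a := (ψ.chart z).1 with ha
  have hpl : ψ.plaque c a = z := ψ.plaque_chart hz
  have h1 := ψ.hasStrictFDerivAt_plaque c a (z := z) (hpl.symm ▸ mem_chart_source H z)
  have hid : mfderiv I 𝓘(ℝ, V) (extChartAt I z) z = ContinuousLinearMap.id ℝ _ :=
    mfderiv_extChartAt_self
  have hA : (((mfderiv I 𝓘(ℝ, V) (extChartAt I z) (ψ.plaque c a)).comp
      (mfderiv (𝓡 ψ.k) I (ψ.plaque c) a) : EuclideanSpace ℝ (Fin ψ.k) →L[ℝ] V)) =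
      (ψ.dplaque c a : EuclideanSpace ℝ (Fin ψ.k) →L[ℝ] V) := by
    rw [hpl, hid]; rfl
  rw [hA] at h1
  have hE : ∀ w, (ψ.dplaque c a w : V) ∈ (E z : Submodule ℝ V) := fun w => by
    have h7 := hW.range_dplaque hψ c a
    have h8 : (ψ.dplaque c a w : V) ∈ (E (ψ.plaque c a) : Submodule ℝ V) :=
      h7.le (LinearMap.mem_range_self _ w)
    have h9 : ∀ p : M, p = z → ∀ v : V, v ∈ (E p : Submodule ℝ V) →
      v ∈ (E z : Submodule ℝ V) := fun p hp v hv => hp ▸ hv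
    exact h9 _ hpl _ h8
  let A : EuclideanSpace ℝ (Fin ψ.k) →L[ℝ] V := ψ.dplaque c a
  have hAinj : Function.Injective A := ψ.dplaque_injective c a
  have h2 : HasStrictFDerivAt (fun x => P (extChartAt I z (ψ.plaque c x))) (P.comp A) a :=
    P.hasStrictFDerivAt.comp a h1
  obtain ⟨N, hN, hinj⟩ := h2.exists_nhds_injOn (by
    rw [injective_iff_map_eq_zero]
    intro w hw
    exact (injective_iff_map_eq_zero A).1 hAinj w (hP _ (hE w) hw))
  refine ⟨ψ.chart.source ∩ (fun x => (ψ.chart x).1) ⁻¹' N, inter_mem (ψ.source_mem_nhds hz)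
    ((continuous_fst.continuousAt.comp (ψ.chart.continuousAt hz)) hN), ?_⟩
  rintro x ⟨hx, hxN⟩ y ⟨hy, hyN⟩ hxc hyc hxy
  have ex : ψ.plaque c (ψ.chart x).1 = x := by rw [← hxc, ψ.plaque_chart hx]
  have ey : ψ.plaque c (ψ.chart y).1 = y := by rw [← hyc, ψ.plaque_chart hy]
  have := hinj hxN hyN (by simpa only [ex, ey] using hxy)
  rw [← ex, ← ey]
  exact congrArg (ψ.plaque c) this

end Topological

section Metric

variable {M : Type*} [EMetricSpace M] [ChartedSpace H M] [IsManifold I 1 M]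
  [RiemannianBundle (fun x : M => TangentSpace I x)]
  [IsContinuousRiemannianBundle V (fun x : M => TangentSpace I x)]

theorem continuousAt_norm_section {X : ∀ x : M, TangentSpace I x} {z : M}
    (hX : ContinuousAt (fun x => (⟨x, X x⟩ : TangentBundle I M)) z) :
    ContinuousAt (fun x => ‖X x‖) z := by
  have h4 := ContinuousAt.inner_bundle hX hX
  simp_rw [norm_eq_sqrt_real_inner]
  exact Real.continuous_sqrt.continuousAt.comp h4

/-- The first-order data of the intersection problem for the tangent subbundle `E₁` and a plaque
tangent to `E₂`: near `z`, every target vector `-e` in the coordinates `P` on `E z` is approximated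
by a combination of a vector of `E₁` and a vector tangent to the plaque, of controlled size. -/
theorem IsContinuousSubbundle.exists_approx [FiniteDimensional ℝ V] {Y : Type*}
    [NormedAddCommGroup Y] [NormedSpace ℝ Y] [FiniteDimensional ℝ Y]
    {E₁ : ∀ x : M, Submodule ℝ (TangentSpace I x)} (hE₁ : IsContinuousSubbundle E₁)
    {z : M} {k : ℕ} {B : EuclideanSpace ℝ (Fin k) → EuclideanSpace ℝ (Fin k) →L[ℝ] V}
    {b₀ : EuclideanSpace ℝ (Fin k)} (hB : ContinuousAt B b₀) (P : V →L[ℝ] Y)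
    (hP : ∀ y : Y, ∃ u : V, u ∈ (E₁ z : Submodule ℝ V) ∧ ∃ w, P (u + B b₀ w) = y) :
    ∃ K > 0, ∀ᶠ p in 𝓝 (z, b₀), ∀ e : Y, ∃ u : TangentSpace I p.1, u ∈ E₁ p.1 ∧
      ‖u‖ ≤ K * ‖e‖ ∧ ∃ w, ‖w‖ ≤ K * ‖e‖ ∧
      ‖(P (mfderiv I 𝓘(ℝ, V) (extChartAt I z) p.1 u) - P (B p.2 w)) + e‖ ≤ ‖e‖ / 2 := by
  obtain ⟨m, U, X, hU, hXc, hX⟩ := hE₁ z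
  have hXz : ∀ i, ContinuousAt (fun x => (⟨x, X i x⟩ : TangentBundle I M)) z :=
    fun i => (hXc i).continuousAt hU
  let Xh : Fin m → M → V := fun i x => mfderiv I 𝓘(ℝ, V) (extChartAt I z) x (X i x)
  have hXh : ∀ i, ContinuousAt (Xh i) z := fun i => continuousAt_mfderiv_extChartAt (hXz i)
  let T : M → (Fin m → ℝ) →L[ℝ] V := fun x =>
    ∑ i, (ContinuousLinearMap.proj (R := ℝ) (φ := fun _ : Fin m => ℝ) i).smulRight (Xh i x)
  have hT : ContinuousAt T z := by
    refine tendsto_finsetSum _ fun i _ => ?_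
    exact ((ContinuousLinearMap.smulRightL ℝ (Fin m → ℝ) V
      (ContinuousLinearMap.proj (R := ℝ) (φ := fun _ : Fin m => ℝ) i)).continuous.continuousAt.comp
      (hXh i))
  have hTa : ∀ x c, T x c = ∑ i, c i • Xh i x := fun x c => by
    simp [T]
  let Z := (Fin m → ℝ) × EuclideanSpace ℝ (Fin k)
  let L : M × EuclideanSpace ℝ (Fin k) → Z →L[ℝ] Y := fun p =>
    (P.comp (T p.1)).comp (ContinuousLinearMap.fst ℝ _ _) -
      (P.comp (B p.2)).comp (ContinuousLinearMap.snd ℝ _ _)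
  have hLa : ∀ p c w, L p (c, w) = P (T p.1 c) - P (B p.2 w) := fun _ _ _ => rfl
  have hL : ContinuousAt L (z, b₀) := by
    have h1 : ContinuousAt (fun p : M × EuclideanSpace ℝ (Fin k) => T p.1) (z, b₀) :=
      ContinuousAt.comp (f := Prod.fst) (x := (z, b₀)) hT continuousAt_fst
    have h2 : ContinuousAt (fun p : M × EuclideanSpace ℝ (Fin k) => B p.2) (z, b₀) :=
      ContinuousAt.comp (f := Prod.snd) (x := (z, b₀)) hB continuousAt_snd
    exact ((continuousAt_const.clm_comp h1).clm_comp continuousAt_const).sub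
      ((continuousAt_const.clm_comp h2).clm_comp continuousAt_const)
  have hid : mfderiv I 𝓘(ℝ, V) (extChartAt I z) z = ContinuousLinearMap.id ℝ _ :=
    mfderiv_extChartAt_self
  have hXhz : ∀ i, Xh i z = X i z := fun i => by simp only [Xh, hid]; rfl
  have hsurj : Function.Surjective (L (z, b₀)) := by
    intro y
    obtain ⟨u, hu, w, hw⟩ := hP y
    obtain ⟨c, hc⟩ : ∃ c : Fin m → ℝ, ∑ i, c i • X i z = (u : TangentSpace I z) :=
      (Submodule.mem_span_range_iff_exists_fun ℝ).1 ((hX z (mem_of_mem_nhds hU)).2.ge hu)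
    refine ⟨(c, -w), ?_⟩
    have h1 : T z c = u := by rw [hTa, ← hc]; simp only [hXhz]; rfl
    rw [hLa, h1, map_neg, map_neg, sub_neg_eq_add, ← map_add, hw]
  -- A right inverse at the base point remains one up to an error `1/2` nearby, by continuity of
  -- `L`. Thus `R (-e)` supplies the coefficients of `u` and the vector `w`.
  obtain ⟨R₀, hR₀⟩ := (L (z, b₀)).toLinearMap.exists_rightInverse_of_surjective
    (LinearMap.range_eq_top.2 hsurj)
  let R : Y →L[ℝ] Z := LinearMap.toContinuousLinearMap R₀
  have hLR : ∀ y, L (z, b₀) (R y) = y := fun y => congrArg (fun f : Y →ₗ[ℝ] Y => f y) hR₀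
  have hclose : ∀ᶠ p in 𝓝 (z, b₀), ‖(L p - L (z, b₀)).comp R‖ < 1 / 2 := by
    have h1 : ContinuousAt (fun p => ‖(L p - L (z, b₀)).comp R‖) (z, b₀) :=
      ((hL.sub continuousAt_const).clm_comp continuousAt_const).norm
    refine h1.eventually (gt_mem_nhds ?_)
    simp
  have hbound : ∀ i, ∀ᶠ x in 𝓝 z, ‖X i x‖ < ‖X i z‖ + 1 := fun i =>
    (continuousAt_norm_section (hXz i)).eventually (gt_mem_nhds (by linarith))
  -- `S` bounds the Riemannian norm of a combination of the frame by its coefficients, uniformly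
  -- near `z`.
  set S := ∑ i, (‖X i z‖ + 1) with hS
  have hS0 : 0 ≤ S := Finset.sum_nonneg fun i _ => by positivity
  let Bd : M → Prop := fun x => ∀ c : Fin m → ℝ,
    ‖(∑ i, c i • X i x : TangentSpace I x)‖ ≤ S * ‖c‖
  have hbound' : ∀ᶠ x in 𝓝 z, Bd x := by
    filter_upwards [eventually_all.2 hbound] with x hx c
    calc ‖∑ i, c i • X i x‖ ≤ ∑ i, ‖c i • X i x‖ := norm_sum_le _ _
      _ ≤ ∑ i, (‖X i z‖ + 1) * ‖c‖ := Finset.sum_le_sum fun i _ => by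
          rw [norm_smul, mul_comm]
          exact mul_le_mul (hx i).le (norm_le_pi_norm c i) (norm_nonneg _) (by positivity)
      _ = S * ‖c‖ := by rw [hS, Finset.sum_mul]
  refine ⟨(S + 1) * (‖R‖ + 1), by positivity, ?_⟩
  have hfst : ∀ᶠ p in 𝓝 (z, b₀), p.1 ∈ U ∧ Bd p.1 :=
    (continuous_fst.tendsto (z, b₀)).eventually (Filter.Eventually.and hU hbound')
  filter_upwards [hclose, hfst] with p hp hpU e
  have hRe : ‖R (-e)‖ ≤ ‖R‖ * ‖e‖ := by simpa using R.le_opNorm (-e)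
  have hle : ‖R‖ * ‖e‖ ≤ (‖R‖ + 1) * ‖e‖ :=
    mul_le_mul_of_nonneg_right (by linarith) (norm_nonneg e)
  refine ⟨∑ i, (R (-e)).1 i • X i p.1, ?_, ?_, (R (-e)).2, ?_, ?_⟩
  · rw [← (hX p.1 hpU.1).2]
    exact Submodule.sum_mem _ fun i _ => Submodule.smul_mem _ _
      (Submodule.subset_span (mem_range_self i))
  · refine (hpU.2 _).trans ?_
    calc S * ‖(R (-e)).1‖ ≤ (S + 1) * ((‖R‖ + 1) * ‖e‖) :=
          mul_le_mul (by linarith) ((norm_fst_le _).trans (hRe.trans hle)) (norm_nonneg _)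
            (by positivity)
      _ = (S + 1) * (‖R‖ + 1) * ‖e‖ := by ring
  · refine ((norm_snd_le _).trans (hRe.trans hle)).trans ?_
    have : 0 ≤ S * ((‖R‖ + 1) * ‖e‖) := by positivity
    nlinarith
  · have h1 : mfderiv I 𝓘(ℝ, V) (extChartAt I z) p.1 (∑ i, (R (-e)).1 i • X i p.1) =
        T p.1 (R (-e)).1 := by
      rw [hTa, map_sum]
      exact Finset.sum_congr rfl fun i _ => map_smul _ _ _
    have h2 : P (mfderiv I 𝓘(ℝ, V) (extChartAt I z) p.1 (∑ i, (R (-e)).1 i • X i p.1)) -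
        P (B p.2 (R (-e)).2) + e = ((L p - L (z, b₀)).comp R) (-e) := by
      have h3 : ((L p - L (z, b₀)).comp R) (-e) = L p (R (-e)) - L (z, b₀) (R (-e)) := rfl
      have h4 : L p (R (-e)) = P (T p.1 (R (-e)).1) - P (B p.2 (R (-e)).2) := rfl
      rw [h1, h3, hLR, h4, sub_neg_eq_add]
    calc _ = ‖((L p - L (z, b₀)).comp R) (-e)‖ := congrArg _ h2
      _ ≤ ‖(L p - L (z, b₀)).comp R‖ * ‖-e‖ := ContinuousLinearMap.le_opNorm _ _
      _ ≤ 1 / 2 * ‖e‖ := by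
          rw [norm_neg]; exact mul_le_mul_of_nonneg_right hp.le (norm_nonneg e)
      _ = ‖e‖ / 2 := by ring

end Metric

end LocalIntersection

/-! ### Local product structure by a variational argument. -/

section IntersectionTheorem

open Filter

variable {V : Type*} [NormedAddCommGroup V] [NormedSpace ℝ V] [FiniteDimensional ℝ V]
  {H : Type*} [TopologicalSpace H] {I : ModelWithCorners ℝ V H}
  {M : Type*} [EMetricSpace M] [ChartedSpace H M] [IsManifold I 1 M]
  [RiemannianBundle (fun x : M => TangentSpace I x)]
  [IsContinuousRiemannianBundle V (fun x : M => TangentSpace I x)]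
  [IsRiemannianManifold I M]

/-- One can move along a leaf of `F` and along the plaque `v` so as to decrease the distance between
the two points in the coordinates `P`, at a cost proportional to the decrease. -/
theorem Foliation.IsTangentTo.exists_descent {Y : Type*}
    [NormedAddCommGroup Y] [NormedSpace ℝ Y] [FiniteDimensional ℝ Y]
    {F : Foliation I M} {E₁ : ∀ x : M, Submodule ℝ (TangentSpace I x)} (hF : F.IsTangentTo E₁)
    {z y : M} (hy : y ∈ (chartAt H z).source) {k : ℕ} {v : EuclideanSpace ℝ (Fin k) → V}
    {b : EuclideanSpace ℝ (Fin k)} {B : EuclideanSpace ℝ (Fin k) →L[ℝ] V}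
    (hv : HasFDerivAt v B b) (P : V →L[ℝ] Y) {K : ℝ}
    (hK : 0 < K) {u : TangentSpace I y} (hu : u ∈ E₁ y) {w : EuclideanSpace ℝ (Fin k)} {e : Y}
    (he : P (extChartAt I z y) - P (v b) = e) (he0 : e ≠ 0)
    (hue : ‖u‖ ≤ K * ‖e‖) (hwe : ‖w‖ ≤ K * ‖e‖)
    (happ : ‖(P (mfderiv I 𝓘(ℝ, V) (extChartAt I z) y u) - P (B w)) + e‖ ≤ ‖e‖ / 2) :
    ∀ᶠ s in 𝓝[>] (0 : ℝ), ∃ y', F.Reach y y' (2 * K * ‖e‖ * s) ∧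
      ‖P (extChartAt I z y') - P (v (b + s • w))‖ +
        1 / (12 * K) * (2 * K * ‖e‖ * s + s * ‖w‖) < ‖e‖ := by
  have hepos : 0 < ‖e‖ := norm_pos_iff.2 he0
  obtain ⟨φ, hφ, hyφ⟩ := F.cover y
  obtain ⟨c, a, rfl⟩ : ∃ c a, φ.plaque c a = y := ⟨_, _, φ.plaque_chart hyφ⟩
  obtain ⟨w', rfl⟩ : ∃ w', φ.dplaque c a w' = u := by
    have := (hF.range_dplaque hφ c a).ge hu
    exact this
  obtain ⟨s₀, hs₀, hreach⟩ := Foliation.reach_segment hφ c a w' (Λ := 2 * K * ‖e‖)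
    (hue.trans_lt (by nlinarith))
  set h : ℝ → Y := fun s => P (extChartAt I z (φ.segment c a w' s)) - P (v (b + s • w)) with hh
  have h0 : h 0 = e := by
    simp only [hh, FoliatedChart.segment, zero_smul, add_zero]; exact he
  let A : EuclideanSpace ℝ (Fin φ.k) →L[ℝ] V :=
    (mfderiv I 𝓘(ℝ, V) (extChartAt I z) (φ.plaque c a)).comp (φ.dplaque c a)
  have hA : HasFDerivAt (fun x => extChartAt I z (φ.plaque c x)) A a :=
    (φ.hasStrictFDerivAt_plaque c a hy).hasFDerivAt
  have hline : ∀ {j : ℕ} (p q : EuclideanSpace ℝ (Fin j)),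
      HasDerivAt (fun s : ℝ => p + s • q) q 0 := fun p q => by
    simpa using ((hasDerivAt_id (0 : ℝ)).smul_const q).const_add p
  have hderiv : HasDerivAt h (P (A w') - P (B w)) 0 := by
    have h1 : HasDerivAt (fun s : ℝ => extChartAt I z (φ.plaque c (a + s • w'))) (A w') 0 := by
      have hA' : HasFDerivAt (fun x => extChartAt I z (φ.plaque c x)) A (a + (0 : ℝ) • w') := by
        simpa using hA
      exact hA'.comp_hasDerivAt (0 : ℝ) (hline a w')
    have h2 : HasDerivAt (fun s : ℝ => v (b + s • w)) (B w) 0 := by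
      have hv' : HasFDerivAt v B (b + (0 : ℝ) • w) := by simpa using hv
      exact hv'.comp_hasDerivAt (0 : ℝ) (hline b w)
    exact (P.hasFDerivAt.comp_hasDerivAt (0 : ℝ) h1).sub (P.hasFDerivAt.comp_hasDerivAt (0 : ℝ) h2)
  have hdec := hderiv.eventually_norm_le (by rwa [h0]) (by rw [h0]; exact happ)
  filter_upwards [hdec, Ioo_mem_nhdsGT hs₀] with s hs hs'
  refine ⟨_, hreach s ⟨hs'.1.le, hs'.2.le⟩, ?_⟩
  rw [h0] at hs
  have hs : ‖P (extChartAt I z (φ.segment c a w' s)) - P (v (b + s • w))‖ ≤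
    ‖e‖ - 3 / 8 * s * ‖e‖ := hs
  -- The total cost is at most `3 K ‖e‖ s`. The weight `1 / (12 K)` turns this into `‖e‖ s / 4`,
  -- strictly less than the gain `3/8 ‖e‖ s`.
  have h3 : 2 * K * ‖e‖ * s + s * ‖w‖ ≤ 3 * K * ‖e‖ * s := by
    have := mul_le_mul_of_nonneg_left hwe hs'.1.le
    linarith
  have h4 : 1 / (12 * K) * (2 * K * ‖e‖ * s + s * ‖w‖) ≤ 1 / 4 * ‖e‖ * s := by
    calc 1 / (12 * K) * (2 * K * ‖e‖ * s + s * ‖w‖) ≤ 1 / (12 * K) * (3 * K * ‖e‖ * s) :=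
          mul_le_mul_of_nonneg_left h3 (by positivity)
      _ = 1 / 4 * ‖e‖ * s := by field_simp; ring
  have h5 : 0 < ‖e‖ * s := mul_pos hepos hs'.1
  linarith

variable [CompleteSpace M] [LocallyCompactSpace M]

/-- Local product structure, uniformly in the first foliation: near a point `z`, each leaf of each
foliation `F` tangent to `E₁` meets the plaque through `z` of a foliation `G` tangent to a
complement of `E₁` in the uniquely integrable bundle `E`. -/
theorem IsUniquelyIntegrableBy.exists_mem_leaf_inter_plaque {W G : Foliation I M}
    {E E₁ E₂ : ∀ x : M, Submodule ℝ (TangentSpace I x)} (hW : IsUniquelyIntegrableBy E W)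
    (hE₁ : IsContinuousSubbundle E₁) (hG : G.IsTangentTo E₂) (hE : ∀ x, E₁ x ⊔ E₂ x = E x)
    {φ ψ : FoliatedChart I M} (hφ : φ ∈ G.atlas) (hψ : ψ ∈ W.atlas) {z : M}
    (hzφ : z ∈ φ.chart.source) (hzψ : z ∈ ψ.chart.source) {O : Set M} (hO : O ∈ 𝓝 z) :
    ∃ O' ∈ 𝓝 z, ∀ F : Foliation I M, F.IsTangentTo E₁ → ∀ z' ∈ O',
      (ψ.chart z').2 = (ψ.chart z).2 → ∃ q ∈ O, q ∈ F.leaf z' ∧ q ∈ φ.chart.source ∧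
        (φ.chart q).2 = (φ.chart z).2 := by
  have hE₁E : ∀ x, E₁ x ≤ E x := fun x => hE x ▸ le_sup_left
  have hE₂E : ∀ x, E₂ x ≤ E x := fun x => hE x ▸ le_sup_right
  let Ez : Submodule ℝ V := E z
  -- A linear projection onto `E z` gives coordinates on the `W`-plaque of `z`. Both sought points
  -- will lie in this plaque, so it suffices to make their projections agree.
  obtain ⟨P₀, hP₀⟩ := Ez.subtype.exists_leftInverse_of_injective Ez.ker_subtype
  let P : V →L[ℝ] Ez := LinearMap.toContinuousLinearMap P₀
  have hPid : ∀ y : Ez, P y = y := fun y => congrArg (fun f : Ez →ₗ[ℝ] Ez => f y) hP₀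
  obtain ⟨N, hN, hNinj⟩ := hW.1.exists_nhds_injective hψ hzψ P (fun v hv h => by
    have := hPid ⟨v, hv⟩
    rw [h] at this
    exact (congrArg Subtype.val this).symm)
  obtain ⟨c, b₀, hcb⟩ : ∃ c b₀, φ.plaque c b₀ = z := ⟨_, _, φ.plaque_chart hzφ⟩
  have hφz : φ.chart z = (b₀, c) := by rw [← hcb, φ.chart_plaque]
  let v : EuclideanSpace ℝ (Fin φ.k) → V := fun b => extChartAt I z (φ.plaque c b)
  have hchz : (chartAt H z).source ∈ 𝓝 z :=
    (chartAt H z).open_source.mem_nhds (mem_chart_source H z)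
  have hch : ∀ᶠ b in 𝓝 b₀, φ.plaque c b ∈ (chartAt H z).source :=
    (φ.continuous_plaque c).continuousAt.eventually (by rw [hcb]; exact hchz)
  have hvC : ∀ b, φ.plaque c b ∈ (chartAt H z).source → ContDiffAt ℝ 1 v b := fun b hb =>
    ((contMDiffAt_extChartAt' hb).comp b (φ.contMDiff_plaque' c b)).contDiffAt
  have hch₀ : φ.plaque c b₀ ∈ (chartAt H z).source := hch.self_of_nhds
  have hBcont : ContinuousAt (fderiv ℝ v) b₀ :=
    ((hvC b₀ hch₀).fderiv_right (m := 0) le_rfl).continuousAt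
  have hid : mfderiv I 𝓘(ℝ, V) (extChartAt I z) z = ContinuousLinearMap.id ℝ _ :=
    mfderiv_extChartAt_self
  have hB₀ : fderiv ℝ v b₀ = (φ.dplaque c b₀ : EuclideanSpace ℝ (Fin φ.k) →L[ℝ] V) := by
    have hA : ∀ p : M, p = z → ∀ w : V,
        (mfderiv I 𝓘(ℝ, V) (extChartAt I z) p : V →L[ℝ] V) w = w := by
      rintro p rfl w; exact congrArg (fun L : V →L[ℝ] V => L w) hid
    let A : EuclideanSpace ℝ (Fin φ.k) →L[ℝ] V :=
      (mfderiv I 𝓘(ℝ, V) (extChartAt I z) (φ.plaque c b₀)).comp (φ.dplaque c b₀)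
    have h1 : HasFDerivAt v A b₀ := (φ.hasStrictFDerivAt_plaque c b₀ hch₀).hasFDerivAt
    rw [h1.fderiv]
    ext1 w
    exact hA _ hcb _
  let E₁z : Submodule ℝ V := E₁ z
  let E₂z : Submodule ℝ V := E₂ z
  have hEz : E₁z ⊔ E₂z = Ez := hE z
  have hrange : ∀ e : V, e ∈ E₂z → ∃ w, fderiv ℝ v b₀ w = e := fun e he => by
    have h9 : ∀ p : M, p = z → e ∈ (E₂ p : Submodule ℝ V) := fun p hp => hp ▸ he
    obtain ⟨w, hw⟩ := (hG.range_dplaque hφ c b₀).ge (h9 _ hcb)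
    exact ⟨w, by rw [hB₀]; exact hw⟩
  obtain ⟨K, hK, happ⟩ := hE₁.exists_approx (z := z) hBcont P (fun y => by
    have h1 : (y : V) ∈ E₁z ⊔ E₂z := hEz.ge y.2
    obtain ⟨u, hu, e, he, hue⟩ := Submodule.mem_sup.1 h1
    obtain ⟨w, hw⟩ := hrange e he
    exact ⟨u, hu, w, by rw [hw, hue]; exact hPid y⟩)
  rw [nhds_prod_eq] at happ
  obtain ⟨pa, hpa, pb, hpb, happ⟩ := eventually_prod_iff.1 happ
  have hplaque : ∀ᶠ b in 𝓝 b₀, φ.plaque c b ∈ N ∧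
      (ψ.chart (φ.plaque c b)).2 = (ψ.chart z).2 := by
    have h1 := hW.eventually_plaque_subset hG hE₂E hφ hψ hzφ hzψ
    have h2 := (φ.continuous_plaque c).tendsto b₀
    rw [hcb] at h2
    filter_upwards [h2 hN, h2.eventually h1] with b hb hb'
    exact ⟨hb, hb' (by rw [φ.chart_plaque, hφz])⟩
  obtain ⟨ε, hε, hεgood⟩ := EMetric.mem_nhds_iff.1 (inter_mem hN (inter_mem hpa
    (inter_mem hO (inter_mem hchz (ψ.source_mem_nhds hzψ)))))
  obtain ⟨r, hr, hrgood⟩ := Metric.nhds_basis_closedBall.mem_iff.1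
    (inter_mem hpb (inter_mem hplaque hch))
  -- One `R` is for the distance from `z` to `z'`, the other for the time spent in the leaf of `F`.
  obtain ⟨R, hRε, hR0, hRr⟩ : ∃ R : ℝ, ENNReal.ofReal (R + R) < ε ∧ 0 < R ∧ R < r := by
    have h1 : ∀ᶠ R : ℝ in 𝓝[>] 0, ENNReal.ofReal (R + R) < ε := by
      have : Continuous fun R : ℝ => ENNReal.ofReal (R + R) :=
        ENNReal.continuous_ofReal.comp (continuous_id.add continuous_id)
      refine (this.tendsto' 0 0 (by simp)).mono_left nhdsWithin_le_nhds |>.eventually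
        (gt_mem_nhds hε)
    obtain ⟨R, h⟩ := (h1.and (Ioo_mem_nhdsGT hr)).exists
    exact ⟨R, h.1, h.2⟩
  set κ : ℝ := 1 / (12 * K) with hκ
  have hκ0 : 0 < κ := by positivity
  have hcontP : ContinuousAt (fun x => ‖P (extChartAt I z x) - P (extChartAt I z z)‖) z :=
    ((P.continuous.continuousAt.comp (continuousAt_extChartAt z)).sub continuousAt_const).norm
  -- The neighbourhood is fixed before `F`: it only makes the functional `J` start below `κ * R`.
  refine ⟨Metric.eball z (ENNReal.ofReal R) ∩
    {x | ‖P (extChartAt I z x) - P (extChartAt I z z)‖ < κ * R},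
    inter_mem (Metric.eball_mem_nhds z (by simpa using hR0))
      (hcontP.eventually (gt_mem_nhds (by simpa using mul_pos hκ0 hR0))), ?_⟩
  rintro F hF z' ⟨hz'R, hz'P⟩ hz'ψ
  have hnear : ∀ {y T}, T ≤ R → 0 ≤ T → F.Reach z' y T → y ∈ Metric.eball z ε := by
    intro y T hT hT0 h
    have hz'R : edist z' z < ENNReal.ofReal R := hz'R
    calc edist y z ≤ edist z' y + edist z' z := edist_triangle_left _ _ _
      _ ≤ ENNReal.ofReal R + ENNReal.ofReal R :=
        add_le_add ((h.edist_le hT0).trans (ENNReal.ofReal_le_ofReal hT)) hz'R.le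
      _ = ENNReal.ofReal (R + R) := (ENNReal.ofReal_add hR0.le hR0.le).symm
      _ < ε := hRε
  let S : Set ((M × ℝ) × EuclideanSpace ℝ (Fin φ.k)) :=
    {p : M × ℝ | p.2 ∈ Icc 0 R ∧ F.Reach z' p.1 p.2} ×ˢ Metric.closedBall b₀ R
  have hS : IsCompact S := (F.isCompact_reach z' R).prod (isCompact_closedBall b₀ R)
  -- An Ekeland-type functional: the gap between the point of the leaf and the point of the plaque,
  -- plus `κ` times the distance travelled. Its minimum exists because the points reached in bounded
  -- time form a compact set.
  let J : (M × ℝ) × EuclideanSpace ℝ (Fin φ.k) → ℝ := fun p =>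
    ‖P (extChartAt I z p.1.1) - P (v p.2)‖ + κ * (p.1.2 + ‖p.2 - b₀‖)
  have hJ : ContinuousOn J S := by
    rintro ⟨⟨y, T⟩, b⟩ ⟨⟨hT, hy⟩, hb⟩
    have hy1 : y ∈ (chartAt H z).source := (hεgood (hnear hT.2 hT.1 hy)).2.2.2.1
    have hb1 : φ.plaque c b ∈ (chartAt H z).source :=
      (hrgood (Metric.closedBall_subset_closedBall hRr.le hb)).2.2
    have c1 : ContinuousAt (fun p : (M × ℝ) × EuclideanSpace ℝ (Fin φ.k) =>
        extChartAt I z p.1.1) ((y, T), b) :=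
      ContinuousAt.comp (f := fun p : (M × ℝ) × EuclideanSpace ℝ (Fin φ.k) => p.1.1)
        (continuousAt_extChartAt' (by rwa [extChartAt_source]))
        (continuous_fst.comp continuous_fst).continuousAt
    have c2 : ContinuousAt (fun p : (M × ℝ) × EuclideanSpace ℝ (Fin φ.k) => v p.2) ((y, T), b) :=
      ContinuousAt.comp (f := fun p : (M × ℝ) × EuclideanSpace ℝ (Fin φ.k) => p.2)
        (x := ((y, T), b)) (hvC b hb1).continuousAt continuous_snd.continuousAt
    refine ContinuousAt.continuousWithinAt ?_
    refine ((P.continuous.continuousAt.comp c1).sub (P.continuous.continuousAt.comp c2)).norm.add ?_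
    fun_prop
  have hb₀S : ((z', (0 : ℝ)), b₀) ∈ S :=
    ⟨⟨⟨le_rfl, hR0.le⟩, Foliation.Reach.refl F z' 0⟩, Metric.mem_closedBall_self hR0.le⟩
  obtain ⟨⟨⟨y, T⟩, b⟩, hmem, hmin⟩ := hS.exists_isMinOn ⟨_, hb₀S⟩ hJ
  obtain ⟨⟨hT, hy⟩, hb⟩ := hmem
  have hmin : ∀ p ∈ S, J ((y, T), b) ≤ J p := fun p hp => hmin hp
  have hT : T ∈ Icc 0 R := hT
  have hy : F.Reach z' y T := hy
  have hb : b ∈ Metric.closedBall b₀ R := hb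
  obtain ⟨hyN, hypa, hyO, hych, hyψ⟩ := hεgood (hnear hT.2 hT.1 hy)
  obtain ⟨hbpb, ⟨hbN, hbψ⟩, hbch⟩ := hrgood (Metric.closedBall_subset_closedBall hRr.le hb)
  have hvb₀ : v b₀ = extChartAt I z z := by simp only [v, hcb]
  have hJlt : J ((y, T), b) < κ * R := by
    refine (hmin _ hb₀S).trans_lt ?_
    simpa [J, hvb₀] using hz'P
  -- The penalty is at most the initial value of `J`, so the minimizer does not touch the
  -- constraints and small moves from it are admissible.
  have hsum : T + ‖b - b₀‖ < R := by
    have h1 : κ * (T + ‖b - b₀‖) ≤ J ((y, T), b) := by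
      simp only [J]; linarith [norm_nonneg (P (extChartAt I z y) - P (v b))]
    exact lt_of_mul_lt_mul_left (h1.trans_lt hJlt) hκ0.le
  have hTR : T < R := lt_of_le_of_lt (le_add_of_nonneg_right (norm_nonneg _)) hsum
  have hbR : ‖b - b₀‖ < R := lt_of_le_of_lt (le_add_of_nonneg_left hT.1) hsum
  have hzero : P (extChartAt I z y) - P (v b) = 0 := by
    -- With a positive gap, `exists_descent` would reduce the gap by more than `κ` times its cost
    -- and so lower `J`.
    by_contra hne
    set e := P (extChartAt I z y) - P (v b) with he
    obtain ⟨u, hu, hue, w, hwe, hap⟩ := happ hypa hbpb e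
    have hdesc := hF.exists_descent hych ((hvC b hbch).differentiableAt one_ne_zero).hasFDerivAt
      P hK hu he.symm hne hue hwe hap
    have hTs : ∀ᶠ s : ℝ in 𝓝[>] 0, T + 2 * K * ‖e‖ * s < R := by
      have : Continuous fun s : ℝ => T + 2 * K * ‖e‖ * s := by fun_prop
      exact (this.tendsto' 0 T (by simp)).mono_left nhdsWithin_le_nhds |>.eventually
        (gt_mem_nhds hTR)
    have hbs : ∀ᶠ s : ℝ in 𝓝[>] 0, ‖b + s • w - b₀‖ < R := by
      have : Continuous fun s : ℝ => ‖b + s • w - b₀‖ := by fun_prop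
      exact (this.tendsto' 0 ‖b - b₀‖ (by simp)).mono_left nhdsWithin_le_nhds |>.eventually
        (gt_mem_nhds hbR)
    obtain ⟨s, ⟨y', hyy', hlt⟩, hTs, hbs, hs⟩ :=
      (hdesc.and (hTs.and (hbs.and self_mem_nhdsWithin))).exists
    have hs : 0 < s := hs
    have hΛs : 0 ≤ 2 * K * ‖e‖ * s := by positivity
    have hmem' : ((y', T + 2 * K * ‖e‖ * s), b + s • w) ∈ S :=
      ⟨⟨⟨add_nonneg hT.1 hΛs, hTs.le⟩, hy.trans hT.1 hΛs hyy'⟩, by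
        simpa [dist_eq_norm] using hbs.le⟩
    have h1 := hmin _ hmem'
    simp only [J] at h1
    have h2 : ‖b + s • w - b₀‖ ≤ ‖b - b₀‖ + s * ‖w‖ := by
      calc ‖b + s • w - b₀‖ = ‖(b - b₀) + s • w‖ := by congr 1; abel
        _ ≤ ‖b - b₀‖ + ‖s • w‖ := norm_add_le _ _
        _ = ‖b - b₀‖ + s * ‖w‖ := by rw [norm_smul, Real.norm_eq_abs, abs_of_pos hs]
    have h3 := mul_le_mul_of_nonneg_left h2 hκ0.le
    rw [← he] at h1
    linarith
  -- The path in the leaf of `F` never leaves the source of `ψ` and is a leaf path of `W`, so it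
  -- keeps its `W`-height.
  have hyW : (ψ.chart y).2 = (ψ.chart z).2 := by
    obtain ⟨σ, hσ, hσ0, hσT⟩ := hy
    have h1 := (hW.isLeafPath hF hE₁E hσ).eqOn_snd (s := Icc 0 T) isPreconnected_Icc hψ
      (fun t ht => (hεgood (hnear (ht.2.trans hT.2) ht.1 ⟨σ, hσ, hσ0, rfl⟩)).2.2.2.2)
      (right_mem_Icc.2 hT.1) (left_mem_Icc.2 hT.1)
    rw [hσ0, hσT] at h1
    exact h1.trans hz'ψ
  have hyb : y = φ.plaque c b := hNinj y hyN _ hbN hyW hbψ (sub_eq_zero.1 hzero)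
  refine ⟨y, hyO, hy.mem_leaf, hyb ▸ φ.plaque_mem_source c b, ?_⟩
  rw [hyb, φ.chart_plaque, hφz]

end IntersectionTheorem

/-! ### Images of foliations, and rates of iterates. -/

section Pushforward

variable {V : Type*} [NormedAddCommGroup V] [NormedSpace ℝ V]
  {H : Type*} [TopologicalSpace H] {I : ModelWithCorners ℝ V H}

section Topological

variable {M : Type*} [TopologicalSpace M] [ChartedSpace H M]

theorem mfderiv_comp_apply_of_diffeomorph {X : Type*} [NormedAddCommGroup X] [NormedSpace ℝ X]
    {H' : Type*} [TopologicalSpace H'] {J : ModelWithCorners ℝ X H'} {N : Type*}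
    [TopologicalSpace N] [ChartedSpace H' N] (h : M ≃ₘ^1⟮I, I⟯ M) {σ : N → M} {a : N}
    (hσ : MDifferentiableAt J I σ a) :
    mfderiv J I (h ∘ σ) a = (mfderiv I I h (σ a)).comp (mfderiv J I σ a) :=
  mfderiv_comp a (h.mdifferentiable one_ne_zero (σ a)) hσ

theorem Diffeomorph.mfderiv_symm_mfderiv (h : M ≃ₘ^1⟮I, I⟯ M) (x : M) (u : TangentSpace I x) :
    (mfderiv I I h.symm (h x) (mfderiv I I h x u) : V) = u := by
  have h1 := mfderiv_comp_apply_of_diffeomorph h.symm (h.mdifferentiable one_ne_zero x)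
  have h2 : ∀ k : M → M, k = id → (mfderiv I I k x u : V) = u := by
    rintro _ rfl
    exact congrArg (fun L : V →L[ℝ] V => L u) (mfderiv_id (I := I) (x := x))
  have h3 := h2 (h.symm ∘ h) (funext h.symm_apply_apply)
  have h4 : (mfderiv I I (h.symm ∘ h) x u : V) = mfderiv I I h.symm (h x) (mfderiv I I h x u) :=
    congrArg (fun L : V →L[ℝ] V => L u) h1
  exact h4.symm.trans h3

theorem Diffeomorph.mfderiv_injective (h : M ≃ₘ^1⟮I, I⟯ M) (x : M) :
    Function.Injective (mfderiv I I h x) := fun u v huv => by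
  have h1 := h.mfderiv_symm_mfderiv x u
  have h2 := h.mfderiv_symm_mfderiv x v
  rw [huv] at h1
  exact h1.symm.trans h2

/-- The image of a foliated chart under a diffeomorphism. -/
noncomputable def FoliatedChart.push (φ : FoliatedChart I M) (h : M ≃ₘ^1⟮I, I⟯ M) :
    FoliatedChart I M where
  k := φ.k
  l := φ.l
  chart := h.toHomeomorph.symm.transOpenPartialHomeomorph φ.chart
  target_eq := φ.target_eq
  contMDiff_plaque c := h.contMDiff.comp (φ.contMDiff_plaque c)
  injective_plaque c a := by
    have h1 := mfderiv_comp_apply_of_diffeomorph h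
      ((φ.contMDiff_plaque c).mdifferentiable one_ne_zero a)
    have h2 : Function.Injective (mfderiv (𝓡 φ.k) I (h ∘ fun a => φ.chart.symm (a, c)) a) := by
      rw [h1]
      exact (h.mfderiv_injective _).comp (φ.injective_plaque c a)
    exact h2

/-- The image of a foliation under a diffeomorphism. -/
noncomputable def Foliation.push (F : Foliation I M) (h : M ≃ₘ^1⟮I, I⟯ M) : Foliation I M where
  atlas := (fun φ => φ.push h) '' F.atlas
  cover p := by
    obtain ⟨φ, hφ, hp⟩ := F.cover (h.symm p)
    exact ⟨_, ⟨φ, hφ, rfl⟩, hp⟩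
  compatible := by
    rintro _ ⟨φ, hφ, rfl⟩ _ ⟨ψ, hψ, rfl⟩ p ⟨hp, hp'⟩
    obtain ⟨U, hU, hUs, hUe⟩ := F.compatible φ hφ ψ hψ (h.symm p) ⟨hp, hp'⟩
    exact ⟨h.symm ⁻¹' U, h.symm.continuous.continuousAt hU, fun x hx => hUs hx,
      fun x hx y hy => hUe _ hx _ hy⟩

/-- Pulls points on a leaf of `h(Wc)` back to a leaf of `Wc`, where quasi-isometry applies. -/
theorem Foliation.mem_leaf_push {F : Foliation I M} {h : M ≃ₘ^1⟮I, I⟯ M} {x y : M}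
    (hxy : y ∈ (F.push h).leaf x) : h.symm y ∈ F.leaf (h.symm x) := by
  have h' : Relation.EqvGen (F.push h).SamePlaque x y := hxy
  clear hxy
  induction h' with
  | rel x y h1 =>
    obtain ⟨_, ⟨φ, hφ, rfl⟩, hx, hy, hxy⟩ := h1
    exact F.mem_leaf_of_snd_eq hφ hx hy hxy
  | refl x => exact F.mem_leaf_self _
  | symm x y _ ih => exact Foliation.mem_leaf_symm ih
  | trans x y z _ _ ih ih' => exact Foliation.mem_leaf_trans ih ih'

theorem Foliation.IsTangentTo.push {F : Foliation I M}
    {E : ∀ x : M, Submodule ℝ (TangentSpace I x)} (hF : F.IsTangentTo E) {h : M ≃ₘ^1⟮I, I⟯ M}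
    (hE : IsTangentInvariant h E) : (F.push h).IsTangentTo E := by
  rintro _ ⟨φ, hφ, rfl⟩
  have h2 : ∀ (a : EuclideanSpace ℝ (Fin φ.k)) (c : EuclideanSpace ℝ (Fin φ.l)),
      (mfderiv (𝓡 φ.k) I (h ∘ fun a => φ.chart.symm (a, c)) a).range =
      E (h (φ.chart.symm (a, c))) := by
    intro a c
    rw [mfderiv_comp_apply_of_diffeomorph h
      ((φ.contMDiff_plaque c).mdifferentiable one_ne_zero a), ← hE, ← hF φ hφ a c]
    refine le_antisymm ?_ ?_
    · rintro _ ⟨w, rfl⟩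
      exact ⟨_, ⟨w, rfl⟩, rfl⟩
    · rintro _ ⟨_, ⟨w, rfl⟩, rfl⟩
      exact ⟨w, rfl⟩
  exact h2

/-- The iterates of a diffeomorphism, as diffeomorphisms. -/
noncomputable def Diffeomorph.iterate (h : M ≃ₘ^1⟮I, I⟯ M) : ℕ → M ≃ₘ^1⟮I, I⟯ M
  | 0 => Diffeomorph.refl I M 1
  | n + 1 => (h.iterate n).trans h

theorem Diffeomorph.coe_iterate (h : M ≃ₘ^1⟮I, I⟯ M) (n : ℕ) : ⇑(h.iterate n) = h^[n] := by
  induction n with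
  | zero => rfl
  | succ n ih => rw [Function.iterate_succ', ← ih]; rfl

theorem Diffeomorph.mfderiv_iterate_succ (h : M ≃ₘ^1⟮I, I⟯ M) (n : ℕ) (x : M) :
    mfderiv I I (h.iterate (n + 1)) x =
      (mfderiv I I h (h.iterate n x)).comp (mfderiv I I (h.iterate n) x) :=
  mfderiv_comp_apply_of_diffeomorph h ((h.iterate n).mdifferentiable one_ne_zero x)

theorem IsTangentInvariant.mfderiv_mem {f : M → M} {E : ∀ x : M, Submodule ℝ (TangentSpace I x)}
    (hE : IsTangentInvariant f E) {x : M} {u : TangentSpace I x} (hu : u ∈ E x) :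
    mfderiv I I f x u ∈ E (f x) :=
  (hE x).le ⟨u, hu, rfl⟩

theorem IsTangentInvariant.iterate {h : M ≃ₘ^1⟮I, I⟯ M}
    {E : ∀ x : M, Submodule ℝ (TangentSpace I x)} (hE : IsTangentInvariant h E) (n : ℕ) :
    IsTangentInvariant (h.iterate n) E := by
  induction n with
  | zero =>
    intro x
    have h1 : mfderiv I I (h.iterate 0) x = ContinuousLinearMap.id ℝ _ := mfderiv_id
    rw [h1]
    exact Submodule.map_id _
  | succ n ih =>
    intro x
    rw [h.mfderiv_iterate_succ]
    have h1 : (E x).map ((mfderiv I I h (h.iterate n x)).toLinearMap ∘ₗ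
        (mfderiv I I (h.iterate n) x).toLinearMap) = E (h (h.iterate n x)) := by
      rw [Submodule.map_comp, ih x, hE]
    exact h1

end Topological

variable {M : Type*} [EMetricSpace M] [ChartedSpace H M]
  [RiemannianBundle (fun x : M => TangentSpace I x)]

theorem Diffeomorph.norm_mfderiv_iterate_le {h : M ≃ₘ^1⟮I, I⟯ M}
    {E : ∀ x : M, Submodule ℝ (TangentSpace I x)}
    (hE : ∀ (n : ℕ) (x : M), ∀ u ∈ E x, mfderiv I I (h.iterate n) x u ∈ E (h.iterate n x)) {k : ℝ}
    (hk0 : 0 ≤ k) (hk : ∀ (x : M) (u : TangentSpace I x), u ∈ E x → ‖mfderiv I I h x u‖ ≤ k * ‖u‖)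
    (n : ℕ) (x : M) (u : TangentSpace I x) (hu : u ∈ E x) :
    ‖mfderiv I I (h.iterate n) x u‖ ≤ k ^ n * ‖u‖ := by
  induction n with
  | zero =>
    have h1 : mfderiv I I (h.iterate 0) x = ContinuousLinearMap.id ℝ _ := mfderiv_id
    rw [h1, pow_zero, one_mul]
    exact le_rfl
  | succ n ih =>
    rw [h.mfderiv_iterate_succ, pow_succ', mul_assoc]
    exact (hk _ _ (hE n x u hu)).trans (mul_le_mul_of_nonneg_left ih hk0)

theorem Diffeomorph.le_norm_mfderiv_iterate {h : M ≃ₘ^1⟮I, I⟯ M}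
    {E : ∀ x : M, Submodule ℝ (TangentSpace I x)} (hE : IsTangentInvariant h E) {k : ℝ}
    (hk0 : 0 ≤ k) (hk : ∀ (x : M) (u : TangentSpace I x), u ∈ E x → k * ‖u‖ ≤ ‖mfderiv I I h x u‖)
    (n : ℕ) (x : M) (u : TangentSpace I x) (hu : u ∈ E x) :
    k ^ n * ‖u‖ ≤ ‖mfderiv I I (h.iterate n) x u‖ := by
  induction n with
  | zero =>
    have h1 : mfderiv I I (h.iterate 0) x = ContinuousLinearMap.id ℝ _ := mfderiv_id
    rw [h1, pow_zero, one_mul]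
    exact le_rfl
  | succ n ih =>
    rw [h.mfderiv_iterate_succ, pow_succ', mul_assoc]
    exact (mul_le_mul_of_nonneg_left ih hk0).trans (hk _ _ ((hE.iterate n).mfderiv_mem hu))

theorem Diffeomorph.norm_mfderiv_symm_le {h : M ≃ₘ^1⟮I, I⟯ M}
    {E : ∀ x : M, Submodule ℝ (TangentSpace I x)} (hE : IsTangentInvariant h E) {k : ℝ}
    (hk0 : 0 < k) (hk : ∀ (x : M) (u : TangentSpace I x), u ∈ E x → k * ‖u‖ ≤ ‖mfderiv I I h x u‖)
    (x : M) (u : TangentSpace I x) (hu : u ∈ E x) :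
    ‖mfderiv I I h.symm x u‖ ≤ k⁻¹ * ‖u‖ := by
  obtain ⟨y, rfl⟩ := h.surjective x
  obtain ⟨v, hv, rfl⟩ := (hE y).ge hu
  have h1 : ∀ (p : M) (hp : p = y) (w : TangentSpace I p), (w : V) = v → ‖w‖ = ‖v‖ := by
    rintro p rfl w rfl; rfl
  have h2 := h1 _ (h.symm_apply_apply y) _ (h.mfderiv_symm_mfderiv y v)
  calc _ = ‖v‖ := h2
    _ = k⁻¹ * (k * ‖v‖) := by field_simp
    _ ≤ _ := mul_le_mul_of_nonneg_left (hk y v hv) (inv_nonneg.2 hk0.le)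

/-- `h` has bounded derivative and preserves `Ec` and `Eu`, and the product of its rate of expansion
of `Ec` with the rate of expansion of `Eu` of its inverse is at most `ε`. -/
structure SeparatesBundles (h : M ≃ₘ^1⟮I, I⟯ M) (Ec Eu : ∀ x : M, Submodule ℝ (TangentSpace I x))
    (ε : ℝ) : Prop where
  invariant_left : IsTangentInvariant h Ec
  invariant_right : IsTangentInvariant h Eu
  exists_bound : ∃ C > 0, ∀ (x : M) (v : TangentSpace I x), ‖mfderiv I I h x v‖ ≤ C * ‖v‖
  exists_rates : ∃ a > 0, ∃ b > 0, a * b ≤ ε ∧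
    (∀ (x : M) (u : TangentSpace I x), u ∈ Ec x → ‖mfderiv I I h x u‖ ≤ a * ‖u‖) ∧
    ∀ (x : M) (v : TangentSpace I x), v ∈ Eu x → ‖mfderiv I I h.symm x v‖ ≤ b * ‖v‖

theorem HasBoundedDerivative.exists_iterate_bound {f : M ≃ₘ^1⟮I, I⟯ M}
    (hf : HasBoundedDerivative I f) (n : ℕ) :
    ∃ C > 0, ∀ (x : M) (v : TangentSpace I x), ‖mfderiv I I (f.iterate n) x v‖ ≤ C * ‖v‖ := by
  obtain ⟨C, hC⟩ := hf
  have hC' : ∀ (x : M) (v : TangentSpace I x), ‖mfderiv I I f x v‖ ≤ max C 1 * ‖v‖ := fun x v =>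
    (hC x v).trans (mul_le_mul_of_nonneg_right (le_max_left _ _) (norm_nonneg _))
  have h1 : 0 < max C 1 := zero_lt_one.trans_le (le_max_right _ _)
  exact ⟨max C 1 ^ n, pow_pos h1 n, fun x v =>
    Diffeomorph.norm_mfderiv_iterate_le (E := fun _ => ⊤) (fun _ _ _ _ => Submodule.mem_top) h1.le
      (fun x u _ => hC' x u) n x v Submodule.mem_top⟩

/-- If `Eu` absolutely dominates `Ec` under `f`, then either `Ec` is trivial or an iterate of `f`
expands `Eu` at a rate twice as large as `Ec`. -/
theorem AbsolutelyDominates.exists_rate {f : M ≃ₘ^1⟮I, I⟯ M} (hf : HasBoundedDerivative I f)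
    {Ec Eu : ∀ x : M, Submodule ℝ (TangentSpace I x)} (hdom : AbsolutelyDominates f Eu Ec)
    (hne : ∃ x, ∃ u ∈ Ec x, u ≠ 0) :
    ∃ n, ∃ a > 0, (∀ (x : M) (u : TangentSpace I x), u ∈ Ec x →
        ‖mfderiv I I (f.iterate n) x u‖ ≤ a * ‖u‖) ∧
      ∀ (x : M) (v : TangentSpace I x), v ∈ Eu x →
        2 * a * ‖v‖ ≤ ‖mfderiv I I (f.iterate n) x v‖ := by
  obtain ⟨n, -, hn⟩ := hdom
  obtain ⟨C, hC0, hC⟩ := hf.exists_iterate_bound n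
  rw [← f.coe_iterate n] at hn
  have hunit : ∀ (x : M) (u : TangentSpace I x), u ≠ 0 → ‖(‖u‖⁻¹ • u : TangentSpace I x)‖ = 1 :=
    fun x u hu => norm_smul_inv_norm (𝕜 := ℝ) hu
  have hnorm : ∀ (x : M) (u : TangentSpace I x), ‖mfderiv I I (f.iterate n) x
      (‖u‖⁻¹ • u : TangentSpace I x)‖ = ‖u‖⁻¹ * ‖mfderiv I I (f.iterate n) x u‖ := fun x u => by
    rw [map_smul, norm_smul, norm_inv, norm_norm]
  -- The rate `a` is the supremum of `S`. Domination is absolute, so each unit vector of `Eu` at any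
  -- point is compared with all of `S` at once, which gives the factor `2`.
  set S : Set ℝ := {r | ∃ x, ∃ u ∈ Ec x, ‖u‖ = 1 ∧ ‖mfderiv I I (f.iterate n) x u‖ = r} with hS
  have hSb : BddAbove S := ⟨C, by rintro _ ⟨x, u, -, hu, rfl⟩; simpa [hu] using hC x u⟩
  have hmem : ∀ (x : M) (u : TangentSpace I x), u ∈ Ec x → u ≠ 0 →
      ‖u‖⁻¹ * ‖mfderiv I I (f.iterate n) x u‖ ∈ S := fun x u hu hu0 =>
    ⟨x, ‖u‖⁻¹ • u, (Ec x).smul_mem _ hu, hunit x u hu0, hnorm x u⟩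
  obtain ⟨x₀, u₀, hu₀, hu₀0⟩ := hne
  have hSn : S.Nonempty := ⟨_, hmem x₀ u₀ hu₀ hu₀0⟩
  have hpos : 0 < ‖u₀‖⁻¹ * ‖mfderiv I I (f.iterate n) x₀ u₀‖ := by
    refine mul_pos (inv_pos.2 (norm_pos_iff.2 hu₀0)) (norm_pos_iff.2 fun h => hu₀0 ?_)
    exact (f.iterate n).mfderiv_injective x₀ (h.trans (map_zero _).symm)
  refine ⟨n, sSup S, hpos.trans_le (le_csSup hSb (hmem x₀ u₀ hu₀ hu₀0)), fun x u hu => ?_,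
    fun x v hv => ?_⟩
  · rcases eq_or_ne u 0 with rfl | hu0
    · simp
    · have h1 := le_csSup hSb (hmem x u hu hu0)
      rwa [inv_mul_le_iff₀ (norm_pos_iff.2 hu0), mul_comm] at h1
  · rcases eq_or_ne v 0 with rfl | hv0
    · simp
    · have h1 : sSup S ≤ 1 / 2 * (‖v‖⁻¹ * ‖mfderiv I I (f.iterate n) x v‖) := by
        refine csSup_le hSn ?_
        rintro _ ⟨y, u, hu, hu1, rfl⟩
        rw [← hnorm]
        exact (hn y x u _ hu ((Eu x).smul_mem _ hv) hu1 (hunit x v hv0)).le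
      have h2 : 0 < ‖v‖ := norm_pos_iff.2 hv0
      calc 2 * sSup S * ‖v‖ ≤
          2 * (1 / 2 * (‖v‖⁻¹ * ‖mfderiv I I (f.iterate n) x v‖)) * ‖v‖ := by gcongr
        _ = _ := by field_simp

/-- The `m`-th power of the iterate from `exists_rate` has rates `a ^ m` and `(2 * a)⁻¹ ^ m`, with
product `2⁻ᵐ`. If `Ec` vanishes everywhere, its rate is arbitrary and the identity serves, with
rates `ε` and `1`. -/
theorem AbsolutelyDominates.exists_separatesBundles {f : M ≃ₘ^1⟮I, I⟯ M}
    (hf : HasBoundedDerivative I f) {Ec Eu : ∀ x : M, Submodule ℝ (TangentSpace I x)}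
    (hEc : IsTangentInvariant f Ec) (hEu : IsTangentInvariant f Eu)
    (hdom : AbsolutelyDominates f Eu Ec) {ε : ℝ} (hε : 0 < ε) :
    ∃ h : M ≃ₘ^1⟮I, I⟯ M, SeparatesBundles h Ec Eu ε := by
  by_cases hne : ∃ x, ∃ u ∈ Ec x, u ≠ 0
  · obtain ⟨n, a, ha, hc, hu⟩ := hdom.exists_rate hf hne
    obtain ⟨m, hm⟩ := exists_pow_lt_of_lt_one hε (by norm_num : (1 / 2 : ℝ) < 1)
    obtain ⟨C, hC0, hC⟩ := hf.exists_iterate_bound n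
    refine ⟨(f.iterate n).iterate m, (hEc.iterate n).iterate m, (hEu.iterate n).iterate m,
      HasBoundedDerivative.exists_iterate_bound ⟨C, hC⟩ m, a ^ m, pow_pos ha m,
      ((2 * a) ^ m)⁻¹, by positivity, ?_, ?_, ?_⟩
    · have : a ^ m * ((2 * a) ^ m)⁻¹ = (1 / 2) ^ m := by
        rw [mul_pow, one_div, inv_pow]; field_simp
      exact this.le.trans hm.le
    · exact Diffeomorph.norm_mfderiv_iterate_le
        (fun k x u hu => ((hEc.iterate n).iterate k).mfderiv_mem hu) ha.le hc m
    · exact Diffeomorph.norm_mfderiv_symm_le ((hEu.iterate n).iterate m) (by positivity)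
        (Diffeomorph.le_norm_mfderiv_iterate (hEu.iterate n) (by positivity) hu m)
  · push Not at hne
    refine ⟨f.iterate 0, hEc.iterate 0, hEu.iterate 0, hf.exists_iterate_bound 0, ε, hε, 1,
      one_pos, (mul_one ε).le, fun x u hu => ?_, fun x v _ => ?_⟩
    · simp [hne x u hu]
    · have h1 : mfderiv I I (f.iterate 0).symm x = ContinuousLinearMap.id ℝ _ := mfderiv_id
      rw [h1, one_mul]
      exact le_rfl

end Pushforward

/-! ### Consequences of domination: unique integrability, uniqueness, rectangles. -/

section Domination

open Filter

/-- The form in which arbitrarily strong separation of rates forces points to coincide; `K` must be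
finite and independent of `ε`. -/
theorem ENNReal.eq_zero_of_forall_le_ofReal_mul {e K : ℝ≥0∞} (hK : K ≠ ⊤)
    (h : ∀ ε : ℝ, 0 < ε → e ≤ ENNReal.ofReal ε * K) : e = 0 := by
  have h1 : Tendsto (fun ε : ℝ => ENNReal.ofReal ε * K) (𝓝[>] 0) (𝓝 0) := by
    have h2 : Tendsto (fun ε : ℝ => ENNReal.ofReal ε) (𝓝[>] 0) (𝓝 0) :=
      (ENNReal.continuous_ofReal.tendsto' 0 0 (by simp)).mono_left nhdsWithin_le_nhds
    simpa using ENNReal.Tendsto.mul_const h2 (Or.inr hK)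
  exact le_antisymm (ge_of_tendsto h1 (by
    filter_upwards [self_mem_nhdsWithin] with ε hε using h ε hε)) bot_le

variable {V : Type*} [NormedAddCommGroup V] [NormedSpace ℝ V] [FiniteDimensional ℝ V]
  {H : Type*} [TopologicalSpace H] {I : ModelWithCorners ℝ V H}
  {M : Type*} [EMetricSpace M] [ChartedSpace H M] [IsManifold I 1 M]
  [RiemannianBundle (fun x : M => TangentSpace I x)]
  [IsContinuousRiemannianBundle V (fun x : M => TangentSpace I x)]
  [IsRiemannianManifold I M]

/-- Quasi-isometric foliations `Wc` and `Wu` tangent to the summands of a uniquely integrable bundle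
`E = T W`, which are separated arbitrarily well by diffeomorphisms. -/
structure SeparatedFoliations (E Ec Eu : ∀ x : M, Submodule ℝ (TangentSpace I x))
    (W Wc Wu : Foliation I M) : Prop where
  integrable : IsUniquelyIntegrableBy E W
  continuous_left : IsContinuousSubbundle Ec
  continuous_right : IsContinuousSubbundle Eu
  sup_eq : ∀ x, Ec x ⊔ Eu x = E x
  tangent_left : Wc.IsTangentTo Ec
  tangent_right : Wu.IsTangentTo Eu
  quasiIsometric_left : Wc.IsQuasiIsometric
  quasiIsometric_right : Wu.IsQuasiIsometric
  separates : ∀ ε : ℝ, 0 < ε → ∃ h : M ≃ₘ^1⟮I, I⟯ M, SeparatesBundles h Ec Eu ε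

theorem Foliation.IsQuasiIsometric.exists_ennreal {W : Foliation I M} (h : W.IsQuasiIsometric) :
    ∃ Q : ℝ≥0∞, Q ≠ ⊤ ∧ ∀ x y, y ∈ W.leaf x → W.leafEDist x y ≤ Q * edist x y := by
  obtain ⟨Q, -, hQ⟩ := h
  exact ⟨_, ENNReal.ofReal_ne_top, hQ⟩

variable [CompleteSpace M] [LocallyCompactSpace M]
  {E Ec Eu : ∀ x : M, Submodule ℝ (TangentSpace I x)} {W Wc Wu : Foliation I M}

namespace SeparatedFoliations

theorem le_left (hs : SeparatedFoliations E Ec Eu W Wc Wu) (x : M) : Ec x ≤ E x :=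
  hs.sup_eq x ▸ le_sup_left

theorem le_right (hs : SeparatedFoliations E Ec Eu W Wc Wu) (x : M) : Eu x ≤ E x :=
  hs.sup_eq x ▸ le_sup_right

/-- The rates of the diffeomorphisms, in terms of distances. -/
theorem exists_edist_le (hs : SeparatedFoliations E Ec Eu W Wc Wu) {ε : ℝ} (hε : 0 < ε) :
    ∃ h : M ≃ₘ^1⟮I, I⟯ M, SeparatesBundles h Ec Eu ε ∧ ∃ a b C : ℝ≥0∞, a * b ≤ ENNReal.ofReal ε ∧
      b ≠ ⊤ ∧ C ≠ ⊤ ∧ (∀ x y, edist (h x) (h y) ≤ a * Wc.leafEDist x y) ∧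
      (∀ x y, edist (h x) (h y) ≤ C * Wu.leafEDist x y) ∧
      (∀ x y, edist (h.symm x) (h.symm y) ≤ b * Wu.leafEDist x y) ∧
      ∀ γ : ℝ → M, ContMDiffOn 𝓘(ℝ, ℝ) I 1 γ (Icc 0 1) →
        (∀ t ∈ Icc (0 : ℝ) 1, mfderivWithin 𝓘(ℝ, ℝ) I γ (Icc 0 1) t (1 : ℝ) ∈ Eu (γ t)) →
        ∀ s ∈ Icc (0 : ℝ) 1, ∀ t ∈ Icc (0 : ℝ) 1,
          edist (h.symm (γ s)) (h.symm (γ t)) ≤ b * pathELength I γ 0 1 := by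
  obtain ⟨h, hh⟩ := hs.separates ε hε
  refine ⟨h, hh, ?_⟩
  obtain ⟨C, hC0, hC⟩ := hh.exists_bound
  obtain ⟨a, ha0, b, hb0, hab, ha, hb⟩ := hh.exists_rates
  refine ⟨ENNReal.ofReal a, ENNReal.ofReal b, ENNReal.ofReal C, ?_, ENNReal.ofReal_ne_top,
    ENNReal.ofReal_ne_top, hs.tangent_left.edist_le_leafEDist h.contMDiff ha0 ha,
    hs.tangent_right.edist_le_leafEDist h.contMDiff hC0 (fun x u _ => hC x u),
    hs.tangent_right.edist_le_leafEDist h.symm.contMDiff hb0 hb, fun γ hγ hE => ?_⟩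
  · rw [← ENNReal.ofReal_mul ha0.le]
    exact ENNReal.ofReal_le_ofReal hab
  have key : ∀ s ∈ Icc (0 : ℝ) 1, ∀ t ∈ Icc (0 : ℝ) 1, s ≤ t →
      edist (h.symm (γ s)) (h.symm (γ t)) ≤ ENNReal.ofReal b * pathELength I γ 0 1 := by
    intro s hs t ht hst
    calc edist (h.symm (γ s)) (h.symm (γ t)) ≤ pathELength I (h.symm ∘ γ) s t :=
          edist_le_pathELength (γ := h.symm ∘ γ) hst hs.1 ht.2
            (h.symm.contMDiff.comp_contMDiffOn hγ)
      _ ≤ pathELength I (h.symm ∘ γ) 0 1 := pathELength_mono hs.1 ht.2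
      _ ≤ _ := pathELength_comp_le h.symm.contMDiff hγ (fun r hr => hb _ _ (hE r hr)) hb0.le
  intro s hs t ht
  rcases le_total s t with hst | hst
  · exact key s hs t ht hst
  · rw [edist_comm]; exact key t ht s hs hst

/-- The expanding bundle is uniquely integrable. -/
theorem isUniquelyIntegrableBy_right (hs : SeparatedFoliations E Ec Eu W Wc Wu) :
    IsUniquelyIntegrableBy Eu Wu := by
  refine ⟨hs.tangent_right, fun γ hγ hE t ht => ?_⟩
  have hstays : ∀ t ∈ Icc (0 : ℝ) 1, Wu.StaysInPlaque γ (𝓝[Icc 0 1] t) (γ t) := by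
    intro t₀ ht₀
    set p := γ t₀ with hp
    obtain ⟨Qc, hQc, hc⟩ := hs.quasiIsometric_left.exists_ennreal
    obtain ⟨Qu, hQu, hu⟩ := hs.quasiIsometric_right.exists_ennreal
    obtain ⟨φ, hφ, hpφ⟩ := Wu.cover p
    obtain ⟨ψ, hψ, hpψ⟩ := W.cover p
    -- `O'` is fixed before `ε`, thus before the foliation `h(Wc)` is known. The unit ball as target
    -- gives `d(q, p) ≤ 1`.
    obtain ⟨O', hO', hU⟩ := hs.integrable.exists_mem_leaf_inter_plaque hs.continuous_left
      hs.tangent_right hs.sup_eq hφ hψ hpφ hpψ (Metric.eball_mem_nhds p one_pos)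
    have hlen : pathELength I γ 0 1 ≠ ⊤ := by
      obtain ⟨C, hC⟩ := isCompact_Icc.exists_bound_of_continuousOn
        (hγ.continuousOn_norm_mfderivWithin zero_lt_one)
      simp only [norm_norm] at hC
      exact ((pathELength_le_of_norm_le zero_le_one le_rfl le_rfl hC).trans_lt
        ENNReal.ofReal_lt_top).ne
    have hcont : Tendsto γ (𝓝[Icc 0 1] t₀) (𝓝 p) := hγ.continuousOn t₀ ht₀
    refine Wu.staysInPlaque_of_chart hcont hφ hpφ ?_
    filter_upwards [hcont hO', hcont (φ.source_mem_nhds hpφ), self_mem_nhdsWithin,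
      hs.integrable.staysInPlaque hγ (fun t ht => hs.le_right _ (hE t ht)) ht₀ ψ hψ hpψ]
      with t htO htφ ht htψ
    -- Under `h⁻¹`, the route from `q` to `p` in `Wu` and then along `γ` shrinks by `b`; the
    -- resulting pair lies on one `Wc`-leaf, and `h` stretches it back only by `a * Qc`.
    have hclose : ∀ ε : ℝ, 0 < ε → ∃ q, edist q (γ t) ≤
        ENNReal.ofReal ε * (Qc * (Qu + pathELength I γ 0 1)) ∧ q ∈ φ.chart.source ∧
        (φ.chart q).2 = (φ.chart p).2 := by
      intro ε hε
      obtain ⟨h, hh, a, b, C, hab, -, -, hac, -, hbu, hbγ⟩ := hs.exists_edist_le hε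
      obtain ⟨q, hqO, hqF, hqφ, hq⟩ := hU (Wc.push h)
        (hs.tangent_left.push hh.invariant_left) (γ t) htO htψ
      refine ⟨q, ?_, hqφ, hq⟩
      have hq1 : edist q p ≤ 1 := le_of_lt hqO
      have h1 : h.symm q ∈ Wc.leaf (h.symm (γ t)) := Foliation.mem_leaf_push hqF
      have h2 : p ∈ Wu.leaf q := Wu.mem_leaf_of_snd_eq hφ hqφ hpφ hq
      have h3 : edist (h.symm q) (h.symm (γ t)) ≤ b * (Qu + pathELength I γ 0 1) := by
        calc edist (h.symm q) (h.symm (γ t))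
            ≤ edist (h.symm q) (h.symm p) + edist (h.symm p) (h.symm (γ t)) :=
              edist_triangle _ _ _
          _ ≤ b * (Qu * 1) + b * pathELength I γ 0 1 :=
              add_le_add ((hbu q p).trans (by gcongr; exact (hu q p h2).trans (by gcongr)))
                (hbγ γ hγ hE t₀ ht₀ t ht)
          _ = b * (Qu + pathELength I γ 0 1) := by rw [mul_one, mul_add]
      calc edist q (γ t) = edist (h (h.symm q)) (h (h.symm (γ t))) := by
            rw [h.apply_symm_apply, h.apply_symm_apply]
        _ ≤ a * (Qc * (b * (Qu + pathELength I γ 0 1))) :=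
            (hac _ _).trans (by
              gcongr
              exact (hc _ _ (Foliation.mem_leaf_symm h1)).trans (by gcongr))
        _ = a * b * (Qc * (Qu + pathELength I γ 0 1)) := by ring
        _ ≤ _ := by gcongr
    by_contra hne
    -- The plaque is closed in the chart, so points `q` of the plaque arbitrarily close to `γ t`
    -- force `γ t` into it.
    have hfar : {y | y ∈ φ.chart.source ∧ (φ.chart y).2 ≠ (φ.chart p).2} ∈ 𝓝 (γ t) := by
      filter_upwards [φ.source_mem_nhds htφ,
        (continuous_snd.continuousAt.comp (φ.chart.continuousAt htφ)).eventually_ne hne]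
        with y hy hy' using ⟨hy, hy'⟩
    obtain ⟨r, hr, hball⟩ := EMetric.mem_nhds_iff.1 hfar
    have hK : Qc * (Qu + pathELength I γ 0 1) ≠ ⊤ :=
      ENNReal.mul_ne_top hQc (ENNReal.add_ne_top.2 ⟨hQu, hlen⟩)
    refine hr.ne' (ENNReal.eq_zero_of_forall_le_ofReal_mul hK fun ε hε => ?_)
    obtain ⟨q, hqd, hqφ, hq⟩ := hclose ε hε
    by_contra hlt
    exact (hball (lt_of_le_of_lt hqd (not_le.1 hlt))).2 hq
  exact Foliation.StaysInPlaque.mem_leaf isPreconnected_Icc hγ.continuousOn hstays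
    (left_mem_Icc.2 zero_le_one) ht

/-- The expanding foliation is invariant. -/
theorem map_mem_leaf_right (hs : SeparatedFoliations E Ec Eu W Wc Wu) {h : M ≃ₘ^1⟮I, I⟯ M}
    (hh : IsTangentInvariant h Eu) {x y : M} (hxy : y ∈ Wu.leaf x) : h y ∈ Wu.leaf (h x) := by
  have h' : Relation.EqvGen Wu.SamePlaque x y := hxy
  clear hxy
  induction h' with
  | rel x y h1 =>
    obtain ⟨φ, hφ, hx, hy, hxy⟩ := h1
    set c := (φ.chart x).2
    set a := (φ.chart x).1
    set w := (φ.chart y).1 - a with hw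
    have e0 : φ.segment c a w 0 = x := by
      simp only [FoliatedChart.segment, zero_smul, add_zero]; exact φ.plaque_chart hx
    have e1 : φ.segment c a w 1 = y := by
      simp only [FoliatedChart.segment, one_smul, hw, add_sub_cancel]
      rw [hxy, φ.plaque_chart hy]
    have hσ := (φ.contMDiff_segment c a w).contMDiffOn (s := Icc 0 1)
    -- The image of a segment in a plaque is again tangent to `Eu`, so unique integrability keeps it
    -- in one leaf.
    have h2 := hs.isUniquelyIntegrableBy_right.2 (h ∘ φ.segment c a w)
      (h.contMDiff.comp_contMDiffOn hσ) (fun t ht => by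
        have h3 := mfderiv_comp_mfderivWithin (I := 𝓘(ℝ, ℝ)) t
          (h.mdifferentiable one_ne_zero (φ.segment c a w t))
          (hσ.mdifferentiableOn one_ne_zero t ht)
          (uniqueMDiffWithinAt_iff_uniqueDiffWithinAt.2 (uniqueDiffOn_Icc zero_lt_one t ht))
        rw [h3]
        exact hh.mfderiv_mem (hs.tangent_right.segment_mfderivWithin_mem hφ c a w ht)) 1
      (right_mem_Icc.2 zero_le_one)
    simpa only [Function.comp_apply, e0, e1] using h2
  | refl x => exact Wu.mem_leaf_self _
  | symm x y _ ih => exact Foliation.mem_leaf_symm ih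
  | trans x y z _ _ ih ih' => exact Foliation.mem_leaf_trans ih ih'

/-- A leaf of `Wc` and a leaf of `Wu` meet at most once. -/
theorem eq_of_mem_leaf (hs : SeparatedFoliations E Ec Eu W Wc Wu) {z z' : M}
    (hzc : z' ∈ Wc.leaf z) (hzu : z' ∈ Wu.leaf z) : z = z' := by
  obtain ⟨Qc, hQc, hc⟩ := hs.quasiIsometric_left.exists_ennreal
  obtain ⟨Qu, hQu, hu⟩ := hs.quasiIsometric_right.exists_ennreal
  have hK : Qu * (Qc * edist z z') ≠ ⊤ := ENNReal.mul_ne_top hQu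
    (ENNReal.mul_ne_top hQc (Foliation.edist_lt_top_of_mem_leaf hzc).ne)
  refine edist_eq_zero.1 (ENNReal.eq_zero_of_forall_le_ofReal_mul hK fun ε hε => ?_)
  obtain ⟨h, hh, a, b, C, hab, -, -, hac, -, hbu, -⟩ := hs.exists_edist_le hε
  have h1 := hs.map_mem_leaf_right hh.invariant_right hzu
  -- Forward along `Wc` costs `a * Qc`; back along `Wu`, between the images, costs `b * Qu`.
  calc edist z z' = edist (h.symm (h z)) (h.symm (h z')) := by
        rw [h.symm_apply_apply, h.symm_apply_apply]
    _ ≤ b * (Qu * (a * (Qc * edist z z'))) := (hbu _ _).trans (by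
        gcongr
        refine (hu _ _ h1).trans (by gcongr; exact (hac _ _).trans (by gcongr; exact hc _ _ hzc)))
    _ = a * b * (Qu * (Qc * edist z z')) := by ring
    _ ≤ _ := by gcongr

/-- The sides of a rectangle of `Wc`- and `Wu`-leaves are bounded in terms of two of them. -/
theorem exists_rectangle_bound (hs : SeparatedFoliations E Ec Eu W Wc Wu) :
    ∃ K : ℝ≥0∞, K ≠ ⊤ ∧ ∀ p q r s : M, q ∈ Wu.leaf p → r ∈ Wc.leaf q → s ∈ Wc.leaf p →
      r ∈ Wu.leaf s → edist s r ≤ K * (edist p q + edist q r) ∧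
        edist p s ≤ K * (edist p q + edist q r) := by
  obtain ⟨Qc, hQc, hc⟩ := hs.quasiIsometric_left.exists_ennreal
  obtain ⟨Qu, hQu, hu⟩ := hs.quasiIsometric_right.exists_ennreal
  -- With the factor `1/2`, the term `edist s r` that enters the bound through `edist p s` can be
  -- absorbed.
  obtain ⟨ε, hε, hεQ⟩ : ∃ ε : ℝ, 0 < ε ∧ ENNReal.ofReal ε * (Qu * Qc) ≤ 1 / 2 := by
    have h2 : Tendsto (fun ε : ℝ => ENNReal.ofReal ε) (𝓝[>] 0) (𝓝 0) :=
      (ENNReal.continuous_ofReal.tendsto' 0 0 (by simp)).mono_left nhdsWithin_le_nhds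
    have h1 : Tendsto (fun ε : ℝ => ENNReal.ofReal ε * (Qu * Qc)) (𝓝[>] 0) (𝓝 0) := by
      simpa using ENNReal.Tendsto.mul_const h2 (Or.inr (ENNReal.mul_ne_top hQu hQc))
    obtain ⟨ε, h3, h4⟩ := ((h1.eventually (gt_mem_nhds (by simp : (0 : ℝ≥0∞) < 1 / 2))).and
      self_mem_nhdsWithin).exists
    exact ⟨ε, h4, h3.le⟩
  obtain ⟨h, hh, a, b, C, hab, hb, hC, hac, hCu, hbu, -⟩ := hs.exists_edist_le hε
  set D := b * Qu * (C * Qu) with hD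
  have hDtop : D ≠ ⊤ := ENNReal.mul_ne_top (ENNReal.mul_ne_top hb hQu) (ENNReal.mul_ne_top hC hQu)
  refine ⟨3 + 2 * D, ENNReal.add_ne_top.2 ⟨by simp, ENNReal.mul_ne_top (by simp) hDtop⟩,
    fun p q r s hpq hqr hps hsr => ?_⟩
  have hsr_top : edist s r ≠ ⊤ := (Foliation.edist_lt_top_of_mem_leaf hsr).ne
  have hA : edist p s ≤ edist p q + edist q r + edist s r := by
    rw [edist_comm s r]
    exact edist_triangle4 _ _ _ _
  have h1 : edist (h s) (h r) ≤ a * (Qc * edist p s) + C * (Qu * edist p q) +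
      a * (Qc * edist q r) := by
    refine (edist_triangle4 _ (h p) (h q) _).trans (add_le_add (add_le_add ?_ ?_) ?_)
    · rw [edist_comm]; exact (hac _ _).trans (by gcongr; exact hc _ _ hps)
    · exact (hCu _ _).trans (by gcongr; exact hu _ _ hpq)
    · exact (hac _ _).trans (by gcongr; exact hc _ _ hqr)
  have h2 : edist s r ≤ 1 / 2 * (2 * edist q r + edist p q + edist s r) + D * edist p q := by
    calc edist s r = edist (h.symm (h s)) (h.symm (h r)) := by
          rw [h.symm_apply_apply, h.symm_apply_apply]
      _ ≤ b * (Qu * edist (h s) (h r)) := (hbu _ _).trans (by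
          gcongr; exact hu _ _ (hs.map_mem_leaf_right hh.invariant_right hsr))
      _ ≤ b * (Qu * (a * (Qc * edist p s) + C * (Qu * edist p q) + a * (Qc * edist q r))) := by
          gcongr
      _ = a * b * (Qu * Qc) * (edist p s + edist q r) + D * edist p q := by rw [hD]; ring
      _ ≤ 1 / 2 * (edist p q + edist q r + edist s r + edist q r) + D * edist p q := by
          gcongr
          exact (mul_le_mul_left hab _).trans hεQ
      _ = _ := by ring
  -- After doubling, one copy of `edist s r` is cancelled; this is legitimate because it is finite.
  have h3 : edist s r ≤ 2 * edist q r + edist p q + 2 * (D * edist p q) := by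
    refine ENNReal.le_of_add_le_add_left hsr_top ?_
    calc edist s r + edist s r = 2 * edist s r := (two_mul _).symm
      _ ≤ 2 * (1 / 2 * (2 * edist q r + edist p q + edist s r) + D * edist p q) := by gcongr
      _ = 2 * (1 / 2) * (2 * edist q r + edist p q + edist s r) + 2 * (D * edist p q) := by ring
      _ = edist s r + (2 * edist q r + edist p q + 2 * (D * edist p q)) := by
          rw [one_div, ENNReal.mul_inv_cancel (by simp) (by simp)]; ring
  have h4 : ∀ u v : ℝ≥0∞, 2 * v + u + 2 * (D * u) ≤ (2 + 2 * D) * (u + v) := fun u v =>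
    calc 2 * v + u + 2 * (D * u) ≤ 2 * v + u + 2 * (D * u) + (u + 2 * (D * v)) := le_self_add
      _ = _ := by ring
  have h5 : edist s r ≤ (2 + 2 * D) * (edist p q + edist q r) := h3.trans (h4 _ _)
  refine ⟨h5.trans (by gcongr; norm_num), hA.trans ?_⟩
  calc edist p q + edist q r + edist s r
      ≤ edist p q + edist q r + (2 + 2 * D) * (edist p q + edist q r) := by gcongr
    _ = _ := by ring

end SeparatedFoliations

end Domination

/-! ### Global product structure by connectedness. -/

section GlobalProduct

open Filter

section Slide

variable {V : Type*} [NormedAddCommGroup V] [NormedSpace ℝ V]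
  {H : Type*} [TopologicalSpace H] {I : ModelWithCorners ℝ V H}
  {M : Type*} [TopologicalSpace M] [ChartedSpace H M]

theorem Foliation.SamePlaque.symm {F : Foliation I M} {x y : M} (h : F.SamePlaque x y) :
    F.SamePlaque y x := by
  obtain ⟨φ, hφ, hx, hy, hxy⟩ := h
  exact ⟨φ, hφ, hy, hx, hxy.symm⟩

/-- The slid path copies the transverse coordinate of `γ` and keeps the leaf coordinate of `y`. -/
theorem Foliation.SamePlaque.exists_slide {F : Foliation I M} {x y : M} (h : F.SamePlaque x y)
    {t₀ : ℝ} {γ : ℝ → M} (hx : γ t₀ = x) (hγ : ∀ᶠ t in 𝓝 t₀, ContinuousAt γ t) :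
    ∃ γ' : ℝ → M, γ' t₀ = y ∧ (∀ᶠ t in 𝓝 t₀, ContinuousAt γ' t) ∧
      ∀ᶠ t in 𝓝 t₀, γ' t ∈ F.leaf (γ t) := by
  subst hx
  obtain ⟨φ, hφ, hx, hy, hxy⟩ := h
  have hsrc : ∀ᶠ t in 𝓝 t₀, γ t ∈ φ.chart.source :=
    hγ.self_of_nhds (φ.source_mem_nhds hx)
  refine ⟨fun t => φ.chart.symm ((φ.chart y).1, (φ.chart (γ t)).2), ?_, ?_, ?_⟩
  · show φ.chart.symm ((φ.chart y).1, (φ.chart (γ t₀)).2) = y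
    rw [hxy]
    exact φ.plaque_chart hy
  · filter_upwards [hγ, hsrc] with t ht hts
    have h1 : ContinuousAt (fun t => (φ.chart (γ t)).2) t :=
      continuous_snd.continuousAt.comp
        (ContinuousAt.comp (f := γ) (x := t) (φ.chart.continuousAt hts) ht)
    have h2 : ContinuousAt (fun t => ((φ.chart y).1, (φ.chart (γ t)).2)) t :=
      continuousAt_const.prodMk h1
    exact ContinuousAt.comp (f := fun t => ((φ.chart y).1, (φ.chart (γ t)).2)) (x := t)
      (φ.chart.symm.continuousAt (by simp [φ.target_eq])) h2
  · filter_upwards [hsrc] with t hts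
    refine F.mem_leaf_of_snd_eq hφ hts (φ.plaque_mem_source _ _) ?_
    exact (congrArg Prod.snd (φ.chart_plaque (φ.chart (γ t)).2 (φ.chart y).1)).symm

/-- A path can be slid along the leaves of a foliation. -/
theorem Foliation.exists_slide {F : Foliation I M} {x y : M} (h : y ∈ F.leaf x) {t₀ : ℝ}
    {γ : ℝ → M} (hx : γ t₀ = x) (hγ : ∀ᶠ t in 𝓝 t₀, ContinuousAt γ t) :
    ∃ γ' : ℝ → M, γ' t₀ = y ∧ (∀ᶠ t in 𝓝 t₀, ContinuousAt γ' t) ∧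
      ∀ᶠ t in 𝓝 t₀, γ' t ∈ F.leaf (γ t) := by
  let S : M → M → Prop := fun x y => ∀ γ : ℝ → M, γ t₀ = x → (∀ᶠ t in 𝓝 t₀, ContinuousAt γ t) →
    ∃ γ' : ℝ → M, γ' t₀ = y ∧ (∀ᶠ t in 𝓝 t₀, ContinuousAt γ' t) ∧
      ∀ᶠ t in 𝓝 t₀, γ' t ∈ F.leaf (γ t)
  have htrans : ∀ x y z, S x y → S y z → S x z := by
    intro x y z h1 h2 γ hx hγ
    obtain ⟨γ', hy, hγ', hl⟩ := h1 γ hx hγ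
    obtain ⟨γ'', hz, hγ'', hl'⟩ := h2 γ' hy hγ'
    exact ⟨γ'', hz, hγ'', by
      filter_upwards [hl, hl'] with t ht ht' using Foliation.mem_leaf_trans ht ht'⟩
  -- Both directions are proved together so that the induction survives the symmetry step.
  have key : S x y ∧ S y x := by
    have h' : Relation.EqvGen F.SamePlaque x y := h
    clear h hx
    induction h' with
    | rel x y h =>
      exact ⟨fun γ hx hγ => h.exists_slide hx hγ, fun γ hx hγ => h.symm.exists_slide hx hγ⟩
    | refl x =>
      have : S x x := fun γ hx hγ => ⟨γ, hx, hγ, Eventually.of_forall fun t => F.mem_leaf_self _⟩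
      exact ⟨this, this⟩
    | symm x y _ ih => exact ih.symm
    | trans x y z _ _ ih ih' => exact ⟨htrans _ _ _ ih.1 ih'.1, htrans _ _ _ ih'.2 ih.2⟩
  exact key.1 γ hx hγ

end Slide

variable {V : Type*} [NormedAddCommGroup V] [NormedSpace ℝ V] [FiniteDimensional ℝ V]
  {H : Type*} [TopologicalSpace H] {I : ModelWithCorners ℝ V H}
  {M : Type*} [EMetricSpace M] [ChartedSpace H M] [IsManifold I 1 M]
  [RiemannianBundle (fun x : M => TangentSpace I x)]
  [IsContinuousRiemannianBundle V (fun x : M => TangentSpace I x)]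
  [IsRiemannianManifold I M] [CompleteSpace M] [LocallyCompactSpace M]
  {E Ec Eu : ∀ x : M, Submodule ℝ (TangentSpace I x)} {W Wc Wu : Foliation I M}

theorem IsUniquelyIntegrableBy.leaf_subset {F : Foliation I M}
    {E₁ : ∀ x : M, Submodule ℝ (TangentSpace I x)} (hW : IsUniquelyIntegrableBy E W)
    (hF : F.IsTangentTo E₁) (hE : ∀ x, E₁ x ≤ E x) (x : M) : F.leaf x ⊆ W.leaf x := by
  intro y hy
  obtain ⟨T, -, σ, hσ, rfl, rfl⟩ := Foliation.exists_reach_of_mem_leaf hy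
  exact (hW.isLeafPath hF hE hσ).mem_leaf 0 T

/-- Bounded ambient distance on a leaf becomes one common travel time, as needed for limits of
families of leaf paths. -/
theorem Foliation.IsQuasiIsometric.exists_reach {F : Foliation I M} (hF : F.IsQuasiIsometric)
    {L : ℝ≥0∞} (hL : L ≠ ⊤) :
    ∃ K : ℝ, ∀ x y, y ∈ F.leaf x → edist x y ≤ L → F.Reach x y K := by
  obtain ⟨Q, hQ, h⟩ := hF.exists_ennreal
  have hQL : Q * L ≠ ⊤ := ENNReal.mul_ne_top hQ hL
  refine ⟨(Q * L).toReal + 1, fun x y hy hxy => Foliation.reach_of_leafEDist_lt ?_⟩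
  calc F.leafEDist x y ≤ Q * L := (h x y hy).trans (by gcongr)
    _ = ENNReal.ofReal (Q * L).toReal := (ENNReal.ofReal_toReal hQL).symm
    _ < _ := (ENNReal.ofReal_lt_ofReal_iff (by positivity)).2 (lt_add_one _)

namespace SeparatedFoliations

/-- Near a point `z`, the `Wu`-leaves of the points of the `W`-plaque of `z` meet the `Wc`-leaf
of `z`. -/
theorem eventually_exists_mem_leaf (hs : SeparatedFoliations E Ec Eu W Wc Wu)
    {ψ : FoliatedChart I M} (hψ : ψ ∈ W.atlas) {z : M} (hz : z ∈ ψ.chart.source) :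
    ∀ᶠ z' in 𝓝 z, (ψ.chart z').2 = (ψ.chart z).2 → ∃ q, q ∈ Wu.leaf z' ∧ q ∈ Wc.leaf z := by
  obtain ⟨φ, hφ, hzφ⟩ := Wc.cover z
  -- The local product theorem is used with the roles of `Ec` and `Eu` exchanged.
  obtain ⟨O', hO', hU⟩ := hs.integrable.exists_mem_leaf_inter_plaque hs.continuous_right
    hs.tangent_left (fun x => (sup_comm _ _).trans (hs.sup_eq x)) hφ hψ hzφ hz univ_mem
  filter_upwards [hO'] with z' hz' hzz'
  obtain ⟨q, -, hq, hqφ, hqz⟩ := hU Wu hs.tangent_right z' hz' hzz'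
  exact ⟨q, hq, Wc.mem_leaf_of_snd_eq hφ hzφ hqφ hqz.symm⟩

/-- The points of a leaf of `W` are joined by chains of leaves of `Wc` and `Wu`. -/
theorem chain_of_mem_leaf (hs : SeparatedFoliations E Ec Eu W Wc Wu) {x y : M}
    (hxy : y ∈ W.leaf x) :
    Relation.EqvGen (fun p q => q ∈ Wc.leaf p ∨ q ∈ Wu.leaf p) x y := by
  have h' : Relation.EqvGen W.SamePlaque x y := hxy
  clear hxy
  induction h' with
  | rel x y h =>
    obtain ⟨ψ, hψ, hx, hy, hxy⟩ := h
    set c := (ψ.chart x).2 with hc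
    -- Nearby points of a `W`-plaque are joined by a two-step chain; connectedness of the plaque
    -- joins all of them.
    let P := fun a b => Relation.EqvGen (fun p q => q ∈ Wc.leaf p ∨ q ∈ Wu.leaf p)
      (ψ.plaque c a) (ψ.plaque c b)
    have : Std.Symm P := ⟨fun _ _ => Relation.EqvGen.symm _ _⟩
    have key := PreconnectedSpace.induction₂ P (fun a => ?_)
      ⟨fun _ _ _ => Relation.EqvGen.trans _ _ _⟩ (ψ.chart x).1 (ψ.chart y).1
    · simp only [P, hxy, ψ.plaque_chart hy] at key
      rw [← hxy, ψ.plaque_chart hx] at key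
      exact key
    · filter_upwards [(ψ.continuous_plaque c).continuousAt.eventually
        (hs.eventually_exists_mem_leaf hψ (ψ.plaque_mem_source c a))] with b hb
      obtain ⟨q, hq, hq'⟩ := hb (by rw [ψ.chart_plaque, ψ.chart_plaque])
      exact .trans _ _ _ (.rel _ _ (Or.inl hq')) (.symm _ _ (.rel _ _ (Or.inr hq)))
  | refl x => exact Relation.EqvGen.refl x
  | symm x y _ ih => exact ih.symm _ _
  | trans x y z _ _ ih ih' => exact ih.trans _ _ _ ih'

/-- The set of parameters at which the `Wu`-leaf of a path in a `Wc`-leaf meets the `Wc`-leaf of `x`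
is open. -/
theorem isOpen_setOf_inter (hs : SeparatedFoliations E Ec Eu W Wc Wu) {γ : ℝ → M}
    (hγ : Continuous γ) (hleaf : ∀ t t', γ t' ∈ Wc.leaf (γ t)) (x : M) :
    IsOpen {t | ∃ s, s ∈ Wu.leaf (γ t) ∧ s ∈ Wc.leaf x} := by
  rw [isOpen_iff_mem_nhds]
  rintro t₀ ⟨s, hsu, hsc⟩
  -- Slid along `Wu`, the path starts at the intersection point `s` and stays in its `W`-plaque,
  -- where the local product structure finds points of the `Wc`-leaf of `s`, that is, of `x`.
  obtain ⟨γ', rfl, hγ', hl⟩ := Foliation.exists_slide hsu rfl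
    (Eventually.of_forall fun t => hγ.continuousAt)
  have hWl : ∀ᶠ t in 𝓝 t₀, γ' t ∈ W.leaf (γ t₀) := by
    filter_upwards [hl] with t ht
    exact Foliation.mem_leaf_trans
      (hs.integrable.leaf_subset hs.tangent_left hs.le_left _ (hleaf t₀ t))
      (hs.integrable.leaf_subset hs.tangent_right hs.le_right _ ht)
  obtain ⟨ψ, hψ, hsψ⟩ := W.cover (γ' t₀)
  have h1 : W.StaysInPlaque γ' (𝓝[univ] t₀) (γ' t₀) :=
    W.staysInPlaque_of_mem_leaf ordConnected_univ (mem_univ t₀)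
      (by rw [nhdsWithin_univ]; filter_upwards [hγ'] with t ht using ht.continuousWithinAt)
      (γ t₀) (by rwa [nhdsWithin_univ])
  rw [nhdsWithin_univ] at h1
  filter_upwards [h1 ψ hψ hsψ, hl, hγ'.self_of_nhds.eventually
    (hs.eventually_exists_mem_leaf hψ hsψ)] with t ht1 ht2 ht3
  obtain ⟨q, hqu, hqc⟩ := ht3 ht1
  exact ⟨q, Foliation.mem_leaf_trans ht2 hqu, Foliation.mem_leaf_trans hsc hqc⟩

/-- The set of parameters at which the `Wu`-leaf of a path in a `Wc`-leaf meets the `Wc`-leaf of `x`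
is closed. -/
theorem isClosed_setOf_inter (hs : SeparatedFoliations E Ec Eu W Wc Wu) {γ : ℝ → M}
    (hγ : Continuous γ) (hleaf : ∀ t t', γ t' ∈ Wc.leaf (γ t)) (x : M) :
    IsClosed {t | ∃ s, s ∈ Wu.leaf (γ t) ∧ s ∈ Wc.leaf x} := by
  set T := {t | ∃ s, s ∈ Wu.leaf (γ t) ∧ s ∈ Wc.leaf x} with hT
  rw [← closure_subset_iff_isClosed]
  intro t₀ ht₀
  obtain ⟨t₁, s₁, hs₁u, hs₁c⟩ := closure_nonempty_iff.1 ⟨t₀, ht₀⟩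
  have : Nonempty M := ⟨x⟩
  choose! s hsu hsc using fun t (ht : t ∈ T) => ht
  obtain ⟨K, hK, hrect⟩ := hs.exists_rectangle_bound
  -- A bound for the rectangle with corners `s₁`, `γ t₁`, `γ t`, `s t`; the `1` allows for the
  -- distance from `γ t` to `γ t₀`.
  set L := K * (edist s₁ (γ t₁) + (edist (γ t₁) (γ t₀) + 1)) with hL
  have hLtop : L ≠ ⊤ := ENNReal.mul_ne_top hK (ENNReal.add_ne_top.2
    ⟨(Foliation.edist_lt_top_of_mem_leaf (Foliation.mem_leaf_symm hs₁u)).ne, ENNReal.add_ne_top.2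
      ⟨(Foliation.edist_lt_top_of_mem_leaf (hleaf t₁ t₀)).ne, ENNReal.one_ne_top⟩⟩)
  obtain ⟨Ku, hKu⟩ := hs.quasiIsometric_right.exists_reach hLtop
  obtain ⟨Kc, hKc⟩ := hs.quasiIsometric_left.exists_reach hLtop
  have : NeBot (𝓝[T] t₀) := mem_closure_iff_nhdsWithin_neBot.1 ht₀
  let 𝒰 : Ultrafilter ℝ := Ultrafilter.of (𝓝[T] t₀)
  have h𝒰 : (𝒰 : Filter ℝ) ≤ 𝓝[T] t₀ := Ultrafilter.of_le _
  have hγ𝒰 : Tendsto γ 𝒰 (𝓝 (γ t₀)) :=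
    hγ.continuousAt.mono_left (h𝒰.trans nhdsWithin_le_nhds)
  have hreach : ∀ᶠ t in (𝒰 : Filter ℝ), Wu.Reach (γ t) (s t) Ku ∧ Wc.Reach s₁ (s t) Kc := by
    filter_upwards [h𝒰 self_mem_nhdsWithin, hγ𝒰 (Metric.eball_mem_nhds (γ t₀) one_pos)]
      with t ht htd
    have htd : edist (γ t) (γ t₀) < 1 := htd
    have hsc' : s t ∈ Wc.leaf s₁ :=
      Foliation.mem_leaf_trans (Foliation.mem_leaf_symm hs₁c) (hsc t ht)
    have hbd : K * (edist s₁ (γ t₁) + edist (γ t₁) (γ t)) ≤ L := by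
      rw [hL]
      gcongr
      refine (edist_triangle _ (γ t₀) _).trans ?_
      gcongr
      rw [edist_comm]
      exact htd.le
    obtain ⟨h1, h2⟩ := hrect s₁ (γ t₁) (γ t) (s t) (Foliation.mem_leaf_symm hs₁u) (hleaf t₁ t) hsc'
      (Foliation.mem_leaf_symm (hsu t ht))
    exact ⟨hKu _ _ (hsu t ht) (by rw [edist_comm]; exact h1.trans hbd),
      hKc _ _ hsc' (h2.trans hbd)⟩
  -- A path is attached to every `t`, arbitrary where no leaf path exists, so that limits can be
  -- taken along the ultrafilter.
  have hreachu : ∀ t, ∃ σ : ℝ → M, t ∈ {t | Wu.Reach (γ t) (s t) Ku} →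
      Wu.IsLeafPath σ ∧ σ 0 = γ t ∧ σ Ku = s t := fun t => by
    by_cases h : Wu.Reach (γ t) (s t) Ku
    · obtain ⟨σ, hσ⟩ := h
      exact ⟨σ, fun _ => hσ⟩
    · exact ⟨fun _ => s₁, fun h' => absurd h' h⟩
  have hreachc : ∀ t, ∃ σ : ℝ → M, t ∈ {t | Wc.Reach s₁ (s t) Kc} →
      Wc.IsLeafPath σ ∧ σ 0 = s₁ ∧ σ Kc = s t := fun t => by
    by_cases h : Wc.Reach s₁ (s t) Kc
    · obtain ⟨σ, hσ⟩ := h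
      exact ⟨σ, fun _ => hσ⟩
    · exact ⟨fun _ => s₁, fun h' => absurd h' h⟩
  choose σ hσ using hreachu
  choose ρ hρ using hreachc
  have hσ' := hreach.mono fun t h => hσ t h.1
  have hρ' := hreach.mono fun t h => hρ t h.2
  obtain ⟨σ', hσL, hσlim⟩ := Foliation.IsLeafPath.exists_ultrafilter_limit 𝒰 (t₀ := 0)
    (hσ'.mono fun t h => h.1) (hγ𝒰.congr' (hσ'.mono fun t h => h.2.1.symm))
  obtain ⟨ρ', hρL, hρlim⟩ := Foliation.IsLeafPath.exists_ultrafilter_limit 𝒰 (t₀ := 0)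
    (hρ'.mono fun t h => h.1) (tendsto_const_nhds.congr' (hρ'.mono fun t h => h.2.1.symm))
  have e1 : σ' 0 = γ t₀ := tendsto_nhds_unique_of_eventuallyEq (hσlim 0) hγ𝒰
    (hσ'.mono fun t h => h.2.1)
  have e2 : ρ' 0 = s₁ := tendsto_nhds_unique_of_eventuallyEq (hρlim 0) tendsto_const_nhds
    (hρ'.mono fun t h => h.2.1)
  -- Both families of paths end at `s t`, so the limit paths share an endpoint, which is the
  -- required intersection point over `t₀`.
  have e3 : σ' Ku = ρ' Kc := tendsto_nhds_unique_of_eventuallyEq (hσlim Ku) (hρlim Kc)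
    ((hσ'.and hρ').mono fun t h => h.1.2.2.trans h.2.2.2.symm)
  refine ⟨σ' Ku, e1 ▸ hσL.mem_leaf 0 Ku, Foliation.mem_leaf_trans hs₁c ?_⟩
  rw [e3, ← e2]
  exact hρL.mem_leaf 0 Kc

/-- Along a leaf path from `y` to `y'` the set of good parameters is clopen in `ℝ`, hence empty or
everything. -/
theorem exists_mem_inter_of_mem_leaf_left (hs : SeparatedFoliations E Ec Eu W Wc Wu) {x y y' : M}
    (hy : y' ∈ Wc.leaf y) :
    (∃ s, s ∈ Wu.leaf y ∧ s ∈ Wc.leaf x) ↔ ∃ s, s ∈ Wu.leaf y' ∧ s ∈ Wc.leaf x := by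
  obtain ⟨T, -, σ, hσ, rfl, rfl⟩ := Foliation.exists_reach_of_mem_leaf hy
  have h : IsClopen {t | ∃ s, s ∈ Wu.leaf (σ t) ∧ s ∈ Wc.leaf x} :=
    ⟨hs.isClosed_setOf_inter hσ.continuous hσ.mem_leaf x,
      hs.isOpen_setOf_inter hσ.continuous hσ.mem_leaf x⟩
  exact ⟨fun h0 => (h.eq_univ ⟨0, h0⟩).ge (mem_univ T),
    fun h0 => (h.eq_univ ⟨T, h0⟩).ge (mem_univ 0)⟩

/-- Global product structure of the leaves of `W`. -/
theorem existsUnique_mem_inter (hs : SeparatedFoliations E Ec Eu W Wc Wu) {x y : M}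
    (hxy : y ∈ W.leaf x) : ∃! z : M, z ∈ Wc.leaf x ∩ Wu.leaf y := by
  have key : ∀ p q, Relation.EqvGen (fun p q => q ∈ Wc.leaf p ∨ q ∈ Wu.leaf p) p q →
      ((∃ s, s ∈ Wu.leaf p ∧ s ∈ Wc.leaf x) ↔ ∃ s, s ∈ Wu.leaf q ∧ s ∈ Wc.leaf x) := by
    intro p q h
    induction h with
    | rel p q h =>
      rcases h with h | h
      · exact hs.exists_mem_inter_of_mem_leaf_left h
      · exact exists_congr fun s => and_congr_left fun _ =>
          ⟨fun hp => Foliation.mem_leaf_trans (Foliation.mem_leaf_symm h) hp,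
            fun hq => Foliation.mem_leaf_trans h hq⟩
    | refl p => exact Iff.rfl
    | symm p q _ ih => exact ih.symm
    | trans p q r _ _ ih ih' => exact ih.trans ih'
  -- The intersection property is transported along a chain from `x`, where the point `x` itself is
  -- an intersection.
  obtain ⟨z, hzu, hzc⟩ := (key x y (hs.chain_of_mem_leaf hxy)).1
    ⟨x, Wu.mem_leaf_self x, Wc.mem_leaf_self x⟩
  refine ⟨z, ⟨hzc, hzu⟩, fun z' hz' => ?_⟩
  exact hs.eq_of_mem_leaf (Foliation.mem_leaf_trans (Foliation.mem_leaf_symm hz'.1) hzc)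
    (Foliation.mem_leaf_trans (Foliation.mem_leaf_symm hz'.2) hzu)

end SeparatedFoliations

end GlobalProduct

theorem mainTheorem8
    {V : Type*} [NormedAddCommGroup V] [NormedSpace ℝ V] [FiniteDimensional ℝ V]
    {H : Type*} [TopologicalSpace H] (I : ModelWithCorners ℝ V H) [I.Boundaryless]
    {M : Type*} [EMetricSpace M] [CompleteSpace M] [ChartedSpace H M] [IsManifold I ∞ M]
    [RiemannianBundle (fun x : M => TangentSpace I x)]
    [IsContMDiffRiemannianBundle I ∞ V (fun x : M => TangentSpace I x)]
    [IsRiemannianManifold I M]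
    (f : M ≃ₘ^1⟮I, I⟯ M) (hf : HasBoundedDerivative I f)
    (E Ec Eu : ∀ x : M, Submodule ℝ (TangentSpace I x)) (W Wc Wu : Foliation I M)
    (hE : IsContinuousSubbundle E) (hEf : IsTangentInvariant f E)
    (hEW : IsUniquelyIntegrableBy E W)
    (hsplit : IsSplitting f E Ec Eu) (hdom : AbsolutelyDominates f Eu Ec)
    (hWc : Wc.IsTangentTo Ec) (hWcq : Wc.IsQuasiIsometric)
    (hWu : Wu.IsTangentTo Eu) (hWuq : Wu.IsQuasiIsometric)
    (x y : M) (hxy : y ∈ W.leaf x) :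
    ∃! z : M, z ∈ Wc.leaf x ∩ Wu.leaf y := by
  have : LocallyCompactSpace M := Manifold.locallyCompact_of_finiteDimensional I
  have : IsContinuousRiemannianBundle V (fun x : M => TangentSpace I x) := by
    obtain ⟨g, hg, hg'⟩ := IsContMDiffRiemannianBundle.exists_contMDiff (IB := I) (n := ∞) (F := V)
      (E := fun x : M => TangentSpace I x)
    exact ⟨g, hg.continuous, hg'⟩
  obtain ⟨hEc, hEcf, hEu, hEuf, hsum⟩ := hsplit
  have hs : SeparatedFoliations E Ec Eu W Wc Wu :=
    ⟨hEW, hEc, hEu, fun x => (hsum x).1, hWc, hWu, hWcq, hWuq,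
      fun ε hε => hdom.exists_separatesBundles hf hEcf hEuf hε⟩
  exact hs.existsUnique_mem_inter hxy
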